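/- **Conventions.** Let $X$ be an infinite-dimensional Banach space over $\mathbb K\in\{\mathbb R,\mathbb C\}$, with closed unit ball $B_X$, and let $\xi$ be an ordinal. A *tree* on a set $\Omega$ is a set $T$ of non-empty finite sequences in $\Omega$ containing every non-empty initial segment of its members; $MAX(T)$ is the set of members of $T$ that are maximal for the initial segment order $\leqslant$ (this notation is used for arbitrary sets of finite sequences); $T^0=T$, $T^{\zeta+1}=T^\zeta\setminus MAX(T^\zeta)$, $T^\zeta=\bigcap_{\eta<\zeta}T^\eta$ for limit $\zeta$ (likewise for $T\cup\{\varnothing\}$), and $\mathrm{rank}(T)$ is the least $\zeta$ with $T^\zeta=\varnothing$. The body $[T]$ is the set of infinite sequences all of whose non-empty finite initial segments lie in $T$. For a non-empty finite sequence $s$, $s^-$ is $s$ with its last term removed. **$\xi$-AUF norms.** A collection $(x_t)_{t\in T}\subset X$ is *weakly null* if for every ordinal $\zeta$ and every $t\in (T\cup\{\varnothing\})^{\zeta+1}$, $0$ is in the weak closure of $\{x_s: s\in T^\zeta,\ s^-=t\}$. For an equivalent norm $|\cdot|$ on $X$, $\sigma>0$ and $y\in X$, let $$\varrho^\xi_{|\cdot|}(\sigma,y)=\sup\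 \inf\bigl\{|y+\sigma x|-1:\ t\in T,\ x\in \mathrm{co}\{x_s:\varnothing<s\leqslant t\}\bigr\},$$ the supremum being over all trees $T$ of rank $\omega^\xi$ and all weakly null collections $(x_t)_{t\in T}$ with $|x_t|\leqslant 1$ for all $t$, and let $\varrho^\xi_{|\cdot|}(\sigma)=\sup_{|y|\leqslant 1}\varrho^\xi_{|\cdot|}(\sigma,y)$. The norm $|\cdot|$ is *$\xi$-asymptotically uniformly flat* ($\xi$-AUF) if $\varrho^\xi_{|\cdot|}(\sigma_0)=0$ for some $\sigma_0>0$. **The trees.** For an ordinal $\alpha$ and a sequence of ordinals $t=(\zeta_i)_i$, let $\alpha+t=(\alpha+\zeta_i)_i$. Define trees $\Gamma_{\xi,n}$ on $[0,\omega^\xi n)$ and weights $\mathbb P_{\xi,n}:\Gamma_{\xi,n}\to[0,1]$, $n\geqslant 1$, as follows. * $\Gamma_{0,1}=\{(0)\}$, $\mathbb P_{0,1}((0))=1$. * $\Gamma_{\xi,n+1}$ is the union of $L=\{\omega^\xi n+t:t\in\Gamma_{\xi,1}\}$ and $\{s\smallfrown t: s\in MAX(L),\ t\in\Gamma_{\xi,n}\}$,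 with $\mathbb P_{\xi,n+1}(\omega^\xi n+t)=\mathbb P_{\xi,1}(t)$ and $\mathbb P_{\xi,n+1}(s\smallfrown t)=\mathbb P_{\xi,n}(t)$. * $\Gamma_{\xi+1,1}=\bigcup_{n\geqslant1}\Gamma_{\xi,n}$ (a disjoint union), with $\mathbb P_{\xi+1,1}=\frac1n\mathbb P_{\xi,n}$ on $\Gamma_{\xi,n}$. * For limit $\xi$, $\Gamma_{\xi,1}=\bigcup_{\zeta<\xi}(\omega^\zeta+\Gamma_{\zeta+1,1})$ (a disjoint union), with $\mathbb P_{\xi,1}(\omega^\zeta+t)=\mathbb P_{\zeta+1,1}(t)$. Let $\Lambda_1=\Gamma_{\xi,1}$, $\Lambda_{i+1}=\{s\smallfrown(\omega^\xi i+t): s\in MAX(\Lambda_i),\ t\in\Gamma_{\xi,1}\}$ and $\Gamma_{\xi,\infty}=\bigcup_{i\geqslant1}\Lambda_i$ (a disjoint union), with $\mathbb P_{\xi,\infty}=\mathbb P_{\xi,1}$ on $\Lambda_1$ and $\mathbb P_{\xi,\infty}(s\smallfrown(\omega^\xi i+t))=\mathbb P_{\xi,1}(t)$ on $\Lambda_{i+1}$.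 For $\tau\in[\Gamma_{\xi,\infty}]$ let $\lambda_0(\tau)=\varnothing$ and, for $n\geqslant1$, let $\lambda_n(\tau)$ be the initial segment of $\tau$ belonging to $MAX(\Lambda_n)$. **The game.** Let $D$ be the set of all $B_Z=Z\cap B_X$, $Z$ a closed subspace of $X$ of finite codimension. Let $\mathfrak c,\mathfrak f,\mathfrak s$ be, respectively, the sets of non-empty norm compact, non-empty finite, and singleton subsets of $B_X$. Let $\mathfrak g$ be one of these and let $C>0$. On turn $i=1,2,\dots$, Player $S$ chooses an ordinal $\zeta_i$ with $(\zeta_1,\dots,\zeta_i)\in\Gamma_{\xi,\infty}$ and a set $u_i\in D$, and then Player $V$ chooses $G_i\in\mathfrak g$ with $G_i\subset u_i$. Player $S$ wins if the resulting $\tau=(\zeta_i)_{i=1}^\infty$ and $(G_i)_{i=1}^\infty$ satisfy $$\sup\Bigl\{\ \sum_{n=1}^\infty\Bigl|x^*\Bigl(\sum_{\lambda_{n-1}(\tau)<t\leqslant\lambda_n(\tau)}\mathbb P_{\xi,\infty}(t)\,x_{|t|}\Bigr)\Bigr|\ :\ x^*\in B_{X^*},\ (x_i)_{i=1}^\infty\in\prod_{i=1}^\infty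 G_i\Bigr\}\leqslant C,$$ where $|t|$ is the length of $t$ and $t$ ranges over initial segments of $\tau$. This is the $(\mathcal E^\infty_C,\mathfrak g,\Gamma_{\xi,\infty})$ game. A strategy for Player $S$ is a function assigning to each position $(\zeta_i,G_i)_{i=1}^n$, $n\geqslant 0$, a legal choice $(\zeta_{n+1},u_{n+1})$; it is winning if Player $S$ wins every play in which Player $S$ follows it. **Theorem.** For every infinite-dimensional Banach space $X$ and every ordinal $\xi$, the following are equivalent. 1. $X$ admits an equivalent $\xi$-AUF norm. 2. There exists $C>0$ such that Player $S$ has a winning strategy in the $(\mathcal E^\infty_C,\mathfrak c,\Gamma_{\xi,\infty})$ game. 3. There exists $C>0$ such that Player $S$ has a winning strategy in the $(\mathcal E^\infty_C,\mathfrak f,\Gamma_{\xi,\infty})$ game. 4. There exists $C>0$ such that Player $S$ has a winning strategy in the $(\mathcal E^\infty_C,\mathfrak s,\Gamma_{\xi,\infty})$ game. -/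

import Mathlib

/-! Trees, two-player games, the special weighted trees on the ordinals, the modulus of
asymptotic smoothness of order `ξ`, and the game attached to weakly `1`-summing block sequences. -/

universe u v w

noncomputable section

namespace AUFGame

/-! ### Trees of finite sequences -/

section Trees

variable {Ω : Type w}

/-- The initial segment `α|n` of length `n` of an infinite sequence. -/
def initSeg (α : ℕ → Ω) (n : ℕ) : List Ω := (List.range n).map α

/-- A tree: a set of non-empty finite sequences containing all non-empty initial segments of its
members. -/
def IsTree (T : Set (List Ω)) : Prop :=
  [] ∉ T ∧ ∀ s t : List Ω, t ∈ T → s <+: t → s ≠ [] → s ∈ T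

/-- `MAX(T)`: the members which are maximal for the initial segment ordering. -/
def maxNodes (T : Set (List Ω)) : Set (List Ω) :=
  {t | t ∈ T ∧ ∀ s ∈ T, t <+: s → s = t}

/-- The transfinite derivatives: `T^0 = T`, `T^(ζ+1) = T^ζ \ MAX(T^ζ)`, and intersections at
limit ordinals. -/
def treeDeriv (T : Set (List Ω)) (ζ : Ordinal.{v}) : Set (List Ω) :=
  Ordinal.limitRecOn (motive := fun _ => Set (List Ω)) ζ T
    (fun _ S => S \ maxNodes S)
    (fun ζ _ ih => ⋂ (η : Ordinal.{v}) (h : η < ζ), ih η h)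

/-- `rank(T) = α`, i.e. `α` is the least ordinal with `T^α = ∅`. -/
def HasRank (T : Set (List Ω)) (α : Ordinal.{v}) : Prop :=
  treeDeriv T α = ∅ ∧ ∀ β < α, treeDeriv T β ≠ ∅

/-- The body `[T]`: infinite sequences all of whose non-empty initial segments lie in `T`. -/
def body (T : Set (List Ω)) : Set (ℕ → Ω) :=
  {τ | ∀ n, initSeg τ (n + 1) ∈ T}

/-- `T.𝔤`: sequences of pairs whose first coordinates form a member of `T`, and whose second
coordinates belong to `𝔤`. -/
def dot {E : Type u} (T : Set (List Ω)) (𝔤 : Set E) : Set (List (Ω × E)) :=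
  {a | a.map Prod.fst ∈ T ∧ ∀ e ∈ a, e.2 ∈ 𝔤}

/-- `[T].𝔤`. -/
def bodyDot {E : Type u} (T : Set (List Ω)) (𝔤 : Set E) : Set (ℕ → Ω × E) :=
  {α | (fun i => (α i).1) ∈ body T ∧ ∀ i, (α i).2 ∈ 𝔤}

end Trees

/-! ### Games -/

section Games

variable {Ω : Type w} {B : Type u}

/-- A strategy for Player S: from the position `a` (the empty position or a member of `T.𝔤`) it
prescribes a pair `(ζ, u)` with `u ∈ D` such that appending `ζ` keeps the play inside `T`. -/
def IsStrategyS (T : Set (List Ω)) (D 𝔤 : Set (Set B))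
    (χ : List (Ω × Set B) → Ω × Set B) : Prop :=
  ∀ a, a = [] ∨ a ∈ dot T 𝔤 → a.map Prod.fst ++ [(χ a).1] ∈ T ∧ (χ a).2 ∈ D

/-- The infinite play `α = (ζᵢ, Gᵢ)` arises when Player S follows `χ`: at each turn the node is the
one prescribed by `χ`, and the reply of Player V is contained in the set prescribed by `χ`. -/
def IsAdmissible (χ : List (Ω × Set B) → Ω × Set B) (α : ℕ → Ω × Set B) : Prop :=
  ∀ n, (α n).1 = (χ (initSeg α n)).1 ∧ (α n).2 ⊆ (χ (initSeg α n)).2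

/-- Player S has a winning strategy in the game with target set `E`, in which Player S chooses
nodes of `T` and members of `D`, and Player V chooses members of `𝔤`. -/
def PlayerSWins (E : Set (ℕ → Ω × Set B)) (T : Set (List Ω)) (D 𝔤 : Set (Set B)) : Prop :=
  ∃ χ : List (Ω × Set B) → Ω × Set B, IsStrategyS T D 𝔤 χ ∧
    ∀ α ∈ bodyDot T 𝔤, IsAdmissible χ α → α ∈ E

end Games

/-! ### The trees `Γ_{ξ,n}` and `Γ_{ξ,∞}` with their weights -/

/-- A set of finite sequences of ordinals together with a real weight for each of its members
(values of `wt` outside `nodes` are irrelevant). -/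
structure WTree where
  nodes : Set (List Ordinal.{v})
  wt : List Ordinal.{v} → ℝ

namespace WTree

/-- `α + W`, with `wt (α + t) = wt t`. -/
def shift (α : Ordinal.{v}) (W : WTree.{v}) : WTree.{v} where
  nodes := (fun t => t.map (fun ζ => α + ζ)) '' W.nodes
  wt t := W.wt (t.map (fun ζ => ζ - α))

/-- Multiplication of the weights by a constant. -/
def scale (c : ℝ) (W : WTree.{v}) : WTree.{v} where
  nodes := W.nodes
  wt t := c * W.wt t

open Classical in
/-- The union of a family with pairwise disjoint node sets, each piece keeping its weights. -/
def iUnion {ι : Type w} (W : ι → WTree.{v}) : WTree.{v} where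
  nodes := ⋃ i, (W i).nodes
  wt t := if h : ∃ i, t ∈ (W i).nodes then (W h.choose).wt t else 0

open Classical in
/-- `{s ⌢ t : s ∈ MAX(S), t ∈ W}`, with `wt (s ⌢ t) = wt t`; the representation `s ⌢ t` is unique,
since distinct members of `MAX(S)` are incomparable. -/
def graft (S : Set (List Ordinal.{v})) (W : WTree.{v}) : WTree.{v} where
  nodes := {a | ∃ t ∈ W.nodes, ∃ s ∈ maxNodes S, a = s ++ t}
  wt a := if h : ∃ t ∈ W.nodes, ∃ s ∈ maxNodes S, a = s ++ t then W.wt h.choose else 0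

/-- The tree with the single node `(0)`, of weight `1`. -/
def single : WTree.{v} where
  nodes := {[0]}
  wt _ := 1

/-- Given `W = Γ_{ξ,1}`, the tree `Γ_{ξ,n}`: the first level of `Γ_{ξ,n+1}` is
`ω^ξ · n + Γ_{ξ,1}`, and below each maximal member of that level there is a copy of `Γ_{ξ,n}`.
Starting from `Γ_{ξ,0} = ∅`, one gets back `Γ_{ξ,1} = W`. -/
def stack (ξ : Ordinal.{v}) (W : WTree.{v}) : ℕ → WTree.{v}
  | 0 => ⟨∅, fun _ => 0⟩
  | n + 1 =>
      let top := shift (Ordinal.omega0 ^ ξ * n) W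
      iUnion (fun b : Bool => if b then top else graft top.nodes (stack ξ W n))

end WTree

/-- The tree `Γ_{ξ,1}` with the weights `ℙ_{ξ,1}`:
`Γ_{0,1} = {(0)}`; `Γ_{ξ+1,1}` is the union of the `Γ_{ξ,n}`, `n ≥ 1`, with weights
`ℙ_{ξ,n} / n`; and for a limit ordinal `ξ`, `Γ_{ξ,1}` is the union of the `ω^ζ + Γ_{ζ+1,1}`,
`ζ < ξ`, with the weights `ℙ_{ζ+1,1}`. -/
def Gamma (ξ : Ordinal.{v}) : WTree.{v} :=
  Ordinal.limitRecOn (motive := fun _ => WTree.{v}) ξ WTree.single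
    (fun ξ W => WTree.iUnion (fun n : ℕ =>
      WTree.scale (1 / ((n : ℝ) + 1)) (WTree.stack ξ W (n + 1))))
    (fun ξ hξ ih => WTree.iUnion (fun ζ : Set.Iio ξ =>
      WTree.shift (Ordinal.omega0 ^ ζ.1) (ih (ζ.1 + 1) (hξ.add_one_lt ζ.2))))

/-- The levels of `Γ_{ξ,∞}` with their weights; `level ξ i` is the `(i+1)`-st level
`Λ_{ξ,∞,i+1}`. -/
def level (ξ : Ordinal.{v}) : ℕ → WTree.{v}
  | 0 => Gamma ξ
  | i + 1 => WTree.graft (level ξ i).nodes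
      (WTree.shift (Ordinal.omega0 ^ ξ * ((i + 1 : ℕ) : Ordinal.{v})) (Gamma ξ))

/-- The tree `Γ_{ξ,∞}` with the weights `ℙ_{ξ,∞}`. -/
def GammaInf (ξ : Ordinal.{v}) : WTree.{v} := WTree.iUnion (level ξ)

/-- The length of `λ_n(τ)`, where `λ_0(τ)` is the empty sequence and `λ_n(τ)` is the initial
segment of `τ` which is a maximal member of the `n`-th level of `Γ_{ξ,∞}`. -/
def cut (ξ : Ordinal.{v}) (τ : ℕ → Ordinal.{v}) : ℕ → ℕ
  | 0 => 0
  | n + 1 => sInf {k | initSeg τ k ∈ maxNodes (level ξ n).nodes}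

/-! ### Banach space notions -/

section Banach

variable (𝕜 : Type*) [RCLike 𝕜] {X : Type u} [NormedAddCommGroup X] [NormedSpace 𝕜 X]

/-- A collection `(x_t)_{t ∈ T}` is weakly null if for every `ζ` and `t ∈ (T ∪ {∅})^(ζ+1)`, `0`
lies in the weak closure of `{x_s : s ∈ T^ζ, s⁻ = t}`. -/
def WeaklyNull {Ω : Type w} (T : Set (List Ω)) (x : List Ω → X) : Prop :=
  ∀ (ζ : Ordinal.{v}), ∀ t ∈ treeDeriv (insert [] T) (ζ + 1),
    (0 : WeakSpace 𝕜 X) ∈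
      closure ((fun s => toWeakSpace 𝕜 X (x s)) '' {s | s ∈ treeDeriv T ζ ∧ s.dropLast = t})

/-- `co(x_s)_{∅ < s ≤ t}`: the convex combinations of the branch of the collection ending at `t`. -/
def branchHull {Ω : Type w} (x : List Ω → X) (t : List Ω) : Set X :=
  {z | ∃ c : ℕ → ℝ, (∀ i, 0 ≤ c i) ∧ ∑ i ∈ Finset.range t.length, c i = 1 ∧
    z = ∑ i ∈ Finset.range t.length, ((c i : ℝ) : 𝕜) • x (t.take (i + 1))}

variable {𝕜}

/-- `p` is a norm on `X` equivalent to the given one. -/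
def IsEquivNorm (p : Seminorm 𝕜 X) : Prop :=
  ∃ a b : ℝ, 0 < a ∧ 0 < b ∧ ∀ x : X, a * ‖x‖ ≤ p x ∧ p x ≤ b * ‖x‖

/-- `ϱ^ξ(σ, y)` for the space `X` normed by the equivalent norm `p`: the supremum of
`inf {p (y + σ z) - 1 : t ∈ T, z ∈ co(x_s)_{s ≤ t}}` over all trees `T` of rank `ω^ξ` and all
weakly null collections `(x_t)_{t ∈ T}` in the closed unit ball of `p`. (Equivalent norms have the
same weak topology. For `0 ≤ σ` the set of values is non-empty, and is bounded by
`p y + σ - 1`.) -/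
def modulusAt (p : Seminorm 𝕜 X) (ξ : Ordinal.{v}) (σ : ℝ) (y : X) : ℝ :=
  sSup {r : ℝ | ∃ (Ω : Type (max u v)) (T : Set (List Ω)) (x : List Ω → X),
    IsTree T ∧ HasRank T (Ordinal.omega0 ^ ξ) ∧ (∀ t ∈ T, p (x t) ≤ 1) ∧
    WeaklyNull.{u, v} 𝕜 T x ∧
    r = sInf {s : ℝ | ∃ t ∈ T, ∃ z ∈ branchHull 𝕜 x t, s = p (y + ((σ : ℝ) : 𝕜) • z) - 1}}

/-- `ϱ^ξ(σ)`, the supremum of `ϱ^ξ(σ, y)` over the closed unit ball of `p`. -/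
def modulus (p : Seminorm 𝕜 X) (ξ : Ordinal.{v}) (σ : ℝ) : ℝ :=
  sSup {r : ℝ | ∃ y : X, p y ≤ 1 ∧ r = modulusAt p ξ σ y}

/-- The norm `p` is `ξ`-asymptotically uniformly flat: `ϱ^ξ(σ₀) = 0` for some `σ₀ > 0`. -/
def IsAUF (p : Seminorm 𝕜 X) (ξ : Ordinal.{v}) : Prop :=
  ∃ σ₀ : ℝ, 0 < σ₀ ∧ modulus p ξ σ₀ = 0

variable (𝕜 X)

/-- `CD(X)`: the closed unit balls of the closed subspaces of finite codimension. -/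
def CD : Set (Set X) :=
  {U | ∃ Z : Submodule 𝕜 X, IsClosed (Z : Set X) ∧ FiniteDimensional 𝕜 (X ⧸ Z) ∧
    U = (Z : Set X) ∩ Metric.closedBall 0 1}

/-- The non-empty norm compact subsets of the closed unit ball. -/
def compactMoves (X : Type u) [NormedAddCommGroup X] : Set (Set X) :=
  {G | IsCompact G ∧ G.Nonempty ∧ G ⊆ Metric.closedBall 0 1}

/-- The non-empty finite subsets of the closed unit ball. -/
def finiteMoves (X : Type u) [NormedAddCommGroup X] : Set (Set X) :=
  {G | G.Finite ∧ G.Nonempty ∧ G ⊆ Metric.closedBall 0 1}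

/-- The singleton subsets of the closed unit ball. -/
def singletonMoves (X : Type u) [NormedAddCommGroup X] : Set (Set X) :=
  {G | ∃ x ∈ Metric.closedBall (0 : X) 1, G = {x}}

variable {X}

/-- The weakly `1`-summing norm `sup {∑ₙ |f (xₙ)| : f ∈ B_{X*}}` of a sequence. -/
def weakOneNorm (x : ℕ → X) : ENNReal :=
  ⨆ (f : X →L[𝕜] 𝕜) (_ : ‖f‖ ≤ 1), ∑' n, ‖f (x n)‖ₑ

/-- The `n`-th block `∑_{λ_n(τ) < t ≤ λ_{n+1}(τ)} ℙ_{ξ,∞}(t) x_{|t|}`, with `n` and the sequence `x`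
indexed from `0`. -/
def block (ξ : Ordinal.{v}) (τ : ℕ → Ordinal.{v}) (x : ℕ → X) (n : ℕ) : X :=
  ∑ k ∈ Finset.Ico (cut ξ τ n) (cut ξ τ (n + 1)),
    (((GammaInf ξ).wt (initSeg τ (k + 1)) : ℝ) : 𝕜) • x k

variable (X)

/-- The target set `𝓔^∞_C`: the plays `τ.γ` in `[Γ_{ξ,∞}].𝔠` such that the block sequence of every
`(x_i) ∈ ∏ γ` is weakly `1`-summing with constant `C`. -/
def targetSet (ξ : Ordinal.{v}) (C : ℝ) : Set (ℕ → Ordinal.{v} × Set X) :=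
  {α | α ∈ bodyDot (GammaInf ξ).nodes (compactMoves X) ∧
    (⨆ (x : ℕ → X) (_ : ∀ i, x i ∈ (α i).2),
      weakOneNorm 𝕜 (block 𝕜 ξ (fun i => (α i).1) x)) ≤ ENNReal.ofReal C}

end Banach

end AUFGame

end

/-! Norms and games are linked by an ordinal derivative, `Survives`. A set of functionals survives
the clock `α` if it is non-empty and, for each `β < α`, the ball of every closed subspace of finite
codimension contains a point whose constraint leaves a part surviving `β`. Surviving `ω ^ ξ` is tied
to weakly null trees of rank `ω ^ ξ` (`exists_tree_of_survives`,
`IsDualBody.survives_of_weaklyNull`) and to one block of the game: the entries of a branch of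
`Γ_{ξ,1}` decrease below `ω ^ ξ`, so Player S runs the clock by choosing nodes
(`exists_follows_of_survives`).

1 implies 2. A functional that is large on an average of many terms is large on many of the terms;
iterating, if it happens frequently that averages along `Γ_{ξ,1}` are large, then the functionals
survive `ω ^ ξ` (`survives_of_avgFilter`) and produce a weakly null tree. In a flat norm this is
impossible, so adding a fixed small multiple of a suitable average to `y` raises the norm above `max
1 (p y)` by at most `ε` (`eventually_avgFilter_of_le`). Finite nets pass from points to compact
sets, and `forcesSum_Gamma` turns what is eventual along averages into something Player S can force.
With errors `2⁻¹, 2⁻², …` on successive blocks, all unimodular combinations of (scaled) blocks keep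
`p`-norm at most `2`, which bounds the weakly 1-summing norm.

2 implies 3 and 3 implies 4 because Player V has fewer moves.

4 implies 1. Given a winning strategy, let `K` be the set of `φ` for which `‖φ‖` plus the sum of
`|φ(block)|` is at most `1` along every run, and let `p` be the supremum over `K`. If `p` were not
flat, a weakly null tree would make `K` survive `ω ^ ξ`. Take a weak-star cluster point `φ₀` all of
whose neighbourhoods survive. Functionals of `K` near `φ₀` can be made to pay for one further block,
so `φ₀` has budget to spare: its total along each run is smaller than `Re φ₀ y` by a fixed amount. A
multiple of `φ₀` then lies in `K` and exceeds `1` at `y`, contradicting `p y ≤ 1`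
(`not_survives_strategyBody`). -/

namespace AUFGame

open Filter Topology Ordinal

/-! ### Derivatives of sets along a filter -/

section Clock

variable {B : Type*} {I : Type*}

/-- `Survives F P α S`: Player V, choosing points frequently along `F`, can keep the set of
constraints `S ∩ P x₁ ∩ P x₂ ∩ ⋯` non-empty while the opponent's ordinal clock runs down
from `α`. -/
def Survives (F : Filter B) (P : B → Set I) (α : Ordinal.{v}) (S : Set I) : Prop :=
  S.Nonempty ∧ ∀ β, β < α → ∃ᶠ x in F, Survives F P β (S ∩ P x)
termination_by α

variable {F : Filter B} {P : B → Set I}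

theorem survives_iff {α : Ordinal.{v}} {S : Set I} :
    Survives F P α S ↔ S.Nonempty ∧ ∀ β < α, ∃ᶠ x in F, Survives F P β (S ∩ P x) := by
  rw [Survives]

theorem Survives.nonempty {α : Ordinal.{v}} {S : Set I} (h : Survives F P α S) : S.Nonempty :=
  (survives_iff.1 h).1

theorem Survives.frequently {α β : Ordinal.{v}} {S : Set I} (h : Survives F P α S) (hβ : β < α) :
    ∃ᶠ x in F, Survives F P β (S ∩ P x) :=
  (survives_iff.1 h).2 β hβ

theorem Survives.mono {α : Ordinal.{v}} {S S' : Set I} (h : Survives F P α S) (hS : S ⊆ S') :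
    Survives F P α S' := by
  induction α using WellFoundedLT.induction generalizing S S' with
  | ind α ih =>
    rw [survives_iff] at h ⊢
    exact ⟨h.1.mono hS, fun β hβ => (h.2 β hβ).mono fun x hx =>
      ih β hβ hx (Set.inter_subset_inter_left _ hS)⟩

theorem Survives.anti {α β : Ordinal.{v}} {S : Set I} (h : Survives F P α S) (hβ : β ≤ α) :
    Survives F P β S := by
  rw [survives_iff] at h ⊢
  exact ⟨h.1, fun γ hγ => h.2 γ (hγ.trans_le hβ)⟩

theorem survives_zero_iff {S : Set I} : Survives F P (0 : Ordinal.{v}) S ↔ S.Nonempty := by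
  rw [survives_iff]
  exact ⟨fun h => h.1, fun h => ⟨h, fun β hβ => absurd hβ (not_lt_bot (a := β))⟩⟩

/-- A clock `γ > β` already provides the moves required at `β`, so only cofinally many clocks
matter. This is how `ω ^ (ξ + 1)` is reached from finite multiples of `ω ^ ξ`, and limits from
smaller powers. -/
theorem survives_of_forall_lt {α : Ordinal.{v}} {S : Set I} (hα : 0 < α)
    (h : ∀ β < α, ∃ γ, β < γ ∧ Survives F P γ S) : Survives F P α S := by
  rw [survives_iff]
  obtain ⟨γ, -, hγ⟩ := h 0 hα
  refine ⟨hγ.nonempty, fun β hβ => ?_⟩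
  obtain ⟨γ, hβγ, hγ⟩ := h β hβ
  exact hγ.frequently hβγ

theorem survives_add_one_iff {α : Ordinal.{v}} {S : Set I}
    (h : ∃ᶠ x in F, Survives F P α (S ∩ P x)) : Survives F P (α + 1) S := by
  rw [survives_iff]
  obtain ⟨x, hx⟩ := h.exists
  refine ⟨hx.nonempty.mono Set.inter_subset_left, fun β hβ => h.mono fun x hx => ?_⟩
  exact hx.anti (Order.lt_add_one_iff.1 hβ)

/-- If both parts failed, each would be empty or be killed by almost every point at some clock value
below `α`; a point keeping the union alive at the larger of the two values contradicts the induction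
hypothesis. This partition property allows case distinctions before any functional has been chosen,
and it combines with weak-star compactness later. -/
theorem Survives.union {α : Ordinal.{v}} {S S' : Set I} (h : Survives F P α (S ∪ S')) :
    Survives F P α S ∨ Survives F P α S' := by
  induction α using WellFoundedLT.induction generalizing S S' with
  | ind α ih =>
    by_contra! hc
    have key : ∀ T : Set I, ¬ Survives F P α T →
        T = ∅ ∨ ∃ β < α, ∀ᶠ x in F, ¬ Survives F P β (T ∩ P x) := by
      intro T hT
      rw [survives_iff, not_and_or, Set.not_nonempty_iff_eq_empty] at hT
      refine hT.imp id fun hT => ?_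
      push Not at hT
      exact hT
    rcases key S hc.1 with h1 | ⟨β, hβ, h1⟩
    · exact hc.2 (by simpa [h1] using h)
    rcases key S' hc.2 with h2 | ⟨γ, hγ, h2⟩
    · exact hc.1 (by simpa [h2] using h)
    obtain ⟨x, hx, hx1, hx2⟩ := ((h.frequently (max_lt hβ hγ)).and_eventually (h1.and h2)).exists
    rw [Set.union_inter_distrib_right] at hx
    rcases ih _ (max_lt hβ hγ) hx with h | h
    · exact hx1 (h.anti (le_max_left _ _))
    · exact hx2 (h.anti (le_max_right _ _))

end Clock

/-! ### Filters of iterated averages -/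

section AvgFilter

variable (𝕜 : Type*) [RCLike 𝕜] {E : Type*} [AddZeroClass E] [SMul 𝕜 E]

/-- The filter of sums `v₁ + ⋯ + vₙ` with `vᵢ` chosen successively along `F`. -/
def sumFilter (F : Filter E) : ℕ → Filter E
  | 0 => pure 0
  | n + 1 => F.bind fun x => (sumFilter F n).map (x + ·)

/-- The filter of averages obtained from the nested filter `F` along the branches of
`Γ_{ξ,1}`. -/
noncomputable def avgFilter (F : Filter E) (ξ : Ordinal.{v}) : Filter E :=
  Ordinal.limitRecOn (motive := fun _ => Filter E) ξ F
    (fun _ G => (atTop : Filter ℕ).bind fun n =>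
      (sumFilter G (n + 1)).map ((((1 / ((n : ℝ) + 1) : ℝ)) : 𝕜) • ·))
    (fun ξ hξ ih => (atTop : Filter (Set.Iio ξ)).bind fun ζ => ih (ζ.1 + 1) (hξ.add_one_lt ζ.2))

variable {F : Filter E}

@[simp] theorem avgFilter_zero : avgFilter 𝕜 F (0 : Ordinal.{v}) = F := by
  rw [avgFilter, Ordinal.limitRecOn_zero]

theorem avgFilter_add_one (ξ : Ordinal.{v}) : avgFilter 𝕜 F (ξ + 1) =
    (atTop : Filter ℕ).bind fun n =>
      (sumFilter (avgFilter 𝕜 F ξ) (n + 1)).map ((((1 / ((n : ℝ) + 1) : ℝ)) : 𝕜) • ·) := by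
  rw [avgFilter, Ordinal.limitRecOn_add_one]; rfl

theorem avgFilter_limit {ξ : Ordinal.{v}} (hξ : Order.IsSuccLimit ξ) : avgFilter 𝕜 F ξ =
    (atTop : Filter (Set.Iio ξ)).bind fun ζ => avgFilter 𝕜 F (ζ.1 + 1) := by
  rw [avgFilter, Ordinal.limitRecOn_limit _ _ _ _ hξ]; rfl

end AvgFilter

theorem induction_add_one_limit {C : Ordinal.{v} → Prop} (ξ : Ordinal.{v}) (zero : C 0)
    (add_one : ∀ ξ, C ξ → C (ξ + 1))
    (limit : ∀ ξ, Order.IsSuccLimit ξ → (∀ ζ < ξ, C ζ) → C ξ) : C ξ :=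
  Ordinal.limitRecOn ξ zero add_one limit

/-! ### From averages to clocks -/

section Averages

variable {𝕜 : Type*} [RCLike 𝕜] {X : Type*} [NormedAddCommGroup X] [NormedSpace 𝕜 X]
  {I : Type*} {F : Filter X} (ev : I → X → ℝ) (θ : I → ℝ)

theorem sumFilter_le_bound {G : Filter X} {M : ℝ} (hadd : ∀ i x y, ev i (x + y) = ev i x + ev i y)
    (h : ∀ᶠ x in G, ∀ i, ev i x - θ i ≤ M) (n : ℕ) :
    ∀ᶠ x in sumFilter G n, ∀ i, ev i x - n * θ i ≤ n * M := by
  induction n with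
  | zero =>
    have h0 : ∀ i, ev i 0 = 0 := fun i => by simpa using hadd i 0 0
    simp [sumFilter, h0]
  | succ n ih =>
    rw [sumFilter, eventually_bind]
    filter_upwards [h] with x hx
    rw [eventually_map]
    filter_upwards [ih] with y hy i
    have := hx i
    have := hy i
    rw [hadd]; push_cast; linarith

theorem avgFilter_le_bound {M : ℝ} (hadd : ∀ i x y, ev i (x + y) = ev i x + ev i y)
    (hsmul : ∀ i (c : ℝ) x, ev i ((c : 𝕜) • x) = c * ev i x)
    (h : ∀ᶠ x in F, ∀ i, ev i x - θ i ≤ M) (ξ : Ordinal.{v}) :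
    ∀ᶠ x in avgFilter 𝕜 F ξ, ∀ i, ev i x - θ i ≤ M := by
  induction ξ using induction_add_one_limit with
  | zero => simpa using h
  | add_one ξ ih =>
    rw [avgFilter_add_one, eventually_bind]
    refine Eventually.of_forall fun n => ?_
    rw [eventually_map]
    filter_upwards [sumFilter_le_bound ev θ hadd ih (n + 1)] with x hx i
    have hn : (0 : ℝ) < n + 1 := by positivity
    have := hx i
    push_cast at this
    rw [hsmul, one_div, inv_mul_eq_div, sub_le_iff_le_add, div_le_iff₀ hn]
    linarith
  | limit ξ hξ ih =>
    rw [avgFilter_limit 𝕜 hξ, eventually_bind]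
    exact Eventually.of_forall fun ζ => ih _ (hξ.add_one_lt ζ.2)

/-- A counting argument: if at most `m` of `n` terms exceed `δ`, and all are at most `M`, their sum
is at most `n * δ + m * (M - δ)`. A larger sum has more than `m` large terms, and each large term is
worth `ω'` on the clock. -/
theorem survives_of_sumFilter {G : Filter X} {M δ : ℝ} (ω' : Ordinal.{v}) (hδM : δ ≤ M)
    (hadd : ∀ i x y, ev i (x + y) = ev i x + ev i y)
    (hM : ∀ᶠ x in G, ∀ i, ev i x - θ i ≤ M)
    (hG : ∀ (β : Ordinal.{v}) (S : Set I),
      (∃ᶠ x in G, Survives F (fun x => {i | 0 < ev i x - θ i}) β (S ∩ {i | δ < ev i x - θ i})) →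
      Survives F (fun x => {i | 0 < ev i x - θ i}) (β + ω') S) (n : ℕ) :
    ∀ (m : ℕ) (r : ℝ) (β : Ordinal.{v}) (S : Set I), n * δ + m * (M - δ) < r →
      (∃ᶠ x in sumFilter G n,
        Survives F (fun x => {i | 0 < ev i x - θ i}) β (S ∩ {i | r < ev i x - n * θ i})) →
      Survives F (fun x => {i | 0 < ev i x - θ i}) (β + ω' * m) S := by
  induction n with
  | zero =>
    intro m r β S hr h
    rw [sumFilter] at h
    obtain ⟨i, -, hi⟩ := (frequently_pure.1 h).nonempty
    have h0 : ev i 0 = 0 := by simpa using hadd i 0 0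
    simp only [Set.mem_ofPred_eq, h0, Nat.cast_zero, zero_mul, zero_add] at hi hr
    have := mul_nonneg (Nat.cast_nonneg (α := ℝ) m) (sub_nonneg.2 hδM)
    linarith
  | succ n ih =>
    intro m r β S hr h
    rw [sumFilter, frequently_bind] at h
    simp only [frequently_map] at h
    -- Whether the first summand is large depends on the index; `Survives.union` makes the choice
    -- for a whole surviving set.
    have h' : ∃ᶠ x in G, (∃ᶠ y in sumFilter G n,
        Survives F (fun x => {i | 0 < ev i x - θ i}) β
          ((S ∩ {i | δ < ev i x - θ i}) ∩ {i | r - M < ev i y - n * θ i})) ∨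
        (∃ᶠ y in sumFilter G n, Survives F (fun x => {i | 0 < ev i x - θ i}) β
          (S ∩ {i | r - δ < ev i y - n * θ i})) := by
      refine (h.and_eventually hM).mono fun x hx => ?_
      rw [← frequently_or_distrib]
      refine hx.1.mono fun y hy => (hy.mono ?_).union
      rintro i ⟨hiS, hi⟩
      have := hx.2 i
      simp only [Set.mem_ofPred_eq, hadd] at hi
      push_cast at hi
      by_cases hd : δ < ev i x - θ i
      · exact Or.inl ⟨⟨hiS, hd⟩, by simp only [Set.mem_ofPred_eq]; linarith⟩
      · exact Or.inr ⟨hiS, by simp only [Set.mem_ofPred_eq]; linarith⟩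
    rw [frequently_or_distrib] at h'
    push_cast at hr
    rcases h' with h' | h'
    -- A large first summand earns one `ω'` and uses up at most `M` of `r`; for `m = 0` nothing more
    -- has to be earned.
    · cases m with
      | zero =>
        obtain ⟨x, hx⟩ := h'.exists
        obtain ⟨y, hy⟩ := hx.exists
        simpa using hy.mono (Set.inter_subset_left.trans Set.inter_subset_left)
      | succ m =>
        have := hG (β + ω' * m) S (h'.mono fun x hx => ih m (r - M) β _ (by
          push_cast at hr; linarith) hx)
        rwa [add_assoc, ← mul_add_one, ← Nat.cast_add_one] at this
    · obtain ⟨x, hx⟩ := h'.exists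
      exact ih m (r - δ) β S (by linarith) hx

/-- If averages along `Γ_{ξ,1}` frequently satisfy the constraints strictly, then the constraints
can be satisfied simultaneously while a clock runs down from `ω ^ ξ`. -/
theorem survives_of_avgFilter {M : ℝ} (hadd : ∀ i x y, ev i (x + y) = ev i x + ev i y)
    (hsmul : ∀ i (c : ℝ) x, ev i ((c : 𝕜) • x) = c * ev i x)
    (hM : ∀ᶠ x in F, ∀ i, ev i x - θ i ≤ M) (ξ : Ordinal.{v}) :
    ∀ δ : ℝ, 0 < δ → ∀ (β : Ordinal.{v}) (S : Set I),
      (∃ᶠ x in avgFilter 𝕜 F ξ,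
        Survives F (fun x => {i | 0 < ev i x - θ i}) β (S ∩ {i | δ < ev i x - θ i})) →
      Survives F (fun x => {i | 0 < ev i x - θ i}) (β + ω ^ ξ) S := by
  have hω (ξ : Ordinal.{v}) : 0 < ω ^ ξ := opow_pos _ omega0_pos
  induction ξ using induction_add_one_limit with
  | zero =>
    intro δ hδ β S h
    rw [opow_zero]
    rw [avgFilter_zero] at h
    refine survives_add_one_iff (h.mono fun x hx => hx.mono ?_)
    exact Set.inter_subset_inter_right _ fun i hi => hδ.trans hi
  | add_one ξ ih =>
    intro δ hδ β S h
    rw [avgFilter_add_one, frequently_bind] at h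
    simp only [frequently_map] at h
    -- The maximum with `δ / 2` provides the inequality `hδM` of the counting lemma, whatever the
    -- sign of `M`.
    have hM' : ∀ᶠ x in avgFilter 𝕜 F ξ, ∀ i, ev i x - θ i ≤ max M (δ / 2) :=
      (avgFilter_le_bound ev θ hadd hsmul hM ξ).mono fun x hx i => (hx i).trans (le_max_left _ _)
    refine survives_of_forall_lt ((hω _).trans_le le_add_self) fun γ hγ => ?_
    have hlim : Order.IsSuccLimit (ω ^ (ξ + 1)) := by
      rw [opow_add, opow_one]
      exact isSuccLimit_mul_right (hω ξ) isSuccLimit_omega0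
    obtain ⟨η, hη, hγη⟩ := (lt_add_iff_of_isSuccLimit hlim).1 hγ
    obtain ⟨m, hm⟩ := lt_omega0_opow_succ.1 (by simpa using hη)
    refine ⟨β + ω ^ ξ * m, hγη.trans ((add_lt_add_iff_left β).2 hm), ?_⟩
    -- For `n ≥ N`, a sum of `n + 1` terms exceeding `(n + 1) * δ` beats the threshold `δ / 2` per
    -- term by more than `m` large terms can account for.
    obtain ⟨N, hN⟩ := exists_nat_gt ((m * (max M (δ / 2) - δ / 2)) / (δ / 2))
    rw [div_lt_iff₀ (by positivity)] at hN
    obtain ⟨n, hn, hNn⟩ := (h.and_eventually (eventually_ge_atTop N)).exists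
    have hn1 : (0 : ℝ) < n + 1 := by positivity
    refine survives_of_sumFilter ev θ (ω ^ ξ) (le_max_right M (δ / 2)) hadd hM'
      (fun β S => ih (δ / 2) (half_pos hδ) β S) (n + 1) m ((n + 1 : ℕ) * δ) β S ?_
      (hn.mono fun x hx => hx.mono (Set.inter_subset_inter_right _ fun i hi => ?_))
    · have : (N : ℝ) ≤ n := by exact_mod_cast hNn
      push_cast
      nlinarith
    · simp only [Set.mem_ofPred_eq, hsmul] at hi ⊢
      rw [one_div, inv_mul_eq_div, lt_sub_iff_add_lt, lt_div_iff₀ hn1] at hi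
      push_cast
      linarith
  | limit ξ hξ ih =>
    intro δ hδ β S h
    rw [avgFilter_limit 𝕜 hξ, frequently_bind] at h
    refine survives_of_forall_lt ((hω _).trans_le le_add_self) fun γ hγ => ?_
    have hlim : Order.IsSuccLimit (ω ^ ξ) := isSuccLimit_opow one_lt_omega0 hξ
    obtain ⟨η, hη, hγη⟩ := (lt_add_iff_of_isSuccLimit hlim).1 hγ
    obtain ⟨ζ, hζ, hηζ⟩ := (lt_opow_of_isSuccLimit omega0_ne_zero hξ).1 hη
    obtain ⟨ζ', hζ', hle⟩ := (h.and_eventually (eventually_ge_atTop ⟨ζ, hζ⟩)).exists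
    refine ⟨β + ω ^ (ζ'.1 + 1), hγη.trans ((add_lt_add_iff_left β).2 (hηζ.trans_le ?_)),
      ih _ (hξ.add_one_lt ζ'.2) δ hδ β S hζ'⟩
    exact opow_le_opow_right omega0_pos ((show ζ ≤ ζ'.1 from hle).trans le_self_add)

end Averages

/-! ### Ends of trees -/

section Ends

variable {Ω : Type w}

/-- A node, or the empty sequence, without an extension in `S`. -/
def IsEnd (S : Set (List Ω)) (t : List Ω) : Prop :=
  (t = [] ∨ t ∈ S) ∧ ∀ ζ, t ++ [ζ] ∉ S

theorem IsTree.ne_nil {S : Set (List Ω)} (hS : IsTree S) {t : List Ω} (ht : t ∈ S) : t ≠ [] :=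
  fun h => hS.1 (h ▸ ht)

theorem IsTree.exists_singleton {S : Set (List Ω)} (hS : IsTree S) {t : List Ω} (ht : t ∈ S) :
    ∃ ζ, [ζ] ∈ S ∧ [ζ] <+: t := by
  cases t with
  | nil => exact absurd ht hS.1
  | cons a l => exact ⟨a, hS.2 _ _ ht (by simp) (by simp), by simp⟩

theorem IsTree.snoc_mem {S : Set (List Ω)} (hS : IsTree S) {s t : List Ω} (ht : t ∈ S)
    (hst : s <+: t) (hne : s ≠ t) : ∃ ζ, s ++ [ζ] ∈ S := by
  obtain ⟨r, rfl⟩ := hst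
  cases r with
  | nil => simp at hne
  | cons a l => exact ⟨a, hS.2 _ _ ht ⟨l, by simp⟩ (by simp)⟩

theorem IsTree.isEnd_iff_mem_maxNodes {S : Set (List Ω)} (hS : IsTree S) (hne : S.Nonempty)
    {t : List Ω} : IsEnd S t ↔ t ∈ maxNodes S := by
  constructor
  · rintro ⟨h | h, h'⟩
    · obtain ⟨r, hr⟩ := hne
      obtain ⟨ζ, hζ, -⟩ := hS.exists_singleton hr
      subst h
      exact absurd hζ (h' ζ)
    · refine ⟨h, fun s hs hts => ?_⟩
      by_contra hc
      obtain ⟨ζ, hζ⟩ := hS.snoc_mem hs hts (Ne.symm hc)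
      exact h' ζ hζ
  · rintro ⟨h, h'⟩
    refine ⟨Or.inr h, fun ζ hζ => ?_⟩
    have := h' _ hζ (by simp)
    simp at this

theorem maxNodes_eq_of_prefix {S : Set (List Ω)} {s s' a : List Ω} (hs : s ∈ maxNodes S)
    (hs' : s' ∈ maxNodes S) (h : s <+: a) (h' : s' <+: a) : s = s' := by
  rcases List.prefix_or_prefix_of_prefix h h' with h | h
  · exact (hs.2 _ hs'.1 h).symm
  · exact hs'.2 _ hs.1 h

theorem maxNodes_append_inj {S : Set (List Ω)} {s s' r r' : List Ω} (hs : s ∈ maxNodes S)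
    (hs' : s' ∈ maxNodes S) (h : s ++ r = s' ++ r') : s = s' ∧ r = r' := by
  obtain rfl := maxNodes_eq_of_prefix hs hs' (List.prefix_append s r)
    (h ▸ List.prefix_append s' r')
  exact ⟨rfl, List.append_cancel_left h⟩

end Ends

/-! ### Weights along branches -/

/-- The weights of the non-empty initial segments of `t`. -/
def branchWts (W : WTree.{v}) (t : List Ordinal.{v}) : List ℝ :=
  (List.range t.length).map fun k => W.wt (t.take (k + 1))

@[simp] theorem length_branchWts (W : WTree.{v}) (t : List Ordinal.{v}) :
    (branchWts W t).length = t.length := by simp [branchWts]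

theorem branchWts_congr {W W' : WTree.{v}} {t t' : List Ordinal.{v}} (hl : t.length = t'.length)
    (h : ∀ k < t.length, W.wt (t.take (k + 1)) = W'.wt (t'.take (k + 1))) :
    branchWts W t = branchWts W' t' := by
  unfold branchWts
  rw [← hl]
  exact List.map_congr_left fun k hk => h k (List.mem_range.1 hk)

theorem branchWts_append {W W₁ W₂ : WTree.{v}} {s r : List Ordinal.{v}}
    (h₁ : ∀ k < s.length, W.wt (s.take (k + 1)) = W₁.wt (s.take (k + 1)))
    (h₂ : ∀ k < r.length, W.wt (s ++ r.take (k + 1)) = W₂.wt (r.take (k + 1))) :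
    branchWts W (s ++ r) = branchWts W₁ s ++ branchWts W₂ r := by
  unfold branchWts
  rw [List.length_append, List.range_add, List.map_append, List.map_map]
  congr 1
  · refine List.map_congr_left fun k hk => ?_
    rw [List.take_append_of_le_length (by have := List.mem_range.1 hk; omega),
      h₁ k (List.mem_range.1 hk)]
  · refine List.map_congr_left fun k hk => ?_
    rw [Function.comp, add_assoc, List.take_length_add_append, h₂ k (List.mem_range.1 hk)]

theorem IsTree.take_mem {Ω : Type w} {S : Set (List Ω)} (hS : IsTree S) {t : List Ω} (ht : t ∈ S)
    (k : ℕ) : t.take (k + 1) ∈ S := by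
  refine hS.2 _ _ ht (List.take_prefix _ _) ?_
  have := hS.ne_nil ht
  simp [this]

/-! ### Regular weighted trees and the operations that build `Γ_{ξ,1}`. -/

namespace WTree

/-- A weighted tree of strictly decreasing sequences of ordinals less than `α`, with non-negative
weights whose sum along each maximal branch is `c`. -/
structure Regular (W : WTree.{v}) (α : Ordinal.{v}) (c : ℝ) : Prop where
  tree : IsTree W.nodes
  pairwise : ∀ t ∈ W.nodes, t.Pairwise (· > ·)
  lt : ∀ t ∈ W.nodes, ∀ ζ ∈ t, ζ < α
  nonneg : ∀ t ∈ W.nodes, 0 ≤ W.wt t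
  sum : ∀ t, IsEnd W.nodes t → (branchWts W t).sum = c

variable {W V : WTree.{v}} {α β : Ordinal.{v}} {c d : ℝ}

/-! #### Shifts -/

theorem mem_shift {t : List Ordinal.{v}} :
    t.map (α + ·) ∈ (shift α W).nodes ↔ t ∈ W.nodes := by
  refine ⟨?_, fun h => ⟨t, h, rfl⟩⟩
  rintro ⟨s, hs, hst⟩
  rwa [← List.map_injective_iff.2 (add_right_injective α) hst]

theorem shift_wt (t : List Ordinal.{v}) : (shift α W).wt (t.map (α + ·)) = W.wt t := by
  simp [shift, Function.comp_def]

theorem branchWts_shift (t : List Ordinal.{v}) :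
    branchWts (shift α W) (t.map (α + ·)) = branchWts W t := by
  refine branchWts_congr (by simp) fun k _ => ?_
  rw [← List.map_take, shift_wt]

theorem isTree_shift (hW : IsTree W.nodes) : IsTree (shift α W).nodes := by
  constructor
  · rintro ⟨s, hs, h⟩
    exact hW.ne_nil hs (List.map_eq_nil_iff.1 h)
  · rintro s _ ⟨t, ht, rfl⟩ hst hne
    obtain ⟨r, rfl, -⟩ : ∃ r, s = List.map (α + ·) r ∧ r <+: t := by
      obtain ⟨q, hq⟩ := hst
      obtain ⟨l₁, l₂, rfl, rfl, rfl⟩ := List.map_eq_append_iff.1 hq.symm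
      exact ⟨l₁, rfl, by simp⟩
    rw [mem_shift]
    exact hW.2 _ _ ht ((List.prefix_map_iff_of_injective (add_right_injective α)).1 hst)
      (by simpa using hne)

theorem isEnd_shift {t : List Ordinal.{v}} :
    IsEnd (shift α W).nodes t ↔ ∃ s, IsEnd W.nodes s ∧ t = s.map (α + ·) := by
  constructor
  · rintro ⟨h, h'⟩
    obtain ⟨s, hs, rfl⟩ : ∃ s, (s = [] ∨ s ∈ W.nodes) ∧ t = s.map (α + ·) := by
      rcases h with rfl | ⟨s, hs, rfl⟩
      · exact ⟨[], by simp⟩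
      · exact ⟨s, Or.inr hs, rfl⟩
    refine ⟨s, ⟨hs, fun ζ hζ => h' (α + ζ) ?_⟩, rfl⟩
    have := (mem_shift (α := α)).2 hζ
    simpa using this
  · rintro ⟨s, ⟨h, h'⟩, rfl⟩
    refine ⟨h.imp (by simp +contextual) mem_shift.2, fun ζ hζ => ?_⟩
    obtain ⟨r, hr, hrs⟩ := hζ
    obtain ⟨r₁, r₂, rfl, h₁, h₂⟩ := List.map_eq_append_iff.1 hrs
    obtain rfl := List.map_injective_iff.2 (add_right_injective α) h₁
    obtain ⟨η, rfl, -⟩ := List.map_eq_singleton_iff.1 h₂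
    exact h' η hr

theorem Regular.shift (hW : W.Regular α c) (β : Ordinal.{v}) :
    (shift β W).Regular (β + α) c where
  tree := isTree_shift hW.tree
  pairwise := by
    rintro _ ⟨t, ht, rfl⟩
    exact (hW.pairwise t ht).map _ fun a b h => (add_lt_add_iff_left β).2 h
  lt := by
    rintro _ ⟨t, ht, rfl⟩ ζ hζ
    obtain ⟨η, hη, rfl⟩ := List.mem_map.1 hζ
    exact (add_lt_add_iff_left β).2 (hW.lt t ht η hη)
  nonneg := by
    rintro _ ⟨t, ht, rfl⟩
    exact (shift_wt (α := β) (W := W) t).symm ▸ hW.nonneg t ht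
  sum := by
    intro t ht
    obtain ⟨s, hs, rfl⟩ := isEnd_shift.1 ht
    rw [branchWts_shift, hW.sum s hs]

/-! #### Multiples -/

theorem branchWts_scale (t : List Ordinal.{v}) :
    branchWts (scale c W) t = (branchWts W t).map (c * ·) := by
  simp [branchWts, scale]

theorem Regular.scale (hW : W.Regular α c) (hd : 0 ≤ d) : (scale d W).Regular α (d * c) where
  tree := hW.tree
  pairwise := hW.pairwise
  lt := hW.lt
  nonneg t ht := mul_nonneg hd (hW.nonneg t ht)
  sum t ht := by
    rw [branchWts_scale, List.sum_map_mul_left, List.map_id', hW.sum t ht]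

/-! #### Disjoint unions -/

section Union

variable {ι : Type w} {U : ι → WTree.{v}}

theorem iUnion_wt {t : List Ordinal.{v}} {i : ι} (hi : t ∈ (U i).nodes)
    (hu : ∀ j, t ∈ (U j).nodes → j = i) : (iUnion U).wt t = (U i).wt t := by
  have h : ∃ i, t ∈ (U i).nodes := ⟨i, hi⟩
  simp only [iUnion, dif_pos h]
  rw [hu _ h.choose_spec]

/-- A node lies in the same piece as its first entry, so disjointness of the unions only has to be
checked on nodes of length one. -/
theorem iUnion_unique (hU : ∀ i, IsTree (U i).nodes)
    (hd : ∀ i j ζ, [ζ] ∈ (U i).nodes → [ζ] ∈ (U j).nodes → i = j)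
    {t : List Ordinal.{v}} {i j : ι} (hi : t ∈ (U i).nodes)
    (hj : t ∈ (U j).nodes) : i = j := by
  obtain ⟨ζ, h, hp⟩ := (hU i).exists_singleton hi
  exact hd i j ζ h ((hU j).2 _ _ hj hp (by simp))

theorem isTree_iUnion (hU : ∀ i, IsTree (U i).nodes) : IsTree (iUnion U).nodes := by
  constructor
  · intro h
    obtain ⟨i, hi⟩ := Set.mem_iUnion.1 h
    exact (hU i).1 hi
  · intro s t ht hst hne
    obtain ⟨i, hi⟩ := Set.mem_iUnion.1 ht
    exact Set.mem_iUnion.2 ⟨i, (hU i).2 s t hi hst hne⟩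

theorem branchWts_iUnion (hU : ∀ i, IsTree (U i).nodes)
    (hd : ∀ i j ζ, [ζ] ∈ (U i).nodes → [ζ] ∈ (U j).nodes → i = j)
    {t : List Ordinal.{v}} {i : ι} (hi : t ∈ (U i).nodes) :
    branchWts (iUnion U) t = branchWts (U i) t :=
  branchWts_congr rfl fun k _ => iUnion_wt ((hU i).take_mem hi k)
    fun _ hj => iUnion_unique hU hd hj ((hU i).take_mem hi k)

theorem isEnd_iUnion_of_isEnd (hU : ∀ i, IsTree (U i).nodes)
    (hd : ∀ i j ζ, [ζ] ∈ (U i).nodes → [ζ] ∈ (U j).nodes → i = j)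
    {t : List Ordinal.{v}} {i : ι} (hne : (U i).nodes.Nonempty)
    (hi : IsEnd (U i).nodes t) : t ∈ (U i).nodes ∧ IsEnd (iUnion U).nodes t := by
  have ht := (((hU i).isEnd_iff_mem_maxNodes hne).1 hi).1
  refine ⟨ht, Or.inr (Set.mem_iUnion.2 ⟨i, ht⟩), fun ζ hζ => ?_⟩
  obtain ⟨j, hj⟩ := Set.mem_iUnion.1 hζ
  obtain rfl := iUnion_unique hU hd ht ((hU j).2 _ _ hj (by simp) ((hU i).ne_nil ht))
  exact hi.2 ζ hj

theorem isEnd_of_isEnd_iUnion (hU : ∀ i, IsTree (U i).nodes) {t : List Ordinal.{v}} {i₀ : ι}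
    (hne : (U i₀).nodes.Nonempty) (ht : IsEnd (iUnion U).nodes t) :
    ∃ i, t ∈ (U i).nodes ∧ IsEnd (U i).nodes t := by
  obtain ⟨r, hr⟩ := hne
  have := (((isTree_iUnion hU).isEnd_iff_mem_maxNodes ⟨r, Set.mem_iUnion.2 ⟨i₀, hr⟩⟩).1 ht).1
  obtain ⟨i, hi⟩ := Set.mem_iUnion.1 this
  exact ⟨i, hi, Or.inr hi, fun ζ hζ => ht.2 ζ (Set.mem_iUnion.2 ⟨i, hζ⟩)⟩

theorem Regular.iUnion (hU : ∀ i, ∃ β ≤ α, (U i).Regular β c)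
    (hd : ∀ i j ζ, [ζ] ∈ (U i).nodes → [ζ] ∈ (U j).nodes → i = j) {i₀ : ι}
    (hne : (U i₀).nodes.Nonempty) : (iUnion U).Regular α c := by
  have hT : ∀ i, IsTree (U i).nodes := fun i => (hU i).choose_spec.2.tree
  refine ⟨isTree_iUnion hT, fun t ht => ?_, fun t ht ζ hζ => ?_, fun t ht => ?_, fun t ht => ?_⟩
  · obtain ⟨i, hi⟩ := Set.mem_iUnion.1 ht
    exact (hU i).choose_spec.2.pairwise t hi
  · obtain ⟨i, hi⟩ := Set.mem_iUnion.1 ht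
    exact ((hU i).choose_spec.2.lt t hi ζ hζ).trans_le (hU i).choose_spec.1
  · obtain ⟨i, hi⟩ := Set.mem_iUnion.1 ht
    rw [iUnion_wt hi fun j hj => iUnion_unique hT hd hj hi]
    exact (hU i).choose_spec.2.nonneg t hi
  · obtain ⟨i, hi, he⟩ := isEnd_of_isEnd_iUnion hT hne ht
    rw [branchWts_iUnion hT hd hi, (hU i).choose_spec.2.sum t he]

end Union

/-! #### Concatenation -/

theorem graft_wt {S : Set (List Ordinal.{v})} {s r : List Ordinal.{v}} (hs : s ∈ maxNodes S)
    (hr : r ∈ V.nodes) : (graft S V).wt (s ++ r) = V.wt r := by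
  have h : ∃ t ∈ V.nodes, ∃ s' ∈ maxNodes S, s ++ r = s' ++ t := ⟨r, hr, s, hs, rfl⟩
  simp only [graft, dif_pos h]
  obtain ⟨-, s', hs', he⟩ := h.choose_spec
  rw [(maxNodes_append_inj hs hs' he).2.symm]

/-- `W` followed by a copy of `V` below each of its maximal members. -/
noncomputable def concat (W V : WTree.{v}) : WTree.{v} :=
  iUnion (fun b : Bool => if b then W else graft W.nodes V)

theorem mem_concat {t : List Ordinal.{v}} : t ∈ (concat W V).nodes ↔
    t ∈ W.nodes ∨ ∃ s ∈ maxNodes W.nodes, ∃ r ∈ V.nodes, t = s ++ r := by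
  simp only [concat, iUnion, Set.mem_iUnion, Bool.exists_bool, graft]
  simp only [Bool.false_eq_true, if_false, if_true, Set.mem_ofPred_eq]
  constructor
  · rintro (⟨r, hr, s, hs, h⟩ | h)
    exacts [Or.inr ⟨s, hs, r, hr, h⟩, Or.inl h]
  · rintro (h | ⟨s, hs, r, hr, h⟩)
    exacts [Or.inr h, Or.inl ⟨r, hr, s, hs, h⟩]

theorem not_mem_of_append (hV : IsTree V.nodes) {s r : List Ordinal.{v}}
    (hs : s ∈ maxNodes W.nodes) (hr : r ∈ V.nodes) : s ++ r ∉ W.nodes := fun h =>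
  hV.ne_nil hr (by simpa using hs.2 _ h (List.prefix_append s r))

theorem concat_wt_left (hV : IsTree V.nodes) {t : List Ordinal.{v}} (ht : t ∈ W.nodes) :
    (concat W V).wt t = W.wt t := by
  refine iUnion_wt (U := fun b : Bool => if b then W else graft W.nodes V) (i := true) ht ?_
  rintro (_ | _) hj
  · obtain ⟨r, hr, s, hs, rfl⟩ := hj
    exact absurd ht (not_mem_of_append hV hs hr)
  · rfl

theorem concat_wt_right (hV : IsTree V.nodes) {s r : List Ordinal.{v}}
    (hs : s ∈ maxNodes W.nodes) (hr : r ∈ V.nodes) : (concat W V).wt (s ++ r) = V.wt r := by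
  refine (iUnion_wt (U := fun b : Bool => if b then W else graft W.nodes V) (i := false)
    ⟨r, hr, s, hs, rfl⟩ ?_).trans (graft_wt hs hr)
  rintro (_ | _) hj
  · rfl
  · exact absurd hj (not_mem_of_append hV hs hr)

theorem isTree_concat (hW : IsTree W.nodes) (hV : IsTree V.nodes) :
    IsTree (concat W V).nodes := by
  constructor
  · rw [mem_concat]
    rintro (h | ⟨s, hs, r, hr, h⟩)
    · exact hW.1 h
    · exact hV.ne_nil hr (List.append_eq_nil_iff.1 h.symm).2
  · intro a t ht hat hne
    rw [mem_concat] at ht ⊢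
    rcases ht with h | ⟨s, hs, r, hr, rfl⟩
    · exact Or.inl (hW.2 _ _ h hat hne)
    · rcases List.prefix_or_prefix_of_prefix hat (List.prefix_append s r) with h | ⟨q, rfl⟩
      · exact Or.inl (hW.2 _ _ hs.1 h hne)
      · rcases eq_or_ne q [] with rfl | hq
        · exact Or.inl (by simpa using hs.1)
        · exact Or.inr ⟨s, hs, q, hV.2 _ _ hr ((List.prefix_append_right_inj s).1 hat) hq, rfl⟩

/-- `IsEnd` instead of `maxNodes` is used for `V` so that `V` may be empty, with `[]` as its only
end; this happens at the bottom of the recursion for `Γ_{ξ,n}`. -/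
theorem isEnd_concat (hW : IsTree W.nodes) (hne : W.nodes.Nonempty) (hV : IsTree V.nodes)
    {t : List Ordinal.{v}} : IsEnd (concat W V).nodes t ↔
      ∃ s ∈ maxNodes W.nodes, ∃ r, IsEnd V.nodes r ∧ t = s ++ r := by
  constructor
  · intro h
    have hne' : (concat W V).nodes.Nonempty := hne.mono fun t ht => mem_concat.2 (Or.inl ht)
    have ht := (((isTree_concat hW hV).isEnd_iff_mem_maxNodes hne').1 h).1
    rcases mem_concat.1 ht with ht | ⟨s, hs, r, hr, rfl⟩
    · refine ⟨t, (hW.isEnd_iff_mem_maxNodes hne).1 ⟨Or.inr ht, fun ζ hζ =>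
        h.2 ζ (mem_concat.2 (Or.inl hζ))⟩, [], ⟨Or.inl rfl, fun ζ hζ => h.2 ζ ?_⟩, by simp⟩
      refine mem_concat.2 (Or.inr ⟨t, ?_, [ζ], hζ, rfl⟩)
      exact (hW.isEnd_iff_mem_maxNodes hne).1 ⟨Or.inr ht, fun ζ hζ =>
        h.2 ζ (mem_concat.2 (Or.inl hζ))⟩
    · refine ⟨s, hs, r, ⟨Or.inr hr, fun ζ hζ => h.2 ζ ?_⟩, rfl⟩
      rw [List.append_assoc]
      exact mem_concat.2 (Or.inr ⟨s, hs, _, hζ, rfl⟩)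
  · rintro ⟨s, hs, r, ⟨hr, hr'⟩, rfl⟩
    refine ⟨Or.inr (mem_concat.2 ?_), fun ζ hζ => ?_⟩
    · rcases hr with rfl | hr
      · exact Or.inl (by simpa using hs.1)
      · exact Or.inr ⟨s, hs, r, hr, rfl⟩
    · rw [List.append_assoc] at hζ
      rcases mem_concat.1 hζ with h | ⟨s', hs', r', hr'', he⟩
      · have := hs.2 _ h (List.prefix_append _ _)
        simp at this
      · obtain ⟨rfl, rfl⟩ := maxNodes_append_inj hs hs' he
        exact hr' _ hr''

theorem branchWts_concat (hW : IsTree W.nodes) (hV : IsTree V.nodes) {s r : List Ordinal.{v}}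
    (hs : s ∈ maxNodes W.nodes) (hr : r = [] ∨ r ∈ V.nodes) :
    branchWts (concat W V) (s ++ r) = branchWts W s ++ branchWts V r := by
  refine branchWts_append (fun k _ => concat_wt_left hV (hW.take_mem hs.1 k)) fun k hk => ?_
  rcases hr with rfl | hr
  · simp at hk
  · exact concat_wt_right hV hs (hV.take_mem hr k)

/-- The entries of `V` lie below `β` and those of `W` do not, so the concatenated sequences still
decrease. -/
theorem Regular.concat {γ : Ordinal.{v}} (hW : W.Regular γ c) (hne : W.nodes.Nonempty)
    (hV : V.Regular β d) (hβ : ∀ t ∈ W.nodes, ∀ ζ ∈ t, β ≤ ζ) :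
    (concat W V).Regular γ (c + d) := by
  have hlt : ∀ s ∈ maxNodes W.nodes, β < γ := by
    intro s hs
    obtain ⟨ζ, hζ, -⟩ := hW.tree.exists_singleton hs.1
    exact (hβ _ hζ ζ (by simp)).trans_lt (hW.lt _ hζ ζ (by simp))
  refine ⟨isTree_concat hW.tree hV.tree, fun t ht => ?_, fun t ht ζ hζ => ?_, fun t ht => ?_,
    fun t ht => ?_⟩
  · rcases mem_concat.1 ht with h | ⟨s, hs, r, hr, rfl⟩
    · exact hW.pairwise t h
    · refine List.pairwise_append.2 ⟨hW.pairwise s hs.1, hV.pairwise r hr, fun a ha b hb => ?_⟩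
      exact (hV.lt r hr b hb).trans_le (hβ s hs.1 a ha)
  · rcases mem_concat.1 ht with h | ⟨s, hs, r, hr, rfl⟩
    · exact hW.lt t h ζ hζ
    · rcases List.mem_append.1 hζ with h | h
      · exact hW.lt s hs.1 ζ h
      · exact (hV.lt r hr ζ h).trans (hlt s hs)
  · rcases mem_concat.1 ht with h | ⟨s, hs, r, hr, rfl⟩
    · rw [concat_wt_left hV.tree h]
      exact hW.nonneg t h
    · rw [concat_wt_right hV.tree hs hr]
      exact hV.nonneg r hr
  · obtain ⟨s, hs, r, hr, rfl⟩ := (isEnd_concat hW.tree hne hV.tree).1 ht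
    rw [branchWts_concat hW.tree hV.tree hs hr.1, List.sum_append, hV.sum r hr,
      hW.sum s ((hW.tree.isEnd_iff_mem_maxNodes hne).2 hs)]

/-! #### The trees `Γ_{ξ,n}` -/

theorem stack_succ (ξ : Ordinal.{v}) (n : ℕ) :
    stack ξ W (n + 1) = concat (WTree.shift (ω ^ ξ * n) W) (stack ξ W n) := rfl

theorem le_of_mem_shift {t : List Ordinal.{v}} (ht : t ∈ (WTree.shift α W).nodes) {ζ : Ordinal.{v}}
    (hζ : ζ ∈ t) : α ≤ ζ := by
  obtain ⟨s, -, rfl⟩ := ht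
  obtain ⟨η, -, rfl⟩ := List.mem_map.1 hζ
  exact le_self_add

theorem nonempty_shift (hne : W.nodes.Nonempty) : (WTree.shift α W).nodes.Nonempty := by
  obtain ⟨t, ht⟩ := hne
  exact ⟨_, mem_shift.2 ht⟩

theorem nonempty_stack {ξ : Ordinal.{v}} (hne : W.nodes.Nonempty) (n : ℕ) :
    (stack ξ W (n + 1)).nodes.Nonempty := by
  obtain ⟨t, ht⟩ := nonempty_shift (α := ω ^ ξ * n) hne
  exact ⟨t, mem_concat.2 (Or.inl ht)⟩

theorem Regular.stack {ξ : Ordinal.{v}} (hW : W.Regular (ω ^ ξ) 1) (hne : W.nodes.Nonempty)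
    (n : ℕ) : (stack ξ W n).Regular (ω ^ ξ * n) n := by
  induction n with
  | zero =>
    -- The empty tree has the single end `[]`, with empty weight sum `0`.
    refine ⟨⟨?_, ?_⟩, ?_, ?_, ?_, ?_⟩ <;> simp [WTree.stack]
    rintro t ⟨h | h, -⟩
    · simp [h, branchWts]
    · exact absurd h (Set.notMem_empty t)
  | succ n ih =>
    have := (hW.shift (ω ^ ξ * n)).concat (nonempty_shift hne) ih
      fun t ht ζ hζ => le_of_mem_shift ht hζ
    rw [← mul_add_one, add_comm] at this
    exact_mod_cast this

/-- The interval containing the first entry records `n`; this separates the pieces of `Γ_{ξ+1,1}`.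
-/
theorem singleton_mem_stack {ξ ζ : Ordinal.{v}} (hW : W.Regular (ω ^ ξ) 1)
    (hne : W.nodes.Nonempty) {n : ℕ} (h : [ζ] ∈ (WTree.stack ξ W (n + 1)).nodes) :
    ω ^ ξ * n ≤ ζ ∧ ζ < ω ^ ξ * (n + 1) := by
  constructor
  · rcases mem_concat.1 h with h | ⟨s, hs, r, hr, h⟩
    · exact le_of_mem_shift h (by simp)
    · have h₁ := List.length_pos_of_ne_nil ((hW.shift _).tree.ne_nil hs.1)
      have h₂ := List.length_pos_of_ne_nil ((hW.stack hne n).tree.ne_nil hr)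
      have := congrArg List.length h
      simp only [List.length_singleton, List.length_append] at this
      omega
  · exact_mod_cast (hW.stack hne (n + 1)).lt _ h ζ (by simp)

end WTree

open WTree
open scoped Pointwise

/-! ### The trees `Γ_{ξ,1}` -/

theorem Gamma_zero : Gamma (0 : Ordinal.{v}) = single := by
  rw [Gamma, Ordinal.limitRecOn_zero]

theorem Gamma_add_one (ξ : Ordinal.{v}) : Gamma (ξ + 1) =
    WTree.iUnion (fun n : ℕ => scale (1 / ((n : ℝ) + 1)) (stack ξ (Gamma ξ) (n + 1))) := by
  rw [Gamma, Ordinal.limitRecOn_add_one]; rfl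

theorem Gamma_limit {ξ : Ordinal.{v}} (hξ : Order.IsSuccLimit ξ) : Gamma ξ =
    WTree.iUnion (fun ζ : Set.Iio ξ => shift (ω ^ ζ.1) (Gamma (ζ.1 + 1))) := by
  rw [Gamma, Ordinal.limitRecOn_limit _ _ _ _ hξ]; rfl

theorem isEnd_single {t : List Ordinal.{v}} : IsEnd single.nodes t ↔ t = [0] := by
  constructor
  · rintro ⟨rfl | h, h'⟩
    · exact absurd rfl (h' 0)
    · exact h
  · rintro rfl
    exact ⟨Or.inr rfl, fun ζ hζ => by simp [single] at hζ⟩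

theorem disjoint_stack {ξ : Ordinal.{v}} {W : WTree.{v}} (hW : W.Regular (ω ^ ξ) 1)
    (hne : W.nodes.Nonempty) (i j : ℕ) (ζ : Ordinal.{v})
    (hi : [ζ] ∈ (stack ξ W (i + 1)).nodes) (hj : [ζ] ∈ (stack ξ W (j + 1)).nodes) : i = j := by
  have key : ∀ i j : ℕ, [ζ] ∈ (stack ξ W (i + 1)).nodes → [ζ] ∈ (stack ξ W (j + 1)).nodes →
      i ≤ j := by
    intro i j hi hj
    have := (singleton_mem_stack hW hne hi).1.trans_lt (singleton_mem_stack hW hne hj).2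
    have := lt_of_mul_lt_mul_left this zero_le
    exact Nat.lt_succ_iff.1 (by exact_mod_cast this)
  exact le_antisymm (key i j hi hj) (key j i hj hi)

/-- Since `ω ^ ζ + ω ^ (ζ + 1) = ω ^ (ζ + 1)`, the first entries of the piece with index `ζ` lie in
`[ω ^ ζ, ω ^ (ζ + 1))`, and these intervals are disjoint. -/
theorem disjoint_shift {ξ : Ordinal.{v}} {W : Ordinal.{v} → WTree.{v}}
    (hW : ∀ ζ < ξ, (W ζ).Regular (ω ^ (ζ + 1)) 1) (i j : Set.Iio ξ) (ζ : Ordinal.{v})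
    (hi : [ζ] ∈ (shift (ω ^ i.1) (W i.1)).nodes) (hj : [ζ] ∈ (shift (ω ^ j.1) (W j.1)).nodes) :
    i = j := by
  have key : ∀ i j : Set.Iio ξ, [ζ] ∈ (shift (ω ^ i.1) (W i.1)).nodes →
      [ζ] ∈ (shift (ω ^ j.1) (W j.1)).nodes → i ≤ j := by
    intro i j hi hj
    have h1 := le_of_mem_shift hi (ζ := ζ) (by simp)
    have h2 := ((hW j.1 j.2).shift (ω ^ j.1)).lt _ hj ζ (by simp)
    rw [add_omega0_opow ((opow_lt_opow_iff_right one_lt_omega0).2 (lt_add_one j.1))] at h2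
    exact Subtype.coe_le_coe.1 <| Order.lt_add_one_iff.1 ((opow_lt_opow_iff_right one_lt_omega0).1 (h1.trans_lt h2))
  exact le_antisymm (key i j hi hj) (key j i hj hi)

/-- The two properties share one induction because regularity of concatenations and unions uses a
non-empty piece. -/
theorem Gamma_regular_nonempty (ξ : Ordinal.{v}) :
    (Gamma ξ).Regular (ω ^ ξ) 1 ∧ (Gamma ξ).nodes.Nonempty := by
  induction ξ using induction_add_one_limit with
  | zero =>
    rw [Gamma_zero]
    refine ⟨⟨⟨by simp [single], ?_⟩, ?_, ?_, ?_, fun t ht => ?_⟩, [0], rfl⟩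
    · rintro s _ rfl hs hne
      obtain ⟨_ | ⟨a, r⟩, hr⟩ := hs
      · exact (List.append_nil s).symm.trans hr
      · have := congrArg List.length hr
        simp only [List.length_append, List.length_cons, List.length_nil] at this
        exact absurd (List.length_eq_zero_iff.1 (by omega)) hne
    · rintro _ rfl; simp
    · rintro _ rfl; simp
    · intro t _; simp [single]
    · rw [isEnd_single.1 ht]; simp [branchWts, single]
  | add_one ξ ih =>
    rw [Gamma_add_one]
    have hne0 := nonempty_stack (ξ := ξ) ih.2 0
    refine ⟨Regular.iUnion (i₀ := 0) (fun n => ⟨ω ^ ξ * (n + 1 : ℕ), ?_, ?_⟩)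
      (disjoint_stack ih.1 ih.2) hne0, ?_⟩
    · exact (opow_mul_lt_opow (natCast_lt_omega0 _) (lt_add_one ξ)).le
    · have := (ih.1.stack ih.2 (n + 1)).scale (d := 1 / ((n : ℝ) + 1)) (by positivity)
      have h1 : (n : ℝ) + 1 ≠ 0 := by positivity
      push_cast at this ⊢
      rwa [one_div_mul_cancel h1] at this
    · obtain ⟨t, ht⟩ := hne0
      exact ⟨t, Set.mem_iUnion.2 ⟨0, ht⟩⟩
  | limit ξ hξ ih =>
    rw [Gamma_limit hξ]
    have hpos : (0 : Ordinal) < ξ := hξ.bot_lt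
    have hne0 := nonempty_shift (α := ω ^ (0 : Ordinal.{v})) (ih _ (hξ.add_one_lt hpos)).2
    refine ⟨Regular.iUnion (i₀ := ⟨0, hpos⟩) (fun ζ => ⟨_, ?_,
      (ih _ (hξ.add_one_lt ζ.2)).1.shift _⟩)
      (disjoint_shift (W := fun ζ => Gamma (ζ + 1)) fun ζ hζ => (ih _ (hξ.add_one_lt hζ)).1)
      hne0, ?_⟩
    · rw [add_omega0_opow ((opow_lt_opow_iff_right one_lt_omega0).2 (lt_add_one ζ.1))]
      exact opow_le_opow_right omega0_pos (hξ.add_one_lt ζ.2).le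
    · obtain ⟨t, ht⟩ := hne0
      exact ⟨t, Set.mem_iUnion.2 ⟨⟨0, hpos⟩, ht⟩⟩

theorem Gamma_regular (ξ : Ordinal.{v}) : (Gamma ξ).Regular (ω ^ ξ) 1 :=
  (Gamma_regular_nonempty ξ).1

theorem Gamma_nonempty (ξ : Ordinal.{v}) : (Gamma ξ).nodes.Nonempty :=
  (Gamma_regular_nonempty ξ).2

/-! ### Initial segments -/

section InitSeg

variable {Ω : Type w} (α : ℕ → Ω)

@[simp] theorem length_initSeg (n : ℕ) : (initSeg α n).length = n := by simp [initSeg]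

theorem initSeg_succ (n : ℕ) : initSeg α (n + 1) = initSeg α n ++ [α n] := by
  simp [initSeg, List.range_succ]

theorem take_initSeg {k n : ℕ} (h : k ≤ n) : (initSeg α n).take k = initSeg α k := by
  rw [initSeg, ← List.map_take, List.take_range, min_eq_left h, initSeg]

theorem initSeg_prefix {k n : ℕ} (h : k ≤ n) : initSeg α k <+: initSeg α n :=
  take_initSeg α h ▸ List.take_prefix _ _

theorem map_initSeg {Ω' : Type*} (f : Ω → Ω') (n : ℕ) :
    (initSeg α n).map f = initSeg (fun i => f (α i)) n := by
  simp [initSeg, Function.comp_def]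

end InitSeg

/-! ### The tree `Γ_{ξ,∞}` -/

/-- The copy of `t` in the level of `Γ_{ξ,∞}` with index `i`. -/
noncomputable def raise (ξ : Ordinal.{v}) (i : ℕ) (t : List Ordinal.{v}) : List Ordinal.{v} :=
  t.map (ω ^ ξ * i + ·)

/-- Concatenations of `i` maximal branches of (translates of) `Γ_{ξ,1}`. -/
def levelEnds (ξ : Ordinal.{v}) : ℕ → Set (List Ordinal.{v})
  | 0 => {[]}
  | i + 1 => {a | ∃ s ∈ levelEnds ξ i, ∃ t ∈ maxNodes (Gamma ξ).nodes, a = s ++ raise ξ i t}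

section Raise

variable {ξ : Ordinal.{v}} {i : ℕ} {s t r : List Ordinal.{v}}

@[simp] theorem raise_nil : raise ξ i [] = [] := rfl

@[simp] theorem length_raise : (raise ξ i t).length = t.length := by simp [raise]

theorem raise_append : raise ξ i (s ++ t) = raise ξ i s ++ raise ξ i t := by simp [raise]

theorem raise_singleton (ζ : Ordinal.{v}) : raise ξ i [ζ] = [ω ^ ξ * i + ζ] := rfl

theorem raise_injective : Function.Injective (raise ξ i) :=
  List.map_injective_iff.2 (add_right_injective _)

theorem raise_prefix_iff : raise ξ i s <+: raise ξ i t ↔ s <+: t :=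
  List.prefix_map_iff_of_injective (add_right_injective _)

theorem take_raise (k : ℕ) : (raise ξ i t).take k = raise ξ i (t.take k) := by
  simp [raise, List.map_take]

@[simp] theorem raise_eq_nil_iff : raise ξ i t = [] ↔ t = [] := by simp [raise]

theorem raise_zero : raise ξ 0 t = t := by simp [raise]

end Raise

section GammaInf

variable {ξ : Ordinal.{v}}

theorem isEnd_Gamma_iff {t : List Ordinal.{v}} :
    IsEnd (Gamma ξ).nodes t ↔ t ∈ maxNodes (Gamma ξ).nodes :=
  (Gamma_regular ξ).tree.isEnd_iff_mem_maxNodes (Gamma_nonempty ξ)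

theorem ne_nil_of_mem_Gamma {t : List Ordinal.{v}} (ht : t ∈ (Gamma ξ).nodes) : t ≠ [] :=
  (Gamma_regular ξ).tree.ne_nil ht

/-- Comparable maximal branches coincide, block after block, so a sequence has at most one place
where its first `n` blocks end. -/
theorem levelEnds_eq_of_prefix {n : ℕ} {s s' a : List Ordinal.{v}} (hs : s ∈ levelEnds ξ n)
    (hs' : s' ∈ levelEnds ξ n) (h : s <+: a) (h' : s' <+: a) : s = s' := by
  induction n generalizing s s' with
  | zero => rw [levelEnds] at hs hs'; exact hs.trans hs'.symm
  | succ n ih =>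
    obtain ⟨s, hs, t, ht, rfl⟩ := hs
    obtain ⟨s', hs', t', ht', rfl⟩ := hs'
    obtain rfl := ih hs hs' ((List.prefix_append _ _).trans h) ((List.prefix_append _ _).trans h')
    congr 2
    rcases List.prefix_or_prefix_of_prefix h h' with h | h
    · rw [List.prefix_append_right_inj, raise_prefix_iff] at h
      exact (ht.2 _ ht'.1 h).symm
    · rw [List.prefix_append_right_inj, raise_prefix_iff] at h
      exact ht'.2 _ ht.1 h

theorem exists_levelEnds_prefix {n j : ℕ} (h : n ≤ j) {s : List Ordinal.{v}}
    (hs : s ∈ levelEnds ξ j) : ∃ e ∈ levelEnds ξ n, e <+: s := by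
  induction j, h using Nat.le_induction generalizing s with
  | base => exact ⟨s, hs, List.prefix_refl s⟩
  | succ j _ ih =>
    obtain ⟨s, hs, t, -, rfl⟩ := hs
    obtain ⟨e, he, hes⟩ := ih hs
    exact ⟨e, he, hes.trans (List.prefix_append _ _)⟩

theorem levelEnds_disjoint {n j : ℕ} {s : List Ordinal.{v}} (hs : s ∈ levelEnds ξ n)
    (hs' : s ∈ levelEnds ξ j) (h : n < j) : False := by
  obtain ⟨e, ⟨s₀, hs₀, t₀, ht₀, rfl⟩, hes⟩ := exists_levelEnds_prefix (Nat.succ_le_of_lt h) hs'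
  obtain rfl := levelEnds_eq_of_prefix hs₀ hs ((List.prefix_append _ _).trans hes)
    (List.prefix_refl s)
  have := hes.length_le
  simp only [List.length_append, length_raise] at this
  exact ne_nil_of_mem_Gamma ht₀.1 (List.length_eq_zero_iff.1 (by omega))

/-- A sequence can be read in two ways only at the border of two blocks: as a complete branch, or as
the empty start of the next one. -/
theorem decomposition_of_lt {n j : ℕ} {s s' t t' : List Ordinal.{v}} (hs : s ∈ levelEnds ξ n)
    (hs' : s' ∈ levelEnds ξ j) (ht : t = [] ∨ t ∈ (Gamma ξ).nodes)
    (h : s ++ raise ξ n t = s' ++ raise ξ j t') (hnj : n < j) :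
    t ∈ maxNodes (Gamma ξ).nodes ∧ t' = [] ∧ j = n + 1 := by
  obtain ⟨e, he', hes⟩ := exists_levelEnds_prefix (Nat.succ_le_of_lt hnj) hs'
  obtain ⟨s₀, hs₀, t₀, ht₀, rfl⟩ := id he'
  have h' : s' <+: s ++ raise ξ n t := h ▸ List.prefix_append _ _
  obtain rfl := levelEnds_eq_of_prefix hs hs₀ (List.prefix_append _ _)
    (((List.prefix_append _ _).trans hes).trans h')
  have h₀ := hes.trans h'
  rw [List.prefix_append_right_inj, raise_prefix_iff] at h₀
  have htG : t ∈ (Gamma ξ).nodes := by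
    rcases ht with rfl | ht
    · exact absurd (List.prefix_nil.1 h₀) (ne_nil_of_mem_Gamma ht₀.1)
    · exact ht
  obtain rfl := ht₀.2 t htG h₀
  have hl := hes.length_le
  have hl' := h'.length_le
  have hs'e : s ++ raise ξ n t = s' := hes.eq_of_length (le_antisymm hl hl')
  refine ⟨ht₀, ?_, ?_⟩
  · rw [hs'e] at h
    simpa using h
  · by_contra hc
    exact levelEnds_disjoint he' (hs'e ▸ hs') (by omega)

/-- The ambiguity at borders disappears if both tails are non-empty, the form suited to weights, or
if both are incomplete, the form suited to positions where Player S has to move. -/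
theorem decomposition_unique {n j : ℕ} {s s' t t' : List Ordinal.{v}} (hs : s ∈ levelEnds ξ n)
    (hs' : s' ∈ levelEnds ξ j) (ht : t = [] ∨ t ∈ (Gamma ξ).nodes)
    (ht' : t' = [] ∨ t' ∈ (Gamma ξ).nodes) (h : s ++ raise ξ n t = s' ++ raise ξ j t')
    (hd : (t ≠ [] ∧ t' ≠ []) ∨ (t ∉ maxNodes (Gamma ξ).nodes ∧ t' ∉ maxNodes (Gamma ξ).nodes)) :
    n = j ∧ s = s' ∧ t = t' := by
  rcases lt_trichotomy n j with hnj | rfl | hnj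
  · have := decomposition_of_lt hs hs' ht h hnj
    rcases hd with hd | hd
    · exact absurd this.2.1 hd.2
    · exact absurd this.1 hd.1
  · obtain rfl := levelEnds_eq_of_prefix hs hs' (List.prefix_append _ _)
      (h.symm ▸ List.prefix_append s' (raise ξ n t'))
    exact ⟨rfl, rfl, raise_injective (List.append_cancel_left h)⟩
  · have := decomposition_of_lt hs' hs ht' h.symm hnj
    rcases hd with hd | hd
    · exact absurd this.2.1 hd.1
    · exact absurd this.1 hd.2

theorem maxNodes_raise {n : ℕ} : maxNodes {a | ∃ s ∈ levelEnds ξ n, ∃ t ∈ (Gamma ξ).nodes,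
    a = s ++ raise ξ n t} = levelEnds ξ (n + 1) := by
  ext a
  constructor
  · rintro ⟨⟨s, hs, t, ht, rfl⟩, hmax⟩
    refine ⟨s, hs, t, ⟨ht, fun r hr htr => ?_⟩, rfl⟩
    have := hmax _ ⟨s, hs, r, hr, rfl⟩
      ((List.prefix_append_right_inj s).2 (raise_prefix_iff.2 htr))
    exact raise_injective (List.append_cancel_left this)
  · rintro ⟨s, hs, t, ht, rfl⟩
    refine ⟨⟨s, hs, t, ht.1, rfl⟩, ?_⟩
    rintro _ ⟨s', hs', t', ht', rfl⟩ h
    obtain rfl := levelEnds_eq_of_prefix hs hs' ((List.prefix_append _ _).trans h)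
      (List.prefix_append _ _)
    rw [List.prefix_append_right_inj, raise_prefix_iff] at h
    rw [ht.2 _ ht' h]

theorem level_nodes (n : ℕ) : (level ξ n).nodes =
    {a | ∃ s ∈ levelEnds ξ n, ∃ t ∈ (Gamma ξ).nodes, a = s ++ raise ξ n t} := by
  induction n with
  | zero => simp [level, levelEnds, raise_zero]
  | succ n ih =>
    ext a
    rw [level, graft, ih, maxNodes_raise]
    constructor
    · rintro ⟨_, ⟨t, ht, rfl⟩, s, hs, rfl⟩
      exact ⟨s, hs, t, ht, rfl⟩
    · rintro ⟨s, hs, t, ht, rfl⟩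
      exact ⟨_, ⟨t, ht, rfl⟩, s, hs, rfl⟩

theorem maxNodes_level (n : ℕ) : maxNodes (level ξ n).nodes = levelEnds ξ (n + 1) := by
  rw [level_nodes, maxNodes_raise]

theorem mem_GammaInf {a : List Ordinal.{v}} : a ∈ (GammaInf ξ).nodes ↔
    ∃ n, ∃ s ∈ levelEnds ξ n, ∃ t ∈ (Gamma ξ).nodes, a = s ++ raise ξ n t := by
  simp only [GammaInf, WTree.iUnion, Set.mem_iUnion, level_nodes, Set.mem_ofPred_eq]

theorem GammaInf_wt {n : ℕ} {s t : List Ordinal.{v}} (hs : s ∈ levelEnds ξ n)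
    (ht : t ∈ (Gamma ξ).nodes) : (GammaInf ξ).wt (s ++ raise ξ n t) = (Gamma ξ).wt t := by
  rw [GammaInf, iUnion_wt (i := n) (by rw [level_nodes]; exact ⟨s, hs, t, ht, rfl⟩)]
  · cases n with
    | zero =>
      rw [levelEnds] at hs
      rw [show s = [] from hs, level, raise_zero, List.nil_append]
    | succ n =>
      rw [level, graft_wt (by rwa [maxNodes_level]), raise, shift_wt]
      exact mem_shift.2 ht
  · intro j hj
    rw [level_nodes] at hj
    obtain ⟨s', hs', t', ht', h⟩ := hj
    exact (decomposition_unique hs' hs (Or.inr ht') (Or.inr ht) h.symm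
      (Or.inl ⟨ne_nil_of_mem_Gamma ht', ne_nil_of_mem_Gamma ht⟩)).1

theorem exists_snoc_of_not_end {t : List Ordinal.{v}} (ht : t = [] ∨ t ∈ (Gamma ξ).nodes)
    (hend : t ∉ maxNodes (Gamma ξ).nodes) : ∃ ζ, t ++ [ζ] ∈ (Gamma ξ).nodes := by
  by_contra! hc
  exact hend (isEnd_Gamma_iff.1 ⟨ht, hc⟩)

theorem nil_notMem_maxNodes : [] ∉ maxNodes (Gamma ξ).nodes := fun h => ne_nil_of_mem_Gamma h.1 rfl

theorem snoc_mem_GammaInf {n : ℕ} {s t : List Ordinal.{v}} (hs : s ∈ levelEnds ξ n)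
    {ζ : Ordinal.{v}} (h : t ++ [ζ] ∈ (Gamma ξ).nodes) :
    s ++ raise ξ n t ++ [ω ^ ξ * n + ζ] ∈ (GammaInf ξ).nodes :=
  mem_GammaInf.2 ⟨n, s, hs, _, h, by rw [raise_append, raise_singleton, List.append_assoc]⟩

/-- By uniqueness of the decomposition with an incomplete tail, Player S cannot leave the current
copy of `Γ_{ξ,1}` before its branch is complete. -/
theorem exists_of_snoc_mem_GammaInf {n : ℕ} {s t : List Ordinal.{v}} (hs : s ∈ levelEnds ξ n)
    (ht : t = [] ∨ t ∈ (Gamma ξ).nodes) (hend : t ∉ maxNodes (Gamma ξ).nodes) {ζ : Ordinal.{v}}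
    (h : s ++ raise ξ n t ++ [ζ] ∈ (GammaInf ξ).nodes) :
    ∃ η, ζ = ω ^ ξ * n + η ∧ t ++ [η] ∈ (Gamma ξ).nodes := by
  obtain ⟨j, s', hs', t', ht', h'⟩ := mem_GammaInf.1 h
  obtain ⟨r, η, rfl⟩ := List.eq_nil_or_concat t' |>.resolve_left (ne_nil_of_mem_Gamma ht')
  rw [List.concat_eq_append] at h' ht'
  rw [raise_append, raise_singleton, ← List.append_assoc] at h'
  obtain ⟨h1, h2⟩ := List.append_inj' h' rfl
  have hr : r = [] ∨ r ∈ (Gamma ξ).nodes := by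
    rcases eq_or_ne r [] with h | h
    · exact Or.inl h
    · exact Or.inr ((Gamma_regular ξ).tree.2 _ _ ht' (List.prefix_append _ _) h)
  have hr' : r ∉ maxNodes (Gamma ξ).nodes := fun hc => (isEnd_Gamma_iff.2 hc).2 η ht'
  obtain ⟨rfl, rfl, rfl⟩ := decomposition_unique hs hs' ht hr h1 (Or.inr ⟨hend, hr'⟩)
  exact ⟨η, by simpa using h2, ht'⟩

theorem exists_decomposition {a : List Ordinal.{v}} (ha : a = [] ∨ a ∈ (GammaInf ξ).nodes) :
    ∃ n, ∃ s ∈ levelEnds ξ n, ∃ t, (t = [] ∨ t ∈ (Gamma ξ).nodes) ∧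
      t ∉ maxNodes (Gamma ξ).nodes ∧ a = s ++ raise ξ n t := by
  rcases ha with rfl | ha
  · exact ⟨0, [], rfl, [], Or.inl rfl, nil_notMem_maxNodes, rfl⟩
  · obtain ⟨n, s, hs, t, ht, rfl⟩ := mem_GammaInf.1 ha
    by_cases h : t ∈ maxNodes (Gamma ξ).nodes
    · exact ⟨n + 1, _, ⟨s, hs, t, h, rfl⟩, [], Or.inl rfl, nil_notMem_maxNodes, by simp⟩
    · exact ⟨n, s, hs, t, Or.inr ht, h, rfl⟩

theorem exists_snoc_mem_GammaInf {a : List Ordinal.{v}} (ha : a = [] ∨ a ∈ (GammaInf ξ).nodes) :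
    ∃ ζ, a ++ [ζ] ∈ (GammaInf ξ).nodes := by
  obtain ⟨n, s, hs, t, ht, hend, rfl⟩ := exists_decomposition ha
  obtain ⟨ζ, hζ⟩ := exists_snoc_of_not_end ht hend
  exact ⟨_, snoc_mem_GammaInf hs hζ⟩

theorem lt_of_snoc_snoc_mem {t : List Ordinal.{v}} {ζ η : Ordinal.{v}}
    (h : t ++ [ζ] ++ [η] ∈ (Gamma ξ).nodes) : η < ζ :=
  (List.pairwise_append.1 ((Gamma_regular ξ).pairwise _ h)).2.2 ζ (by simp) η (by simp)

/-! ### Cuts of infinite branches -/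

theorem initSeg_mem_levelEnds_unique {τ : ℕ → Ordinal.{v}} {n k k' : ℕ}
    (h : initSeg τ k ∈ levelEnds ξ n) (h' : initSeg τ k' ∈ levelEnds ξ n) : k = k' := by
  have := levelEnds_eq_of_prefix h h' (initSeg_prefix τ (le_max_left k k'))
    (initSeg_prefix τ (le_max_right k k'))
  simpa using congrArg List.length this

theorem cut_eq {τ : ℕ → Ordinal.{v}} {n k : ℕ} (h : initSeg τ k ∈ levelEnds ξ n) :
    cut ξ τ n = k := by
  cases n with
  | zero =>
    rw [levelEnds] at h
    simpa [cut] using (congrArg List.length (show initSeg τ k = [] from h)).symm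
  | succ n =>
    rw [cut, maxNodes_level]
    exact initSeg_mem_levelEnds_unique
      (Nat.sInf_mem (s := {k | initSeg τ k ∈ levelEnds ξ (n + 1)}) ⟨k, h⟩) h

/-- Inside a copy of `Γ_{ξ,1}` the entries decrease, so well-founded induction on a bound `α` for
the possible next entries shows that every block ends after finitely many turns. -/
theorem exists_initSeg_mem_levelEnds_succ {τ : ℕ → Ordinal.{v}}
    (hτ : τ ∈ body (GammaInf ξ).nodes) {n : ℕ} {s : List Ordinal.{v}} (hs : s ∈ levelEnds ξ n)
    (α : Ordinal.{v}) : ∀ (t : List Ordinal.{v}) (k : ℕ), initSeg τ k = s ++ raise ξ n t →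
      (t = [] ∨ t ∈ (Gamma ξ).nodes) → (∀ ζ, t ++ [ζ] ∈ (Gamma ξ).nodes → ζ < α) →
      ∃ k', initSeg τ k' ∈ levelEnds ξ (n + 1) := by
  induction α using WellFoundedLT.induction with
  | ind α ih =>
    intro t k hk ht hα
    by_cases hend : t ∈ maxNodes (Gamma ξ).nodes
    · exact ⟨k, s, hs, t, hend, hk⟩
    · have h := hτ k
      rw [initSeg_succ, hk] at h
      obtain ⟨η, hη, hηt⟩ := exists_of_snoc_mem_GammaInf hs ht hend h
      refine ih η (hα η hηt) (t ++ [η]) (k + 1) ?_ (Or.inr hηt) fun ζ hζ => lt_of_snoc_snoc_mem hζ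
      rw [initSeg_succ, hk, hη, raise_append, raise_singleton, List.append_assoc]

theorem initSeg_cut_mem {τ : ℕ → Ordinal.{v}} (hτ : τ ∈ body (GammaInf ξ).nodes) (n : ℕ) :
    initSeg τ (cut ξ τ n) ∈ levelEnds ξ n := by
  have : ∃ k, initSeg τ k ∈ levelEnds ξ n := by
    induction n with
    | zero => exact ⟨0, rfl⟩
    | succ n ih =>
      obtain ⟨k, hk⟩ := ih
      exact exists_initSeg_mem_levelEnds_succ hτ hk (ω ^ ξ) [] k (by simp) (Or.inl rfl)
        fun ζ hζ => (Gamma_regular ξ).lt _ hζ ζ (by simp)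
  obtain ⟨k, hk⟩ := this
  rwa [cut_eq hk]

theorem block_eq (𝕜 : Type*) [RCLike 𝕜] {X : Type u} [NormedAddCommGroup X] [NormedSpace 𝕜 X]
    {τ : ℕ → Ordinal.{v}} {n k : ℕ} {t : List Ordinal.{v}} (hk : initSeg τ k ∈ levelEnds ξ n)
    (ht : t ∈ maxNodes (Gamma ξ).nodes)
    (h : initSeg τ (k + t.length) = initSeg τ k ++ raise ξ n t) (x : ℕ → X) :
    block 𝕜 ξ τ x n =
      ∑ j ∈ Finset.range t.length, (((Gamma ξ).wt (t.take (j + 1)) : ℝ) : 𝕜) • x (k + j) := by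
  have h1 : initSeg τ (k + t.length) ∈ levelEnds ξ (n + 1) := ⟨_, hk, t, ht, h⟩
  rw [block, cut_eq hk, cut_eq h1, Finset.sum_Ico_eq_sum_range, Nat.add_sub_cancel_left]
  refine Finset.sum_congr rfl fun j hj => ?_
  have hj := Finset.mem_range.1 hj
  have : initSeg τ (k + j + 1) = initSeg τ k ++ raise ξ n (t.take (j + 1)) := by
    rw [← take_initSeg τ (n := k + t.length) (by omega), h, List.take_append]
    rw [List.take_of_length_le (by simp; omega), take_raise, length_initSeg,
      show k + j + 1 - k = j + 1 by omega]
  rw [this, GammaInf_wt hk ((Gamma_regular ξ).tree.take_mem ht.1 j)]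

end GammaInf

/-! ### Forcing an outcome in finitely many turns -/

section Forces

/-- Player S can reach, in finitely many turns from a given position, a position in `A`. -/
inductive Forces {Ω : Type*} {B : Type*} (T : Set (List Ω)) (D 𝔤 : Set (Set B))
    (A : List (Ω × Set B) → Prop) : List (Ω × Set B) → Prop
  | done (b) : A b → Forces T D 𝔤 A b
  | step (b ζ u) : b.map Prod.fst ++ [ζ] ∈ T → u ∈ D →
      (∀ G ∈ 𝔤, G ⊆ u → Forces T D 𝔤 A (b ++ [(ζ, G)])) → Forces T D 𝔤 A b

variable {Ω Ω' : Type*} {B : Type*} {T : Set (List Ω)} {T' : Set (List Ω')} {D 𝔤 : Set (Set B)}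

/-- Replays a forcing on another tree, after the position `pre` and with nodes renamed by `f`. The
final positions are only required to force the new outcome, so that plays can be composed. -/
theorem Forces.transfer {A : List (Ω × Set B) → Prop} {A' : List (Ω' × Set B) → Prop}
    (f : Ω → Ω') (pre : List (Ω' × Set B))
    (hT : ∀ t ∈ T, pre.map Prod.fst ++ t.map f ∈ T')
    (hA : ∀ b, A b → Forces T' D 𝔤 A' (pre ++ b.map (Prod.map f id))) {b : List (Ω × Set B)}
    (h : Forces T D 𝔤 A b) : Forces T' D 𝔤 A' (pre ++ b.map (Prod.map f id)) := by
  induction h with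
  | done b h => exact hA b h
  | step b ζ u hζ hu _ ih =>
    refine Forces.step _ (f ζ) u ?_ hu fun G hG hGu => ?_
    · have := hT _ hζ
      simpa [Function.comp_def] using this
    · simpa using ih G hG hGu

end Forces

/-! ### Filters of moves -/

section MoveFilter

variable (𝕜 : Type*) [RCLike 𝕜] (X : Type u) [NormedAddCommGroup X] [NormedSpace 𝕜 X]

theorem inter_mem_CD {U V : Set X} (hU : U ∈ CD 𝕜 X) (hV : V ∈ CD 𝕜 X) : U ∩ V ∈ CD 𝕜 X := by
  obtain ⟨Z, hZ, hZf, rfl⟩ := hU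
  obtain ⟨Y, hY, hYf, rfl⟩ := hV
  refine ⟨Z ⊓ Y, hZ.inter hY, Submodule.CoFG.inf hZf hYf, ?_⟩
  ext x
  simp only [Set.mem_inter_iff, SetLike.mem_coe, Submodule.mem_inf]
  tauto

theorem closedBall_mem_CD : Metric.closedBall (0 : X) 1 ∈ CD 𝕜 X :=
  ⟨⊤, isClosed_univ, Submodule.CoFG.top, by simp⟩

/-- The filter generated by the members of `CD(X)`. -/
def pointFilter : Filter X where
  sets := {A | ∃ U ∈ CD 𝕜 X, U ⊆ A}
  univ_sets := ⟨_, closedBall_mem_CD 𝕜 X, Set.subset_univ _⟩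
  sets_of_superset := fun ⟨U, hU, h⟩ h' => ⟨U, hU, h.trans h'⟩
  inter_sets := fun ⟨U, hU, h⟩ ⟨V, hV, h'⟩ =>
    ⟨U ∩ V, inter_mem_CD 𝕜 X hU hV, Set.inter_subset_inter h h'⟩

/-- The moves of Player V inside small members of `CD(X)`. -/
def moveFilter (𝔤 : Set (Set X)) : Filter (Set X) := (pointFilter 𝕜 X).smallSets ⊓ 𝓟 𝔤

variable {𝕜 X}

theorem eventually_pointFilter {A : X → Prop} :
    (∀ᶠ x in pointFilter 𝕜 X, A x) ↔ ∃ U ∈ CD 𝕜 X, ∀ x ∈ U, A x := Iff.rfl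

theorem frequently_pointFilter {A : X → Prop} :
    (∃ᶠ x in pointFilter 𝕜 X, A x) ↔ ∀ U ∈ CD 𝕜 X, ∃ x ∈ U, A x := by
  rw [Filter.Frequently, eventually_pointFilter]
  push Not
  rfl

theorem eventually_moveFilter {𝔤 : Set (Set X)} {A : Set X → Prop} :
    (∀ᶠ G in moveFilter 𝕜 X 𝔤, A G) ↔ ∃ U ∈ CD 𝕜 X, ∀ G ∈ 𝔤, G ⊆ U → A G := by
  rw [moveFilter, eventually_inf_principal, eventually_smallSets]
  constructor
  · rintro ⟨s, ⟨U, hU, hUs⟩, h⟩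
    exact ⟨U, hU, fun G hG hGU => h G (hGU.trans hUs) hG⟩
  · rintro ⟨U, hU, h⟩
    exact ⟨U, ⟨U, hU, subset_rfl⟩, fun G hGU hG => h G hG hGU⟩

end MoveFilter

/-! ### Weighted sums of moves -/

section WSum

variable (𝕜 : Type*) [RCLike 𝕜] {X : Type u} [NormedAddCommGroup X] [NormedSpace 𝕜 X]

/-- The set of combinations of points of given sets, with given real coefficients. -/
def combos (c : List ℝ) (G : List (Set X)) : Set X :=
  (List.zipWith (fun (a : ℝ) (g : Set X) => (a : 𝕜) • g) c G).sum

/-- The set of combinations, with the weights of the tree `W`, of points of the sets in a play. -/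
def weightedSum (W : WTree.{v}) (b : List (Ordinal.{v} × Set X)) : Set X :=
  combos 𝕜 (branchWts W (b.map Prod.fst)) (b.map Prod.snd)

theorem combos_append {c c' : List ℝ} {G G' : List (Set X)} (h : c.length = G.length) :
    combos 𝕜 (c ++ c') (G ++ G') = combos 𝕜 c G + combos 𝕜 c' G' := by
  rw [combos, List.zipWith_append h, List.sum_append]; rfl

theorem combos_mul (d : ℝ) (c : List ℝ) (G : List (Set X)) :
    combos 𝕜 (c.map (d * ·)) G = (d : 𝕜) • combos 𝕜 c G := by
  induction c generalizing G with
  | nil => simp [combos]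
  | cons a c ih =>
    cases G with
    | nil => simp [combos]
    | cons g G =>
      simp only [combos, List.map_cons, List.zipWith_cons_cons, List.sum_cons, smul_add,
        RCLike.ofReal_mul, mul_smul] at ih ⊢
      rw [ih]

theorem sum_mem_combos {c : List ℝ} {G : List (Set X)} (x : ℕ → X) (hcG : c.length = G.length)
    (hx : ∀ j (h : j < G.length), x j ∈ G[j]) :
    ∑ j ∈ Finset.range c.length, ((c.getD j 0 : ℝ) : 𝕜) • x j ∈ combos 𝕜 c G := by
  induction c generalizing G x with
  | nil => simp [combos]
  | cons a c ih =>
    cases G with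
    | nil => simp at hcG
    | cons g G =>
      rw [List.length_cons, Finset.sum_range_succ', add_comm]
      simp only [combos, List.zipWith_cons_cons, List.sum_cons]
      refine Set.add_mem_add (Set.smul_mem_smul_set (hx 0 (by simp))) ?_
      simp only [List.getD_cons_succ]
      exact ih (fun j => x (j + 1)) (by simpa using hcG) fun j hj =>
        hx (j + 1) (by simpa using hj)

theorem isCompact_combos {c : List ℝ} {G : List (Set X)} (hG : ∀ g ∈ G, IsCompact g) :
    IsCompact (combos 𝕜 c G) := by
  induction c generalizing G with
  | nil => simp [combos]
  | cons a c ih =>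
    cases G with
    | nil => simp [combos]
    | cons g G =>
      simp only [combos, List.zipWith_cons_cons, List.sum_cons]
      exact ((hG g (by simp)).smul _).add (ih fun g hg => hG g (by simp [hg]))

end WSum

/-! ### Forcing averages -/

section ForceAverages

variable (𝕜 : Type*) [RCLike 𝕜] {X : Type u} [NormedAddCommGroup X] [NormedSpace 𝕜 X]
  {𝔤 : Set (Set X)}

/-- Player S can force the weighted sum along a maximal branch of `W` into `A`. -/
def ForcesSum (W : WTree.{v}) (𝔤 : Set (Set X)) (A : Set X → Prop) : Prop :=
  Forces W.nodes (CD 𝕜 X) 𝔤 (fun b => IsEnd W.nodes (b.map Prod.fst) ∧ A (weightedSum 𝕜 W b)) []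

theorem forcesSum_shift {W : WTree.{v}} {A : Set X → Prop} (α : Ordinal.{v})
    (h : ForcesSum 𝕜 W 𝔤 A) : ForcesSum 𝕜 (shift α W) 𝔤 A := by
  refine h.transfer (α + ·) [] (fun t ht => mem_shift.2 ht) fun b hb => Forces.done _ ?_
  rw [weightedSum, List.nil_append, List.map_map, List.map_map]
  have h1 : b.map (Prod.fst ∘ Prod.map (α + ·) id) = (b.map Prod.fst).map (α + ·) := by simp
  have h2 : b.map (Prod.snd ∘ Prod.map (α + ·) (id : Set X → Set X)) = b.map Prod.snd := by
    simp
  rw [h1, h2, branchWts_shift]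
  exact ⟨isEnd_shift.2 ⟨_, hb.1, rfl⟩, hb.2⟩

theorem forcesSum_scale {W : WTree.{v}} {A : Set X → Prop} (c : ℝ)
    (h : ForcesSum 𝕜 W 𝔤 fun s => A ((c : 𝕜) • s)) : ForcesSum 𝕜 (scale c W) 𝔤 A := by
  have := h.transfer (T' := (scale c W).nodes)
    (A' := fun b => IsEnd (scale c W).nodes (b.map Prod.fst) ∧ A (weightedSum 𝕜 (scale c W) b))
    id [] (fun t ht => by rw [List.map_id]; exact ht) fun b hb => Forces.done _ ?_
  · exact this
  · rw [weightedSum]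
    simp only [List.nil_append, Prod.map_id, List.map_id, branchWts_scale, combos_mul]
    exact hb

theorem forcesSum_iUnion {ι : Type w} {U : ι → WTree.{v}} {A : Set X → Prop}
    (hU : ∀ i, IsTree (U i).nodes)
    (hd : ∀ i j ζ, [ζ] ∈ (U i).nodes → [ζ] ∈ (U j).nodes → i = j) {i : ι}
    (hne : (U i).nodes.Nonempty) (h : ForcesSum 𝕜 (U i) 𝔤 A) : ForcesSum 𝕜 (iUnion U) 𝔤 A := by
  have := h.transfer (T' := (iUnion U).nodes)
    (A' := fun b => IsEnd (iUnion U).nodes (b.map Prod.fst) ∧ A (weightedSum 𝕜 (iUnion U) b))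
    id [] (fun t ht => by
      rw [List.map_id]
      exact show t ∈ ⋃ i, (U i).nodes from Set.mem_iUnion.2 ⟨i, ht⟩) fun b hb => Forces.done _ ?_
  · exact this
  · obtain ⟨h1, h2⟩ := isEnd_iUnion_of_isEnd hU hd hne hb.1
    rw [weightedSum]
    simp only [List.nil_append, Prod.map_id, List.map_id, branchWts_iUnion hU hd h1]
    exact ⟨h2, hb.2⟩

/-- Two transfers: the play on `W` is copied unchanged, and the play on `V` is then appended to the
maximal branch reached. -/
theorem forcesSum_concat {W V : WTree.{v}} {A : Set X → Prop} (hW : IsTree W.nodes)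
    (hne : W.nodes.Nonempty) (hV : IsTree V.nodes)
    (h : ForcesSum 𝕜 W 𝔤 fun s => ForcesSum 𝕜 V 𝔤 fun s' => A (s + s')) :
    ForcesSum 𝕜 (concat W V) 𝔤 A := by
  have := h.transfer (T' := (concat W V).nodes)
    (A' := fun b => IsEnd (concat W V).nodes (b.map Prod.fst) ∧
      A (weightedSum 𝕜 (concat W V) b))
    id [] (fun t ht => by rw [List.map_id]; exact mem_concat.2 (Or.inl ht)) fun b hb => ?_
  · exact this
  obtain ⟨hb1, hb2⟩ := hb
  rw [hW.isEnd_iff_mem_maxNodes hne] at hb1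
  have := hb2.transfer (T' := (concat W V).nodes)
    (A' := fun b => IsEnd (concat W V).nodes (b.map Prod.fst) ∧
      A (weightedSum 𝕜 (concat W V) b))
    id b (fun t ht => mem_concat.2 (Or.inr ⟨_, hb1, t, ht, by simp⟩)) fun b' hb' =>
      Forces.done _ ?_
  · simpa using this
  · simp only [Prod.map_id, List.map_id, List.map_append]
    refine ⟨(isEnd_concat hW hne hV).2 ⟨_, hb1, _, hb'.1, rfl⟩, ?_⟩
    rw [weightedSum, List.map_append, List.map_append, branchWts_concat hW hV hb1 hb'.1.1,
      combos_append _ (by simp)]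
    exact hb'.2

theorem forcesSum_stack {ξ : Ordinal.{v}} {W : WTree.{v}} (hW : W.Regular (ω ^ ξ) 1)
    (hne : W.nodes.Nonempty) {F : Filter (Set X)}
    (h : ∀ A : Set X → Prop, (∀ᶠ s in F, A s) → ForcesSum 𝕜 W 𝔤 A) (n : ℕ) :
    ∀ A : Set X → Prop, (∀ᶠ s in sumFilter F n, A s) → ForcesSum 𝕜 (stack ξ W n) 𝔤 A := by
  induction n with
  | zero =>
    intro A hA
    rw [sumFilter, eventually_pure] at hA
    refine Forces.done _ ⟨⟨Or.inl rfl, fun ζ hζ => hζ⟩, ?_⟩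
    simpa [weightedSum, combos, branchWts] using hA
  | succ n ih =>
    intro A hA
    rw [sumFilter, eventually_bind] at hA
    rw [stack_succ]
    refine forcesSum_concat 𝕜 (hW.shift _).tree (nonempty_shift hne) (hW.stack hne n).tree
      (forcesSum_shift 𝕜 _ (h _ ?_))
    exact hA.mono fun s hs => ih _ (eventually_map.1 hs)

/-- What happens eventually along the filter of averages can be forced on `Γ_{ξ,1}`. -/
theorem forcesSum_Gamma (ξ : Ordinal.{v}) : ∀ A : Set X → Prop,
    (∀ᶠ s in avgFilter 𝕜 (moveFilter 𝕜 X 𝔤) ξ, A s) → ForcesSum 𝕜 (Gamma ξ) 𝔤 A := by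
  induction ξ using induction_add_one_limit with
  | zero =>
    intro A hA
    rw [avgFilter_zero, eventually_moveFilter] at hA
    obtain ⟨U, hU, hA⟩ := hA
    rw [Gamma_zero]
    refine Forces.step _ 0 U rfl hU fun G hG hGU => Forces.done _ ⟨isEnd_single.2 rfl, ?_⟩
    simpa [weightedSum, combos, branchWts, single] using hA G hG hGU
  | add_one ξ ih =>
    intro A hA
    rw [avgFilter_add_one, eventually_bind] at hA
    -- A single `n` is enough, because Player S chooses the piece of the union.
    obtain ⟨n, hn⟩ := hA.exists
    rw [Gamma_add_one]
    refine forcesSum_iUnion 𝕜 (i := n)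
      (fun i => ((Gamma_regular ξ).stack (Gamma_nonempty ξ) (i + 1)).tree)
      (disjoint_stack (Gamma_regular ξ) (Gamma_nonempty ξ))
      (nonempty_stack (Gamma_nonempty ξ) n) (forcesSum_scale 𝕜 _ ?_)
    exact forcesSum_stack 𝕜 (Gamma_regular ξ) (Gamma_nonempty ξ) ih _ _ (eventually_map.1 hn)
  | limit ξ hξ ih =>
    intro A hA
    rw [avgFilter_limit 𝕜 hξ, eventually_bind] at hA
    have : Nonempty (Set.Iio ξ) := ⟨⟨0, hξ.bot_lt⟩⟩
    obtain ⟨ζ, hζ⟩ := hA.exists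
    rw [Gamma_limit hξ]
    exact forcesSum_iUnion 𝕜 (i := ζ) (fun i => ((Gamma_regular (i.1 + 1)).shift _).tree)
      (disjoint_shift (W := fun ζ => Gamma (ζ + 1)) fun ζ _ => Gamma_regular _)
      (nonempty_shift (Gamma_nonempty _))
      (forcesSum_shift 𝕜 _ (ih _ (hξ.add_one_lt ζ.2) A hζ))

end ForceAverages

/-! ### From points to compact sets -/

section Nets

variable (𝕜 : Type*) [RCLike 𝕜] {X : Type u} [NormedAddCommGroup X] [NormedSpace 𝕜 X]

/-- The set `s` has a finite `η`-net consisting of points with the property `A`. -/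
def HasNet (η : ℝ) (A : X → Prop) (s : Set X) : Prop :=
  ∃ N : Set X, N.Finite ∧ (∀ v ∈ N, A v) ∧ ∀ x ∈ s, ∃ v ∈ N, ‖x - v‖ ≤ η

/-- A finite net reduces the continuation of a whole set to finitely many points, for which the
eventual statements can be intersected. The accumulated error `n * η` shrinks back to `η` when
averages are taken. -/
theorem eventually_hasNet_sumFilter {F : Filter X} {Fs : Filter (Set X)} {η : ℝ}
    (h : ∀ A : X → Prop, (∀ᶠ x in F, A x) → ∀ᶠ s in Fs, HasNet η A s) (n : ℕ) :
    ∀ A : X → Prop, (∀ᶠ x in sumFilter F n, A x) →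
      ∀ᶠ s in sumFilter Fs n, HasNet (n * η) A s := by
  induction n with
  | zero =>
    intro A hA
    rw [sumFilter, eventually_pure] at hA ⊢
    exact ⟨{0}, Set.finite_singleton _, by simpa using hA, by simp⟩
  | succ n ih =>
    intro A hA
    rw [sumFilter, eventually_bind] at hA ⊢
    filter_upwards [h _ hA]
    rintro s ⟨N, hN, hNA, hs⟩
    rw [eventually_map]
    have : ∀ᶠ s' in sumFilter Fs n, ∀ v ∈ N, HasNet (n * η) (fun y => A (v + y)) s' :=
      (eventually_all_finite hN).2 fun v hv => ih _ (eventually_map.1 (hNA v hv))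
    filter_upwards [this] with s' hs'
    choose! M hM hMA hMs using hs'
    refine ⟨⋃ v ∈ N, (v + ·) '' M v, hN.biUnion fun v hv => (hM v hv).image _, ?_, ?_⟩
    · intro y hy
      simp only [Set.mem_iUnion] at hy
      obtain ⟨v, hv, y, hy, rfl⟩ := hy
      exact hMA v hv y hy
    · rintro _ ⟨x, hx, y, hy, rfl⟩
      obtain ⟨v, hv, hxv⟩ := hs x hx
      obtain ⟨z, hz, hyz⟩ := hMs v hv y hy
      refine ⟨v + z, Set.mem_biUnion hv ⟨z, hz, rfl⟩, ?_⟩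
      calc ‖x + y - (v + z)‖ = ‖(x - v) + (y - z)‖ := by congr 1; abel
        _ ≤ η + n * η := (norm_add_le _ _).trans (add_le_add hxv hyz)
        _ = ((n + 1 : ℕ) : ℝ) * η := by push_cast; ring

theorem eventually_hasNet_avgFilter {F : Filter X} {Fs : Filter (Set X)} {η : ℝ}
    (h : ∀ A : X → Prop, (∀ᶠ x in F, A x) → ∀ᶠ s in Fs, HasNet η A s) (ξ : Ordinal.{v}) :
    ∀ A : X → Prop, (∀ᶠ x in avgFilter 𝕜 F ξ, A x) →
      ∀ᶠ s in avgFilter 𝕜 Fs ξ, HasNet η A s := by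
  induction ξ using induction_add_one_limit with
  | zero => simpa using h
  | add_one ξ ih =>
    intro A hA
    rw [avgFilter_add_one, eventually_bind] at hA ⊢
    filter_upwards [hA] with n hn
    rw [eventually_map] at hn ⊢
    filter_upwards [eventually_hasNet_sumFilter ih (n + 1) _ hn]
    rintro s ⟨N, hN, hNA, hs⟩
    refine ⟨(((1 / ((n : ℝ) + 1) : ℝ) : 𝕜) • ·) '' N, hN.image _, ?_, ?_⟩
    · rintro _ ⟨y, hy, rfl⟩
      exact hNA y hy
    · rintro _ ⟨x, hx, rfl⟩
      obtain ⟨v, hv, hxv⟩ := hs x hx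
      refine ⟨_, ⟨v, hv, rfl⟩, ?_⟩
      have hn1 : (0 : ℝ) < n + 1 := by positivity
      rw [← smul_sub, norm_smul, RCLike.norm_ofReal, abs_of_pos (by positivity), one_div,
        inv_mul_le_iff₀ hn1]
      exact_mod_cast hxv
  | limit ξ hξ ih =>
    intro A hA
    rw [avgFilter_limit 𝕜 hξ, eventually_bind] at hA ⊢
    filter_upwards [hA] with ζ hζ
    exact ih _ (hξ.add_one_lt ζ.2) A hζ

theorem eventually_hasNet_compactMoves {η : ℝ} (hη : 0 < η) (A : X → Prop)
    (hA : ∀ᶠ x in pointFilter 𝕜 X, A x) :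
    ∀ᶠ s in moveFilter 𝕜 X (compactMoves X), HasNet η A s := by
  obtain ⟨U, hU, hA⟩ := eventually_pointFilter.1 hA
  refine eventually_moveFilter.2 ⟨U, hU, fun G hG hGU => ?_⟩
  obtain ⟨N, hNG, hN, hcov⟩ := Metric.finite_approx_of_totallyBounded hG.1.totallyBounded η hη
  refine ⟨N, hN, fun v hv => hA v (hGU (hNG hv)), fun x hx => ?_⟩
  obtain ⟨v, hv, hxv⟩ := Set.mem_iUnion₂.1 (hcov hx)
  exact ⟨v, hv, by rw [← dist_eq_norm]; exact (Metric.mem_ball.1 hxv).le⟩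

end Nets

/-! ### Derivatives of trees -/

section Deriv

variable {Ω : Type w}

@[simp] theorem treeDeriv_zero (T : Set (List Ω)) : treeDeriv T (0 : Ordinal.{v}) = T := by
  rw [treeDeriv, Ordinal.limitRecOn_zero]

theorem treeDeriv_add_one (T : Set (List Ω)) (ζ : Ordinal.{v}) :
    treeDeriv T (ζ + 1) = treeDeriv T ζ \ maxNodes (treeDeriv T ζ) := by
  rw [treeDeriv, Ordinal.limitRecOn_add_one]; rfl

theorem treeDeriv_limit (T : Set (List Ω)) {ζ : Ordinal.{v}} (hζ : Order.IsSuccLimit ζ) :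
    treeDeriv T ζ = ⋂ (η : Ordinal.{v}) (_ : η < ζ), treeDeriv T η := by
  rw [treeDeriv, Ordinal.limitRecOn_limit _ _ _ _ hζ]; rfl

/-- By `hlt`, a node with `ρ t = ζ` is maximal in the derivative of order `ζ`; by `hex`, a node with
`ρ t > ζ` still has a proper extension there. -/
theorem treeDeriv_eq_of_rank {S : Set (List Ω)} (ρ : List Ω → Ordinal.{v})
    (hlt : ∀ t ∈ S, ∀ s ∈ S, t <+: s → t ≠ s → ρ s < ρ t)
    (hex : ∀ t ∈ S, ∀ β < ρ t, ∃ s ∈ S, t <+: s ∧ t ≠ s ∧ β ≤ ρ s) (ζ : Ordinal.{v}) :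
    treeDeriv S ζ = {t | t ∈ S ∧ ζ ≤ ρ t} := by
  induction ζ using induction_add_one_limit with
  | zero => simp
  | add_one ζ ih =>
    rw [treeDeriv_add_one, ih]
    ext t
    constructor
    · rintro ⟨⟨ht, hζ⟩, hmax⟩
      refine ⟨ht, Order.add_one_le_of_lt (lt_of_le_of_ne hζ ?_)⟩
      rintro rfl
      refine hmax ⟨⟨ht, le_rfl⟩, fun s hs hts => ?_⟩
      by_contra hne
      exact (hlt t ht s hs.1 hts (Ne.symm hne)).not_ge hs.2
    · rintro ⟨ht, hζ⟩
      have hζ := Order.add_one_le_iff.1 hζ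
      refine ⟨⟨ht, hζ.le⟩, fun hmax => ?_⟩
      obtain ⟨s, hs, hts, hne, hle⟩ := hex t ht ζ hζ
      exact hne (hmax.2 s ⟨hs, hle⟩ hts).symm
  | limit ζ hζ ih =>
    rw [treeDeriv_limit _ hζ]
    ext t
    simp only [Set.mem_iInter]
    constructor
    · intro h
      have h0 := h 0 hζ.bot_lt
      rw [treeDeriv_zero] at h0
      refine ⟨h0, hζ.le_iff_forall_le.2 fun η hη => ?_⟩
      have := h η hη
      rw [ih η hη] at this
      exact this.2
    · rintro ⟨ht, hle⟩ η hη
      rw [ih η hη]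
      exact ⟨ht, hη.le.trans hle⟩

end Deriv

/-! ### The weak topology and finite-codimensional subspaces -/

section Weak

variable {𝕜 : Type*} [RCLike 𝕜] {X : Type u} [NormedAddCommGroup X] [NormedSpace 𝕜 X]

/-- A basic weak neighbourhood of `0` involves finitely many functionals, and their common kernel is
closed and of finite codimension. -/
theorem exists_CD_of_mem_nhds {V : Set (WeakSpace 𝕜 X)} (hV : V ∈ 𝓝 (0 : WeakSpace 𝕜 X)) :
    ∃ U ∈ CD 𝕜 X, ∀ x ∈ U, toWeakSpace 𝕜 X x ∈ V := by
  have hV' : V ∈ Filter.comap (fun (x : WeakSpace 𝕜 X) (f : X →L[𝕜] 𝕜) =>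
      (topDualPairing 𝕜 X).flip x f) (𝓝 fun f => (topDualPairing 𝕜 X).flip 0 f) := by
    have := nhds_induced (fun (x : WeakSpace 𝕜 X) (f : X →L[𝕜] 𝕜) =>
      (topDualPairing 𝕜 X).flip x f) (0 : WeakSpace 𝕜 X)
    exact this ▸ hV
  obtain ⟨W, hW, hWV⟩ := hV'
  rw [nhds_pi, Filter.mem_pi] at hW
  obtain ⟨I, hI, t, ht, hIt⟩ := hW
  refine ⟨_, ⟨⨅ f ∈ I, LinearMap.ker (f : X →ₗ[𝕜] 𝕜), ?_, ?_, rfl⟩, fun x hx => hWV (hIt ?_)⟩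
  · simp only [Submodule.coe_iInf]
    exact isClosed_biInter fun f _ => f.isClosed_ker
  · rw [← sInf_image]
    refine Submodule.CoFG.sInf_of_finite (hI.image _) ?_
    rintro _ ⟨f, -, rfl⟩
    exact Submodule.CoFG.ker _
  · intro f hf
    have h1 : x ∈ LinearMap.ker (f : X →ₗ[𝕜] 𝕜) := by
      have := hx.1
      simp only [SetLike.mem_coe, Submodule.mem_iInf] at this
      exact this f hf
    have h2 : f x = 0 := by simpa using h1
    have h3 : (topDualPairing 𝕜 X).flip x f = (topDualPairing 𝕜 X).flip 0 f := by
      rw [map_zero]; exact h2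
    have h4 := mem_of_mem_nhds (ht f)
    rw [← h3] at h4
    exact h4

theorem zero_mem_closure_of_frequently {A : X → Prop} (h : ∃ᶠ x in pointFilter 𝕜 X, A x) :
    (0 : WeakSpace 𝕜 X) ∈ closure (toWeakSpace 𝕜 X '' {x | A x}) := by
  rw [mem_closure_iff_nhds]
  intro V hV
  obtain ⟨U, hU, hUV⟩ := exists_CD_of_mem_nhds hV
  obtain ⟨x, hx, hA⟩ := frequently_pointFilter.1 h U hU
  exact ⟨_, hUV x hx, x, hA, rfl⟩

/-- In coordinates, `f` is a finite family of functionals. Applied to quotient maps, this makes the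
distance to a closed subspace of finite codimension weakly continuous. -/
theorem continuous_of_weakSpace {E : Type*} [NormedAddCommGroup E] [NormedSpace 𝕜 E]
    [FiniteDimensional 𝕜 E] (f : X →L[𝕜] E) :
    Continuous fun x : WeakSpace 𝕜 X => f ((toWeakSpace 𝕜 X).symm x) := by
  let e : E ≃L[𝕜] (Fin (Module.finrank 𝕜 E) → 𝕜) := ContinuousLinearEquiv.ofFinrankEq (by simp)
  have : Continuous fun x : WeakSpace 𝕜 X => e (f ((toWeakSpace 𝕜 X).symm x)) := by
    refine continuous_pi fun i => ?_
    exact WeakBilin.eval_continuous (topDualPairing 𝕜 X).flip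
      ((ContinuousLinearMap.proj (R := 𝕜) (φ := fun _ => 𝕜) i).comp ((e : E →L[𝕜] _).comp f))
  have h := e.symm.continuous.comp this
  simp only [Function.comp_def, ContinuousLinearEquiv.symm_apply_apply] at h
  exact h

/-- Points in the weak closure of which `0` lies are norm close to any given closed subspace of
finite codimension. -/
theorem exists_norm_sub_lt_of_zero_mem_closure {S : Set X} {Z : Submodule 𝕜 X}
    (hZ : IsClosed (Z : Set X)) (hZf : FiniteDimensional 𝕜 (X ⧸ Z))
    (h : (0 : WeakSpace 𝕜 X) ∈ closure (toWeakSpace 𝕜 X '' S)) {η : ℝ} (hη : 0 < η) :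
    ∃ x ∈ S, ∃ z ∈ Z, ‖x - z‖ < η := by
  have : IsClosed (Z : Set X) := hZ
  let π : X →L[𝕜] X ⧸ Z := Z.mkQL
  have hc := continuous_of_weakSpace π
  have hnhds : {x : WeakSpace 𝕜 X | ‖π ((toWeakSpace 𝕜 X).symm x)‖ < η} ∈
      𝓝 (0 : WeakSpace 𝕜 X) :=
    (isOpen_lt hc.norm continuous_const).mem_nhds (by simpa using hη)
  obtain ⟨_, hx, x, hxS, rfl⟩ := mem_closure_iff_nhds.1 h _ hnhds
  have hx : ‖(Z.mkQ x)‖ < η := by simpa [π] using hx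
  -- The quotient norm is an infimum over the coset: `m` is a representative of norm less than `η`,
  -- and `x - m` lies in `Z`.
  obtain ⟨m, hm, hmη⟩ := Submodule.Quotient.norm_mk_lt (Z.mkQ x) (sub_pos.2 hx)
  refine ⟨x, hxS, x - m, ?_, by simpa using hmη⟩
  rw [← Submodule.Quotient.mk_eq_zero, Submodule.Quotient.mk_sub, hm]
  simp

end Weak

/-! ### Weakly null trees from clocks -/

section TreeOfClock

variable {X : Type u} {I : Type*} (P : X → Set I) (o : Ordinal.{v}) (S : Set I)

/-- The ordinal at the end of a sequence of pairs. -/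
noncomputable def lastOrd (l : List (o.ToType × X)) : Ordinal.{v} :=
  l.getLast?.elim o fun a => (ToType.mk.symm a.1).1

/-- The constraints left at the end of a sequence of pairs. -/
def leftSet (l : List (o.ToType × X)) : Set I := {i | i ∈ S ∧ ∀ a ∈ l, i ∈ P a.2}

@[simp] theorem lastOrd_nil : lastOrd o ([] : List (o.ToType × X)) = o := rfl

@[simp] theorem lastOrd_snoc (l : List (o.ToType × X)) (a : o.ToType × X) :
    lastOrd o (l ++ [a]) = (ToType.mk.symm a.1).1 := by simp [lastOrd]

theorem leftSet_snoc (l : List (o.ToType × X)) (a : o.ToType × X) :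
    leftSet P o S (l ++ [a]) = leftSet P o S l ∩ P a.2 := by
  ext i
  simp only [leftSet, List.mem_append, List.mem_singleton, Set.mem_ofPred_eq, Set.mem_inter_iff]
  constructor
  · exact fun h => ⟨⟨h.1, fun b hb => h.2 b (Or.inl hb)⟩, h.2 a (Or.inr rfl)⟩
  · rintro ⟨⟨h1, h2⟩, h3⟩
    refine ⟨h1, ?_⟩
    rintro b (hb | rfl)
    exacts [h2 b hb, h3]

variable (𝕜 : Type*) [RCLike 𝕜] [NormedAddCommGroup X] [NormedSpace 𝕜 X]

/-- The tree of all finite sequences produced by Player V while a clock runs down from `o`. -/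
def clockTree (B : Set X) : Set (List (o.ToType × X)) :=
  {l | l ≠ [] ∧ l.Pairwise (fun a b => (ToType.mk.symm b.1).1 < (ToType.mk.symm a.1).1) ∧
    (∀ a ∈ l, a.2 ∈ B) ∧ ∀ s, s <+: l → s ≠ [] →
      Survives (pointFilter 𝕜 X) P (lastOrd o s) (leftSet P o S s)}

/-- A tree of finite sequences from the points produced by Player V, when the set of constraints
survives. -/
theorem exists_tree_of_survives {P : X → Set I} {o : Ordinal.{v}} {S : Set I} (B : Set X)
    (hB : ∀ᶠ x in pointFilter 𝕜 X, x ∈ B) (h : Survives (pointFilter 𝕜 X) P o S) :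
    ∃ (Ω : Type (max u v)) (T : Set (List Ω)) (x : List Ω → X), IsTree T ∧ HasRank T o ∧
      (∀ t ∈ T, x t ∈ B) ∧ WeaklyNull.{u, v} 𝕜 T x ∧
      ∀ t ∈ T, ∃ i ∈ S, ∀ k < t.length, i ∈ P (x (t.take (k + 1))) := by
  have hT0 : [] ∉ clockTree P o S 𝕜 B := fun h => h.1 rfl
  have hsurv : ∀ t ∈ insert [] (clockTree P o S 𝕜 B),
      Survives (pointFilter 𝕜 X) P (lastOrd o t) (leftSet P o S t) := by
    rintro t (rfl | ht)
    · exact h.mono fun i hi => ⟨hi, by simp⟩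
    · exact ht.2.2.2 t (List.prefix_refl t) ht.1
  -- At every node each smaller ordinal is available as the next clock value, with frequently many
  -- points. The first fact gives the rank of the tree, the second its weak nullity.
  have hchild : ∀ t ∈ insert [] (clockTree P o S 𝕜 B), ∀ β < lastOrd o t, ∃ b : o.ToType,
      (ToType.mk.symm b).1 = β ∧ ∃ᶠ x in pointFilter 𝕜 X,
        t ++ [(b, x)] ∈ clockTree P o S 𝕜 B := by
    intro t ht β hβ
    have hle : lastOrd o t ≤ o := by
      rcases List.eq_nil_or_concat t with rfl | ⟨r, a, rfl⟩
      · simp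
      · rw [List.concat_eq_append, lastOrd_snoc]
        exact (ToType.mk.symm a.1).2.le
    refine ⟨ToType.mk ⟨β, hβ.trans_le hle⟩, by simp,
      (((hsurv t ht).frequently hβ).and_eventually hB).mono fun x hx => ?_⟩
    have hpw : t.Pairwise (fun a b => (ToType.mk.symm b.1).1 < (ToType.mk.symm a.1).1) := by
      rcases ht with rfl | ht
      exacts [List.Pairwise.nil, ht.2.1]
    refine ⟨by simp, List.pairwise_append.2 ⟨hpw, by simp, ?_⟩, ?_, ?_⟩
    · intro a ha b hb
      obtain rfl := List.mem_singleton.1 hb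
      simp only [OrderIso.symm_apply_apply]
      rcases List.eq_nil_or_concat t with rfl | ⟨r, c, rfl⟩
      · simp at ha
      · rw [List.concat_eq_append] at ha hβ hpw
        rw [lastOrd_snoc] at hβ
        rcases List.mem_append.1 ha with ha | ha
        · exact hβ.trans ((List.pairwise_append.1 hpw).2.2 a ha c (by simp))
        · rwa [List.mem_singleton.1 ha]
    · intro a ha
      rcases List.mem_append.1 ha with ha | ha
      · rcases ht with rfl | ht
        · simp at ha
        · exact ht.2.2.1 a ha
      · rw [List.mem_singleton.1 ha]
        exact hx.2
    · intro s hs hne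
      rcases List.prefix_concat_iff.1 hs with rfl | hs
      · rw [lastOrd_snoc, leftSet_snoc]
        simpa using hx.1
      · rcases ht with rfl | ht
        · exact absurd (List.prefix_nil.1 hs) hne
        · exact ht.2.2.2 s hs hne
  have hlt : ∀ t ∈ insert [] (clockTree P o S 𝕜 B), ∀ s ∈ insert [] (clockTree P o S 𝕜 B),
      t <+: s → t ≠ s → lastOrd o s < lastOrd o t := by
    rintro t - s hs ⟨r, rfl⟩ hne
    rcases List.eq_nil_or_concat r with rfl | ⟨r, b, rfl⟩
    · simp at hne
    rw [List.concat_eq_append, ← List.append_assoc] at hs ⊢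
    rw [lastOrd_snoc]
    rcases List.eq_nil_or_concat t with rfl | ⟨t, a, rfl⟩
    · exact (ToType.mk.symm b.1).2
    · rw [List.concat_eq_append] at hs ⊢
      rw [lastOrd_snoc]
      rcases hs with hs | hs
      · simp at hs
      · exact (List.pairwise_append.1 hs.2.1).2.2 a (by simp) b (by simp)
  have hex : ∀ t ∈ insert [] (clockTree P o S 𝕜 B), ∀ β < lastOrd o t,
      ∃ s ∈ clockTree P o S 𝕜 B, t <+: s ∧ t ≠ s ∧ β ≤ lastOrd o s := by
    intro t ht β hβ
    obtain ⟨b, hb, hx⟩ := hchild t ht β hβ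
    obtain ⟨x, hx⟩ := hx.exists
    exact ⟨_, hx, List.prefix_append _ _, by simp, by simp [hb]⟩
  have hd := treeDeriv_eq_of_rank (lastOrd o)
    (fun t ht s hs => hlt t (Or.inr ht) s (Or.inr hs)) (fun t ht => hex t (Or.inr ht))
  have hd' := treeDeriv_eq_of_rank (lastOrd o) hlt fun t ht β hβ => by
    obtain ⟨s, hs, h⟩ := hex t ht β hβ
    exact ⟨s, Or.inr hs, h⟩
  -- Using `o.ToType` for the ordinals below `o` keeps the index type in the universe demanded by
  -- `modulusAt`. The vector at a node is its last point; the default `0` at `[]` plays no role.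
  refine ⟨o.ToType × X, clockTree P o S 𝕜 B, fun l => l.getLast?.elim 0 Prod.snd,
    ⟨hT0, ?_⟩, ⟨?_, ?_⟩, ?_, ?_, ?_⟩
  · intro s t ht hst hne
    exact ⟨hne, ht.2.1.sublist hst.sublist, fun a ha => ht.2.2.1 a (hst.subset ha),
      fun r hr => ht.2.2.2 r (hr.trans hst)⟩
  · rw [hd, Set.eq_empty_iff_forall_notMem]
    rintro t ⟨ht, hot⟩
    exact (hlt [] (Or.inl rfl) t (Or.inr ht) (by simp) (Ne.symm ht.1)).not_ge hot
  · intro β hβ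
    rw [hd, ← Set.nonempty_iff_ne_empty]
    obtain ⟨s, hs, -, -, hle⟩ := hex [] (Or.inl rfl) β hβ
    exact ⟨s, hs, hle⟩
  · intro t ht
    rcases List.eq_nil_or_concat t with rfl | ⟨t, a, rfl⟩
    · exact absurd ht hT0
    · simpa using ht.2.2.1 a (by simp)
  · intro ζ t ht
    rw [hd'] at ht
    obtain ⟨ht, hζ⟩ := ht
    obtain ⟨b, hb, hx⟩ := hchild t ht ζ (Order.add_one_le_iff.1 hζ)
    refine closure_mono ?_ (zero_mem_closure_of_frequently hx)
    rintro _ ⟨x, hx, rfl⟩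
    refine ⟨t ++ [(b, x)], ⟨?_, by simp⟩, by simp⟩
    rw [hd]
    exact ⟨hx, by simp [hb]⟩
  · intro t ht
    obtain ⟨i, hi, hit⟩ := (hsurv t (Or.inr ht)).nonempty
    refine ⟨i, hi, fun k hk => ?_⟩
    have : (t.take (k + 1)).getLast? = some t[k] := by
      rw [List.take_succ_eq_append_getElem hk, List.getLast?_append_of_ne_nil _ (by simp),
        List.getLast?_singleton]
    show i ∈ P ((t.take (k + 1)).getLast?.elim 0 Prod.snd)
    rw [this]
    exact hit _ (List.getElem_mem hk)

end TreeOfClock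

/-! ### Flat norms and averages along `Γ_{ξ,1}`. -/

section Modulus

variable {𝕜 : Type*} [RCLike 𝕜] {X : Type u} [NormedAddCommGroup X] [NormedSpace 𝕜 X]

/-! ### The modulus and its values on trees -/

/-- Hahn–Banach extension from the line spanned by `w`, dominated by `p`; the bound by `b` makes the
extension continuous. -/
theorem exists_norming_functional {p : Seminorm 𝕜 X} {b : ℝ} (hb : ∀ x, p x ≤ b * ‖x‖) (w : X) :
    ∃ φ : X →L[𝕜] 𝕜, (∀ x, ‖φ x‖ ≤ p x) ∧ φ w = (p w : 𝕜) := by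
  rcases eq_or_ne w 0 with rfl | hw
  · exact ⟨0, fun x => by simp, by simp⟩
  · let f : Module.Dual 𝕜 (Submodule.span 𝕜 {w}) :=
      ((p w : ℝ) : 𝕜) • (LinearEquiv.coord 𝕜 X w hw : Submodule.span 𝕜 {w} →ₗ[𝕜] 𝕜)
    have hf : ∀ c : 𝕜, f (c • ⟨w, Submodule.mem_span_singleton_self w⟩) = (p w : 𝕜) * c := by
      intro c
      have : LinearEquiv.coord 𝕜 X w hw ⟨w, Submodule.mem_span_singleton_self w⟩ = 1 :=
        LinearEquiv.coord_self 𝕜 X w hw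
      rw [map_smul]
      show c • ((p w : 𝕜) • LinearEquiv.coord 𝕜 X w hw ⟨w, _⟩) = _
      rw [this]
      simp [mul_comm]
    obtain ⟨g, hg, hgp⟩ := Module.Dual.exists_extension_of_le_seminorm (p := p) _ f (by
      rintro ⟨x, hx⟩
      obtain ⟨c, rfl⟩ := Submodule.mem_span_singleton.1 hx
      have := hf c
      rw [show (⟨c • w, hx⟩ : Submodule.span 𝕜 {w}) =
        c • ⟨w, Submodule.mem_span_singleton_self w⟩ from rfl, this]
      simp [map_smul_eq_mul, mul_comm, abs_of_nonneg (apply_nonneg p w)])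
    refine ⟨g.mkContinuous b fun x => (hgp x).trans (hb x), hgp, ?_⟩
    have := hg ⟨w, Submodule.mem_span_singleton_self w⟩
    have h1 := hf 1
    rw [one_smul, mul_one] at h1
    exact this.trans h1

theorem re_map_ofReal_smul (φ : X →L[𝕜] 𝕜) (c : ℝ) (x : X) :
    RCLike.re (φ ((c : 𝕜) • x)) = c * RCLike.re (φ x) := by
  rw [map_smul, _root_.smul_eq_mul, RCLike.re_ofReal_mul]

theorem le_re_of_mem_branchHull {Ω : Type w} {x : List Ω → X} {t : List Ω} (φ : X →L[𝕜] 𝕜) {a : ℝ}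
    (h : ∀ k < t.length, a ≤ RCLike.re (φ (x (t.take (k + 1))))) {z : X}
    (hz : z ∈ branchHull 𝕜 x t) : a ≤ RCLike.re (φ z) := by
  obtain ⟨c, hc, hc1, rfl⟩ := hz
  rw [map_sum, map_sum]
  calc a = ∑ i ∈ Finset.range t.length, c i * a := by rw [← Finset.sum_mul, hc1, one_mul]
    _ ≤ _ := Finset.sum_le_sum fun i hi => by
      rw [re_map_ofReal_smul]
      exact mul_le_mul_of_nonneg_left (h i (Finset.mem_range.1 hi)) (hc i)

theorem mem_branchHull_of_lt {Ω : Type w} (x : List Ω → X) {t : List Ω} {k : ℕ}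
    (hk : k < t.length) : x (t.take (k + 1)) ∈ branchHull 𝕜 x t := by
  refine ⟨fun i => if i = k then 1 else 0, fun i => by positivity, by simp [hk], ?_⟩
  rw [Finset.sum_eq_single k]
  · simp
  · intro i _ hik
    simp [hik]
  · simp [hk]

theorem HasRank.nonempty {Ω : Type w} {T : Set (List Ω)} {o : Ordinal.{v}} (h : HasRank T o)
    (ho : 0 < o) : T.Nonempty := by
  have := h.2 0 ho
  rwa [treeDeriv_zero, ← Set.nonempty_iff_ne_empty] at this

/-- The values of which `modulusAt` is the supremum of the infima. -/
def treeValues (p : Seminorm 𝕜 X) (σ : ℝ) (y : X) {Ω : Type w} (T : Set (List Ω))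
    (x : List Ω → X) : Set ℝ :=
  {s : ℝ | ∃ t ∈ T, ∃ z ∈ branchHull 𝕜 x t, s = p (y + ((σ : ℝ) : 𝕜) • z) - 1}

variable {p : Seminorm 𝕜 X} {σ : ℝ} {y : X} {Ω : Type w} {T : Set (List Ω)} {x : List Ω → X}

theorem bddBelow_treeValues : BddBelow (treeValues p σ y T x) := by
  refine ⟨-1, ?_⟩
  rintro _ ⟨t, -, z, -, rfl⟩
  linarith [apply_nonneg p (y + ((σ : ℝ) : 𝕜) • z)]

theorem exists_treeValues_le (hσ : 0 ≤ σ) (hT : IsTree T) (hne : T.Nonempty)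
    (hx : ∀ t ∈ T, p (x t) ≤ 1) : ∃ s ∈ treeValues p σ y T x, s ≤ p y + σ - 1 := by
  obtain ⟨t, ht⟩ := hne
  have h0 : 0 < t.length := List.length_pos_of_ne_nil (hT.ne_nil ht)
  refine ⟨_, ⟨t, ht, _, mem_branchHull_of_lt x h0, rfl⟩, ?_⟩
  have h1 := map_add_le_add p y (((σ : ℝ) : 𝕜) • x (t.take (0 + 1)))
  have h2 := mul_le_mul_of_nonneg_left (hx _ (hT.take_mem ht 0)) hσ
  rw [map_smul_eq_mul, RCLike.norm_ofReal, abs_of_nonneg hσ] at h1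
  linarith

theorem sInf_treeValues_le (hσ : 0 ≤ σ) (hT : IsTree T) (hne : T.Nonempty)
    (hx : ∀ t ∈ T, p (x t) ≤ 1) : sInf (treeValues p σ y T x) ≤ p y + σ - 1 := by
  obtain ⟨s, hs, hle⟩ := exists_treeValues_le hσ hT hne hx
  exact (csInf_le bddBelow_treeValues hs).trans hle

/-- A real supremum bounds its elements only when the set is bounded; the uniform bound `σ` comes
from the first vector of a branch. -/
theorem sInf_treeValues_le_zero {ξ : Ordinal.{v}} (hσ : 0 ≤ σ) (h : modulus p ξ σ = 0)
    (hy : p y ≤ 1) {Ω : Type (max u v)} {T : Set (List Ω)} {x : List Ω → X} (hT : IsTree T)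
    (hr : HasRank T (ω ^ ξ)) (hx : ∀ t ∈ T, p (x t) ≤ 1) (hw : WeaklyNull.{u, v} 𝕜 T x) :
    sInf (treeValues p σ y T x) ≤ 0 := by
  have hω : 0 < ω ^ ξ := opow_pos _ omega0_pos
  have key : ∀ y : X, p y ≤ 1 → σ ∈ upperBounds {r : ℝ | ∃ (Ω : Type (max u v))
      (T : Set (List Ω)) (x : List Ω → X),
      IsTree T ∧ HasRank T (ω ^ ξ) ∧ (∀ t ∈ T, p (x t) ≤ 1) ∧
      WeaklyNull.{u, v} 𝕜 T x ∧ r = sInf (treeValues p σ y T x)} := by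
    rintro y hy _ ⟨Ω, T, x, hT, hr, hx, -, rfl⟩
    exact (sInf_treeValues_le hσ hT (hr.nonempty hω) hx).trans (by linarith)
  have h1 : sInf (treeValues p σ y T x) ≤ modulusAt p ξ σ y :=
    le_csSup ⟨σ, key y hy⟩ ⟨Ω, T, x, hT, hr, hx, hw, rfl⟩
  have h2 : modulusAt p ξ σ y ≤ modulus p ξ σ := by
    refine le_csSup ⟨σ, ?_⟩ ⟨y, hy, rfl⟩
    rintro _ ⟨y, hy, rfl⟩
    exact Real.sSup_le (key y hy) hσ
  linarith

theorem WeaklyNull.smul (c : 𝕜) (h : WeaklyNull.{u, v} 𝕜 T x) :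
    WeaklyNull.{u, v} 𝕜 T fun t => c • x t := by
  intro ζ t ht
  have := map_mem_closure (continuous_const_smul c) (h ζ t ht)
    (t := (fun s => toWeakSpace 𝕜 X (c • x s)) '' {s | s ∈ treeDeriv T ζ ∧ s.dropLast = t}) ?_
  · simpa using this
  · rintro _ ⟨s, hs, rfl⟩
    exact ⟨s, hs, by simp⟩

/-! ### Averages in an asymptotically uniformly flat space -/

/-- Otherwise functionals norming the perturbed vectors survive `ω ^ ξ` and yield a weakly null tree
with one functional exceeding `1 + ε / 2` along each branch. It does so on the convex hull of the
branch too, so the infimum in the modulus is at least `ε / 2`. -/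
theorem eventually_avgFilter_of_modulus {ξ : Ordinal.{v}} {b : ℝ} (hb0 : 0 < b)
    (hb : ∀ x, p x ≤ b * ‖x‖) (hσ : 0 < σ) (h : modulus p ξ σ = 0) (hy : p y ≤ 1) {ε : ℝ}
    (hε : 0 < ε) : ∀ᶠ z in avgFilter 𝕜 (pointFilter 𝕜 X) ξ,
      p (y + ((σ / b : ℝ) : 𝕜) • z) ≤ 1 + ε := by
  by_contra hc
  rw [Filter.not_eventually] at hc
  let I := {φ : X →L[𝕜] 𝕜 // ∀ x, ‖φ x‖ ≤ p x}
  -- With these choices `0 < ev φ x - θ φ` says that `Re φ (y + (σ / b) x) > 1 + ε / 2`; the assumed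
  -- excess `ε` leaves the margin `δ = ε / 2`.
  let ev : I → X → ℝ := fun φ x => σ / b * RCLike.re (φ.1 x)
  let θ : I → ℝ := fun φ => 1 + ε / 2 - RCLike.re (φ.1 y)
  have hball : ∀ᶠ x in pointFilter 𝕜 X, x ∈ Metric.closedBall (0 : X) 1 :=
    eventually_pointFilter.2 ⟨_, closedBall_mem_CD 𝕜 X, fun x hx => hx⟩
  have hσb : 0 < σ / b := by positivity
  have hS := survives_of_avgFilter (𝕜 := 𝕜) (F := pointFilter 𝕜 X) (M := σ) ev θ
    (fun i x y => by simp only [ev, map_add]; ring)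
    (fun i c x => by simp only [ev, re_map_ofReal_smul]; ring)
    (hball.mono fun x hx i => by
      have h1 : RCLike.re (i.1 x) ≤ b := by
        refine ((RCLike.re_le_norm _).trans (i.2 x)).trans ((hb x).trans ?_)
        have := mem_closedBall_zero_iff.1 hx
        nlinarith
      have h2 : RCLike.re (i.1 y) ≤ 1 := ((RCLike.re_le_norm _).trans (i.2 y)).trans hy
      have h3 : σ / b * RCLike.re (i.1 x) ≤ σ := by
        calc σ / b * RCLike.re (i.1 x) ≤ σ / b * b := by gcongr
          _ = σ := div_mul_cancel₀ _ hb0.ne'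
      simp only [ev, θ]
      linarith) ξ (ε / 2) (half_pos hε) 0 Set.univ (hc.mono fun z hz => by
      rw [survives_zero_iff]
      obtain ⟨φ, hφ, hφz⟩ := exists_norming_functional hb (y + ((σ / b : ℝ) : 𝕜) • z)
      refine ⟨⟨φ, hφ⟩, trivial, ?_⟩
      have h1 : RCLike.re (φ (y + ((σ / b : ℝ) : 𝕜) • z)) = p (y + ((σ / b : ℝ) : 𝕜) • z) := by
        rw [hφz, RCLike.ofReal_re]
      rw [map_add, map_add, re_map_ofReal_smul] at h1
      simp only [ev, θ, Set.mem_ofPred_eq]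
      linarith [not_le.1 hz])
  rw [zero_add] at hS
  obtain ⟨Ω, T, x, hT, hr, hx, hw, hP⟩ := exists_tree_of_survives 𝕜 _ hball hS
  have hω : 0 < ω ^ ξ := opow_pos _ omega0_pos
  -- Division by `b` moves the vectors from the unit ball of `X` into that of `p`, and turns the
  -- coefficient `σ / b` into `σ`.
  have hx' : ∀ t ∈ T, p (((b⁻¹ : ℝ) : 𝕜) • x t) ≤ 1 := fun t ht => by
    rw [map_smul_eq_mul, RCLike.norm_ofReal, abs_of_pos (inv_pos.2 hb0), inv_mul_le_iff₀ hb0]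
    have := mem_closedBall_zero_iff.1 (hx t ht)
    nlinarith [hb (x t)]
  have h1 := sInf_treeValues_le_zero hσ.le h hy hT hr hx' (hw.smul _)
  obtain ⟨s₀, hs₀, -⟩ := exists_treeValues_le (y := y) hσ.le hT (hr.nonempty hω) hx'
  have h2 : ε / 2 ≤ sInf (treeValues p σ y T fun t => ((b⁻¹ : ℝ) : 𝕜) • x t) := by
    refine le_csInf ⟨s₀, hs₀⟩ ?_
    rintro _ ⟨t, ht, z, hz, rfl⟩
    obtain ⟨φ, -, hφ⟩ := hP t ht
    have h3 := le_re_of_mem_branchHull φ.1 (a := (1 + ε / 2 - RCLike.re (φ.1 y)) / σ)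
      (fun k hk => by
        have := hφ k hk
        simp only [ev, θ, Set.mem_ofPred_eq, sub_pos] at this
        rw [re_map_ofReal_smul, div_le_iff₀ hσ]
        calc _ ≤ σ / b * RCLike.re (φ.1 (x (t.take (k + 1)))) := this.le
          _ = _ := by field_simp) hz
    rw [div_le_iff₀ hσ] at h3
    have h4 := (RCLike.re_le_norm _).trans (φ.2 (y + ((σ : ℝ) : 𝕜) • z))
    rw [map_add, map_add, re_map_ofReal_smul] at h4
    linarith
  linarith

/-- In `y = (R - 1) (y / R) + y / R` only the second summand is perturbed, so the error stays `ε`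
and is not multiplied by `R`. -/
theorem eventually_avgFilter_of_le {ξ : Ordinal.{v}} {b : ℝ} (hb0 : 0 < b)
    (hb : ∀ x, p x ≤ b * ‖x‖) (hσ : 0 < σ) (h : modulus p ξ σ = 0) {R : ℝ} (hR : 1 ≤ R)
    (hy : p y ≤ R) {ε : ℝ} (hε : 0 < ε) : ∀ᶠ z in avgFilter 𝕜 (pointFilter 𝕜 X) ξ,
      p (y + ((σ / b : ℝ) : 𝕜) • z) ≤ R + ε := by
  have hR0 : 0 < R := by linarith
  have hy1 : p (((R⁻¹ : ℝ) : 𝕜) • y) ≤ 1 := by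
    rw [map_smul_eq_mul, RCLike.norm_ofReal, abs_of_pos (inv_pos.2 hR0), inv_mul_le_iff₀ hR0]
    linarith
  filter_upwards [eventually_avgFilter_of_modulus hb0 hb hσ h hy1 hε] with z hz
  have hdec : y + ((σ / b : ℝ) : 𝕜) • z = ((R - 1 : ℝ) : 𝕜) • (((R⁻¹ : ℝ) : 𝕜) • y) +
      (((R⁻¹ : ℝ) : 𝕜) • y + ((σ / b : ℝ) : 𝕜) • z) := by
    have h1 : ((R : ℝ) : 𝕜) • (((R⁻¹ : ℝ) : 𝕜) • y) = y := by
      rw [smul_smul, ← RCLike.ofReal_mul, mul_inv_cancel₀ hR0.ne', RCLike.ofReal_one, one_smul]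
    rw [RCLike.ofReal_sub, RCLike.ofReal_one, sub_smul, h1, one_smul]
    abel
  rw [hdec]
  refine (map_add_le_add p _ _).trans ?_
  rw [map_smul_eq_mul p (((R - 1 : ℝ)) : 𝕜), RCLike.norm_ofReal, abs_of_nonneg (by linarith)]
  nlinarith

/-- Both arguments are approximated, `K` by a finite net and the averaged set by the net from
`eventually_hasNet_avgFilter`; the pointwise estimate is applied to pairs of net points. -/
theorem eventually_compact_of_modulus {ξ : Ordinal.{v}} {b : ℝ} (hb0 : 0 < b)
    (hb : ∀ x, p x ≤ b * ‖x‖) (hσ : 0 < σ) (h : modulus p ξ σ = 0) {R : ℝ} (hR : 1 ≤ R)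
    {K : Set X} (hK : IsCompact K) (hKR : ∀ y ∈ K, p y ≤ R) {ε : ℝ} (hε : 0 < ε) :
    ∀ᶠ s in avgFilter 𝕜 (moveFilter 𝕜 X (compactMoves X)) ξ,
      ∀ y ∈ K, ∀ z ∈ s, p (y + ((σ / b : ℝ) : 𝕜) • z) ≤ R + ε := by
  have hσb : 0 < σ / b := by positivity
  -- The two terms are the `p`-costs of replacing `y` and `z` by net points; together they use half
  -- of `ε`.
  obtain ⟨η, hη, hηε⟩ : ∃ η : ℝ, 0 < η ∧ b * η + σ / b * (b * η) ≤ ε / 2 := by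
    refine ⟨ε / (2 * (b + σ)), by positivity, le_of_eq ?_⟩
    field_simp
  obtain ⟨N, hNK, hN, hcov⟩ := Metric.finite_approx_of_totallyBounded hK.totallyBounded η hη
  have h1 : ∀ᶠ z in avgFilter 𝕜 (pointFilter 𝕜 X) ξ, ∀ y ∈ N,
      p (y + ((σ / b : ℝ) : 𝕜) • z) ≤ R + ε / 2 :=
    (eventually_all_finite hN).2 fun y hy =>
      eventually_avgFilter_of_le hb0 hb hσ h hR (hKR y (hNK hy)) (half_pos hε)
  filter_upwards [eventually_hasNet_avgFilter 𝕜 (eventually_hasNet_compactMoves 𝕜 hη) ξ _ h1]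
  rintro s ⟨M, -, hM, hs⟩ y hy z hz
  obtain ⟨y', hy', hyy'⟩ := Set.mem_iUnion₂.1 (hcov hy)
  obtain ⟨z', hz', hzz'⟩ := hs z hz
  have hdec : y + ((σ / b : ℝ) : 𝕜) • z = (y' + ((σ / b : ℝ) : 𝕜) • z') +
      ((y - y') + ((σ / b : ℝ) : 𝕜) • (z - z')) := by
    rw [smul_sub]; abel
  have h2 : p (y - y') ≤ b * η := (hb _).trans (by
    rw [Metric.mem_ball, dist_eq_norm] at hyy'
    gcongr)
  have h3 : p (z - z') ≤ b * η := (hb _).trans (by gcongr)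
  have h4 : p (((σ / b : ℝ) : 𝕜) • (z - z')) ≤ σ / b * (b * η) := by
    rw [map_smul_eq_mul, RCLike.norm_ofReal, abs_of_pos hσb]
    gcongr
  rw [hdec]
  have h5 := map_add_le_add p (y' + ((σ / b : ℝ) : 𝕜) • z')
    ((y - y') + ((σ / b : ℝ) : 𝕜) • (z - z'))
  have h6 := map_add_le_add p (y - y') (((σ / b : ℝ) : 𝕜) • (z - z'))
  linarith [hM z' hz' y' hy']

end Modulus

/-! ### Monotonicity of forcing in the outcome. -/

section Forces

variable {Ω : Type*} {B : Type*} {T : Set (List Ω)} {D 𝔤 : Set (Set B)}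

theorem Forces.mono {A A' : List (Ω × Set B) → Prop} {b : List (Ω × Set B)}
    (h : Forces T D 𝔤 A b) (hb : ∀ e ∈ b, e.2 ∈ 𝔤)
    (hA : ∀ b, (∀ e ∈ b, e.2 ∈ 𝔤) → A b → A' b) : Forces T D 𝔤 A' b := by
  induction h with
  | done b h => exact Forces.done _ (hA b hb h)
  | step b ζ u hζ hu _ ih =>
    refine Forces.step _ ζ u hζ hu fun G hG hGu => ih G hG hGu fun e he => ?_
    rcases List.mem_append.1 he with he | he
    · exact hb e he
    · rw [List.mem_singleton.1 he]
      exact hG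

end Forces

/-! ### Plays on the levels of `Γ_{ξ,∞}` -/

/-- The copy of a play on `Γ_{ξ,1}` in the level with index `n` of `Γ_{ξ,∞}`. -/
noncomputable def raisePlay {X : Type u} (ξ : Ordinal.{v}) (n : ℕ) (b : List (Ordinal.{v} × Set X)) :
    List (Ordinal.{v} × Set X) :=
  b.map (Prod.map (ω ^ ξ * n + ·) id)

theorem map_fst_raisePlay {X : Type u} (ξ : Ordinal.{v}) (n : ℕ) (b : List (Ordinal.{v} × Set X)) :
    (raisePlay ξ n b).map Prod.fst = raise ξ n (b.map Prod.fst) := by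
  simp [raisePlay, raise]

/-! ### From a flat norm to a strategy against compact sets. -/

section Strategy

variable {𝕜 : Type*} [RCLike 𝕜] {X : Type u} [NormedAddCommGroup X] [NormedSpace 𝕜 X]

/-! ### Bounded blocks -/

/-- After `n` complete blocks, the signed sums of blocks lie in a compact set on which `p` is
at most `2 - 2⁻ⁿ`. -/
def Controlled (p : Seminorm 𝕜 X) (σ : ℝ) (ξ : Ordinal.{v}) (n : ℕ)
    (s : List (Ordinal.{v} × Set X)) : Prop :=
  ∃ K : Set X, IsCompact K ∧ (∀ y ∈ K, p y ≤ 2 - (1 / 2) ^ n) ∧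
    (∀ c : 𝕜, ‖c‖ = 1 → ∀ y ∈ K, c • y ∈ K) ∧
    ∀ α : ℕ → Ordinal.{v} × Set X, initSeg α s.length = s → ∀ x : ℕ → X, (∀ i, x i ∈ (α i).2) →
      ∀ c : ℕ → 𝕜, (∀ i, ‖c i‖ = 1) →
        ∑ j ∈ Finset.range n, c j • (σ : 𝕜) • block 𝕜 ξ (fun i => (α i).1) x j ∈ K

variable {p : Seminorm 𝕜 X} {σ : ℝ} {ξ : Ordinal.{v}}

theorem controlled_nil : Controlled p σ ξ 0 [] := by
  refine ⟨{0}, isCompact_singleton, ?_, ?_, ?_⟩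
  · simp only [Set.mem_singleton_iff, forall_eq, map_zero]
    norm_num
  · simp
  · simp

theorem block_mem_weightedSum {n : ℕ} {s b : List (Ordinal.{v} × Set X)}
    (hs : s.map Prod.fst ∈ levelEnds ξ n) (hb : b.map Prod.fst ∈ maxNodes (Gamma ξ).nodes)
    {α : ℕ → Ordinal.{v} × Set X}
    (hα : initSeg α (s ++ raisePlay ξ n b).length = s ++ raisePlay ξ n b)
    {x : ℕ → X} (hx : ∀ i, x i ∈ (α i).2) :
    block 𝕜 ξ (fun i => (α i).1) x n ∈ weightedSum 𝕜 (Gamma ξ) b := by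
  have hlen : (s ++ raisePlay ξ n b).length = s.length + b.length := by simp [raisePlay]
  rw [hlen] at hα
  have hαs : initSeg α s.length = s := by
    rw [← take_initSeg α (Nat.le_add_right s.length b.length), hα]
    simp
  have h1 : initSeg (fun i => (α i).1) s.length = s.map Prod.fst := by
    rw [← map_initSeg, hαs]
  have h2 := block_eq 𝕜 (τ := fun i => (α i).1) (n := n) (k := s.length)
    (t := b.map Prod.fst) (by rwa [h1]) hb (by
      rw [h1, ← map_initSeg, List.length_map, hα, List.map_append, map_fst_raisePlay]) x
  rw [h2, weightedSum]
  have h3 := sum_mem_combos 𝕜 (c := branchWts (Gamma ξ) (b.map Prod.fst))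
    (G := b.map Prod.snd) (fun j => x (s.length + j)) (by simp) fun j hj => by
      have hj' : j < b.length := by simpa using hj
      have h4 : (initSeg α (s.length + b.length))[s.length + j]'(by simpa using hj') =
          α (s.length + j) := by simp [initSeg]
      have h5 : (b.map Prod.snd)[j] = (α (s.length + j)).2 := by
        rw [← h4]
        simp only [hα]
        rw [List.getElem_append_right (Nat.le_add_right _ _)]
        simp [raisePlay]
      rw [h5]
      exact hx _
  rw [length_branchWts] at h3
  convert h3 using 1
  refine Finset.sum_congr rfl fun j hj => ?_
  have hj := Finset.mem_range.1 hj
  congr 2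
  rw [List.getD_eq_getElem _ _ (by simpa using hj)]
  simp [branchWts]

/-- The new compact set consists of the `y + c σ z` with `|c| = 1`. Rotation invariance of `K` moves
the factor `c` from the new block to `y`, so estimating `y + σ z` suffices. -/
theorem controlled_append {n : ℕ} {s b : List (Ordinal.{v} × Set X)} {K : Set X}
    (hK : IsCompact K) (hKc : ∀ c : 𝕜, ‖c‖ = 1 → ∀ y ∈ K, c • y ∈ K)
    (hKα : ∀ α : ℕ → Ordinal.{v} × Set X, initSeg α s.length = s →
      ∀ x : ℕ → X, (∀ i, x i ∈ (α i).2) → ∀ c : ℕ → 𝕜, (∀ i, ‖c i‖ = 1) →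
        ∑ j ∈ Finset.range n, c j • (σ : 𝕜) • block 𝕜 ξ (fun i => (α i).1) x j ∈ K)
    (hs : s.map Prod.fst ∈ levelEnds ξ n) (hb : b.map Prod.fst ∈ maxNodes (Gamma ξ).nodes)
    (hbc : ∀ e ∈ b, IsCompact e.2)
    (h : ∀ y ∈ K, ∀ z ∈ weightedSum 𝕜 (Gamma ξ) b,
      p (y + (σ : 𝕜) • z) ≤ 2 - (1 / 2) ^ (n + 1)) :
    Controlled p σ ξ (n + 1) (s ++ raisePlay ξ n b) := by
  have hV : IsCompact (weightedSum 𝕜 (Gamma ξ) b) := by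
    refine isCompact_combos 𝕜 fun g hg => ?_
    obtain ⟨e, he, rfl⟩ := List.mem_map.1 hg
    exact hbc e he
  have hcont : Continuous fun q : 𝕜 × X × X => q.2.1 + q.1 • (σ : 𝕜) • q.2.2 := by fun_prop
  refine ⟨(fun q : 𝕜 × X × X => q.2.1 + q.1 • (σ : 𝕜) • q.2.2) ''
    (Metric.sphere (0 : 𝕜) 1 ×ˢ K ×ˢ weightedSum 𝕜 (Gamma ξ) b),
    ((isCompact_sphere _ _).prod (hK.prod hV)).image hcont, ?_, ?_, ?_⟩
  · rintro _ ⟨⟨c, y, z⟩, ⟨hc, hy, hz⟩, rfl⟩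
    have hc : ‖c‖ = 1 := by simpa using hc
    have hc0 : c ≠ 0 := norm_ne_zero_iff.1 (by rw [hc]; exact one_ne_zero)
    have h1 : y + c • (σ : 𝕜) • z = c • (c⁻¹ • y + (σ : 𝕜) • z) := by
      rw [smul_add, smul_inv_smul₀ hc0]
    show p (y + c • (σ : 𝕜) • z) ≤ _
    rw [h1, map_smul_eq_mul, hc, one_mul]
    exact h _ (hKc _ (by rw [norm_inv, hc, inv_one]) y hy) z hz
  · rintro c' hc' _ ⟨⟨c, y, z⟩, ⟨hc, hy, hz⟩, rfl⟩
    refine ⟨⟨c' * c, c' • y, z⟩, ⟨?_, hKc c' hc' y hy, hz⟩, ?_⟩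
    · have hc : ‖c‖ = 1 := by simpa using hc
      simp [hc, hc']
    · simp only [smul_add, mul_smul]
  · intro α hα x hx c hc
    have hαs : initSeg α s.length = s := by
      rw [← take_initSeg α (n := (s ++ raisePlay ξ n b).length) (by simp), hα]
      simp
    rw [Finset.sum_range_succ]
    exact ⟨⟨c n, _, _⟩, ⟨by simpa using hc n, hKα α hαs x hx c hc,
      block_mem_weightedSum hs hb hα hx⟩, rfl⟩

/-! ### The winning positions -/

/-- Positions from which Player S can complete the present block keeping the sums of blocks
controlled. -/
def Winning (p : Seminorm 𝕜 X) (σ : ℝ) (ξ : Ordinal.{v}) (a : List (Ordinal.{v} × Set X)) : Prop :=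
  ∃ (n : ℕ) (s b : List (Ordinal.{v} × Set X)), s.map Prod.fst ∈ levelEnds ξ n ∧
    Controlled p σ ξ n s ∧ a = s ++ raisePlay ξ n b ∧
    (b.map Prod.fst = [] ∨ b.map Prod.fst ∈ (Gamma ξ).nodes) ∧
    Forces (Gamma ξ).nodes (CD 𝕜 X) (compactMoves X)
      (fun b => b.map Prod.fst ∈ maxNodes (Gamma ξ).nodes ∧
        Controlled p σ ξ (n + 1) (s ++ raisePlay ξ n b)) b

theorem forces_of_controlled {b σ₀ : ℝ} (hb0 : 0 < b) (hb : ∀ x, p x ≤ b * ‖x‖) (hσ : 0 < σ₀)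
    (h : modulus p ξ σ₀ = 0) {n : ℕ} {s : List (Ordinal.{v} × Set X)}
    (hs : s.map Prod.fst ∈ levelEnds ξ n) (hc : Controlled p (σ₀ / b) ξ n s) :
    Forces (Gamma ξ).nodes (CD 𝕜 X) (compactMoves X)
      (fun b' => b'.map Prod.fst ∈ maxNodes (Gamma ξ).nodes ∧
        Controlled p (σ₀ / b) ξ (n + 1) (s ++ raisePlay ξ n b')) [] := by
  obtain ⟨K, hK, hKp, hKc, hKα⟩ := hc
  have hR : (1 : ℝ) ≤ 2 - (1 / 2) ^ n := by
    have := pow_le_one₀ (n := n) (by norm_num : (0 : ℝ) ≤ 1 / 2) (by norm_num)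
    linarith
  -- The error `2⁻⁽ⁿ⁺¹⁾` is the exact difference between the bounds for `n` and `n + 1` blocks.
  have h1 := forcesSum_Gamma 𝕜 ξ _ (eventually_compact_of_modulus hb0 hb hσ h hR hK hKp
    (ε := (1 / 2) ^ (n + 1)) (by positivity))
  refine Forces.mono h1 (by simp) fun b' hb' hA => ?_
  rw [isEnd_Gamma_iff] at hA
  refine ⟨hA.1, controlled_append hK hKc hKα hs hA.1 (fun e he => (hb' e he).1) ?_⟩
  intro y hy z hz
  refine (hA.2 y hy z hz).trans (le_of_eq ?_)
  rw [pow_succ]; ring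

/-- If the plan for the present block is already fulfilled, the position is read as the start of the
next block, for which `forces_of_controlled` supplies a new plan. -/
theorem Winning.exists_move {b σ₀ : ℝ} (hb0 : 0 < b) (hb : ∀ x, p x ≤ b * ‖x‖) (hσ : 0 < σ₀)
    (h : modulus p ξ σ₀ = 0) {a : List (Ordinal.{v} × Set X)} (ha : Winning p (σ₀ / b) ξ a) :
    ∃ ζ u, a.map Prod.fst ++ [ζ] ∈ (GammaInf ξ).nodes ∧ u ∈ CD 𝕜 X ∧
      ∀ G ∈ compactMoves X, G ⊆ u → Winning p (σ₀ / b) ξ (a ++ [(ζ, G)]) := by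
  have key : ∀ (n : ℕ) (s b' : List (Ordinal.{v} × Set X)) (ζ : Ordinal.{v}) (u : Set X),
      s.map Prod.fst ∈ levelEnds ξ n → Controlled p (σ₀ / b) ξ n s →
      b'.map Prod.fst ++ [ζ] ∈ (Gamma ξ).nodes → u ∈ CD 𝕜 X →
      (∀ G ∈ compactMoves X, G ⊆ u → Forces (Gamma ξ).nodes (CD 𝕜 X) (compactMoves X)
        (fun q => q.map Prod.fst ∈ maxNodes (Gamma ξ).nodes ∧
          Controlled p (σ₀ / b) ξ (n + 1) (s ++ raisePlay ξ n q)) (b' ++ [(ζ, G)])) →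
      ∃ ζ u, (s ++ raisePlay ξ n b').map Prod.fst ++ [ζ] ∈ (GammaInf ξ).nodes ∧ u ∈ CD 𝕜 X ∧
        ∀ G ∈ compactMoves X, G ⊆ u →
          Winning p (σ₀ / b) ξ (s ++ raisePlay ξ n b' ++ [(ζ, G)]) := by
    intro n s b' ζ u hs hc hζ hu hG
    refine ⟨ω ^ ξ * n + ζ, u, ?_, hu, fun G hG' hGu => ⟨n, s, b' ++ [(ζ, G)], hs, hc, ?_, ?_,
      hG G hG' hGu⟩⟩
    · rw [List.map_append, map_fst_raisePlay]
      exact snoc_mem_GammaInf hs hζ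
    · simp [raisePlay]
    · exact Or.inr (by simpa using hζ)
  obtain ⟨n, s, b', hs, hc, rfl, hb', hF⟩ := ha
  cases hF with
  | step _ ζ u hζ hu hG => exact key n s b' ζ u hs hc hζ hu hG
  | done _ hA =>
    have hs' : (s ++ raisePlay ξ n b').map Prod.fst ∈ levelEnds ξ (n + 1) := by
      rw [List.map_append, map_fst_raisePlay]
      exact ⟨_, hs, _, hA.1, rfl⟩
    cases forces_of_controlled hb0 hb hσ h hs' hA.2 with
    | step _ ζ u hζ hu hG => simpa [raisePlay] using key (n + 1) _ [] ζ u hs' hA.2 hζ hu hG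
    | done _ hA => exact absurd hA.1 nil_notMem_maxNodes

/-- At the end of a block either the next block has just been opened, and control is part of the
data, or the branch is complete; then no step is legal, so the plan must have reached its outcome.
-/
theorem Winning.controlled {a : List (Ordinal.{v} × Set X)} (ha : Winning p σ ξ a) {n : ℕ}
    (hn : a.map Prod.fst ∈ levelEnds ξ n) : Controlled p σ ξ n a := by
  obtain ⟨m, s, b, hs, hc, rfl, hb, hF⟩ := ha
  have hdec : s.map Prod.fst ++ raise ξ m (b.map Prod.fst) =
      (s ++ raisePlay ξ m b).map Prod.fst ++ raise ξ n [] := by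
    rw [List.map_append, map_fst_raisePlay, raise_nil, List.append_nil]
  rcases lt_trichotomy n m with hnm | rfl | hnm
  · exact absurd (decomposition_of_lt hn hs (Or.inl rfl) hdec.symm hnm).1 nil_notMem_maxNodes
  · have h1 := levelEnds_eq_of_prefix hs hn (List.prefix_append _ _)
      (by rw [hdec, raise_nil, List.append_nil])
    have h2 : b = [] := by
      have := congrArg List.length h1
      simpa [raisePlay] using this
    simpa [h2, raisePlay] using hc
  · obtain ⟨hmax, -, rfl⟩ := decomposition_of_lt hs hn hb hdec hnm
    cases hF with
    | done _ hA => exact hA.2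
    | step _ ζ u hζ => exact absurd hζ ((isEnd_Gamma_iff.2 hmax).2 ζ)

/-! ### The target set -/

theorem exists_unimodular_mul (w : 𝕜) : ∃ c : 𝕜, ‖c‖ = 1 ∧ c * w = (‖w‖ : 𝕜) := by
  rcases eq_or_ne w 0 with rfl | hw
  · exact ⟨1, by simp, by simp⟩
  · have hw' : ‖w‖ ≠ 0 := norm_ne_zero_iff.2 hw
    refine ⟨(‖w‖ : 𝕜) * w⁻¹, ?_, ?_⟩
    · rw [norm_mul, norm_inv, RCLike.norm_ofReal, abs_norm, mul_inv_cancel₀ hw']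
    · rw [mul_assoc, inv_mul_cancel₀ hw, mul_one]

/-- Unimodular coefficients can be chosen to turn every `φ (z j)` into its absolute value. -/
theorem sum_norm_le_of_signs {z : ℕ → X} {n : ℕ} {C : ℝ}
    (h : ∀ c : ℕ → 𝕜, (∀ i, ‖c i‖ = 1) → ‖∑ j ∈ Finset.range n, c j • z j‖ ≤ C)
    {φ : X →L[𝕜] 𝕜} (hφ : ‖φ‖ ≤ 1) : ∑ j ∈ Finset.range n, ‖φ (z j)‖ ≤ C := by
  choose c hc hcz using fun j => exists_unimodular_mul (φ (z j))
  have h1 : φ (∑ j ∈ Finset.range n, c j • z j) =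
      ((∑ j ∈ Finset.range n, ‖φ (z j)‖ : ℝ) : 𝕜) := by
    simp [hcz]
  have h2 := φ.le_of_opNorm_le hφ (∑ j ∈ Finset.range n, c j • z j)
  rw [h1, RCLike.norm_ofReal, one_mul,
    abs_of_nonneg (Finset.sum_nonneg fun _ _ => norm_nonneg _)] at h2
  exact h2.trans (h c hc)

theorem weakOneNorm_le {z : ℕ → X} {C : ℝ} (hC : 0 ≤ C)
    (h : ∀ φ : X →L[𝕜] 𝕜, ‖φ‖ ≤ 1 → ∀ n, ∑ j ∈ Finset.range n, ‖φ (z j)‖ ≤ C) :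
    weakOneNorm 𝕜 z ≤ ENNReal.ofReal C := by
  refine iSup₂_le fun φ hφ => ENNReal.tsum_le_of_sum_range_le fun n => ?_
  rw [ENNReal.le_ofReal_iff_toReal_le (by simp) hC, ENNReal.toReal_sum (by simp)]
  simpa using h φ hφ n

/-- In a space with an asymptotically uniformly flat norm, Player S has a winning strategy against
compact sets. -/
theorem playerSWins_of_isAUF (hp : IsEquivNorm p) (h : IsAUF p ξ) :
    ∃ C : ℝ, 0 < C ∧ PlayerSWins (targetSet 𝕜 X ξ C) (GammaInf ξ).nodes (CD 𝕜 X)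
      (compactMoves X) := by
  obtain ⟨a, b, ha0, hb0, hab⟩ := hp
  obtain ⟨σ₀, hσ, hmod⟩ := h
  have hb : ∀ x, p x ≤ b * ‖x‖ := fun x => (hab x).2
  have hσb : 0 < σ₀ / b := by positivity
  -- A signed sum of blocks multiplied by `σ₀ / b` has `p`-norm at most `2`, and `a * ‖·‖ ≤ p`.
  refine ⟨2 / (a * (σ₀ / b)), by positivity, ?_⟩
  have hmove : ∀ q : List (Ordinal.{v} × Set X), ∃ m : Ordinal.{v} × Set X,
      (q = [] ∨ q ∈ dot (GammaInf ξ).nodes (compactMoves X) →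
        q.map Prod.fst ++ [m.1] ∈ (GammaInf ξ).nodes ∧ m.2 ∈ CD 𝕜 X) ∧
      (Winning p (σ₀ / b) ξ q → ∀ G ∈ compactMoves X, G ⊆ m.2 →
        Winning p (σ₀ / b) ξ (q ++ [(m.1, G)])) := by
    intro q
    by_cases hq : Winning p (σ₀ / b) ξ q
    · obtain ⟨ζ, u, hζ, hu, hG⟩ := hq.exists_move hb0 hb hσ hmod
      exact ⟨(ζ, u), fun _ => ⟨hζ, hu⟩, fun _ => hG⟩
    -- A strategy has to answer every position; outside the winning ones any legal move will do.
    · by_cases hq' : q = [] ∨ q ∈ dot (GammaInf ξ).nodes (compactMoves X)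
      · obtain ⟨ζ, hζ⟩ := exists_snoc_mem_GammaInf (ξ := ξ) (a := q.map Prod.fst)
          (hq'.imp (by simp +contextual) fun h => h.1)
        exact ⟨(ζ, _), fun _ => ⟨hζ, closedBall_mem_CD 𝕜 X⟩, fun h => absurd h hq⟩
      · exact ⟨(0, ∅), fun h => absurd h hq', fun h => absurd h hq⟩
  choose χ hχ hχW using hmove
  refine ⟨χ, hχ, fun α hα hadm => ⟨hα, ?_⟩⟩
  have hwin : ∀ k, Winning p (σ₀ / b) ξ (initSeg α k) := by
    intro k
    induction k with
    | zero =>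
      exact ⟨0, [], [], rfl, controlled_nil, rfl, Or.inl rfl,
        forces_of_controlled hb0 hb hσ hmod rfl controlled_nil⟩
    | succ k ih =>
      have := hχW _ ih (α k).2 (hα.2 k) (hadm k).2
      rwa [← (hadm k).1, ← initSeg_succ] at this
  refine iSup₂_le fun x hx => weakOneNorm_le (by positivity) fun φ hφ n => ?_
  refine sum_norm_le_of_signs (fun c hc => ?_) hφ
  have hcut := initSeg_cut_mem hα.1 n
  rw [← map_initSeg α Prod.fst] at hcut
  obtain ⟨K, -, hKp, -, hKα⟩ := (hwin _).controlled hcut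
  have h1 := hKp _ (hKα α (by simp) x hx c hc)
  have h2 : ∑ j ∈ Finset.range n, c j • ((σ₀ / b : ℝ) : 𝕜) • block 𝕜 ξ (fun i => (α i).1) x j =
      ((σ₀ / b : ℝ) : 𝕜) • ∑ j ∈ Finset.range n, c j • block 𝕜 ξ (fun i => (α i).1) x j := by
    rw [Finset.smul_sum]
    exact Finset.sum_congr rfl fun j _ => smul_comm _ _ _
  rw [h2, map_smul_eq_mul, RCLike.norm_ofReal, abs_of_pos hσb] at h1
  have h3 := (hab (∑ j ∈ Finset.range n, c j • block 𝕜 ξ (fun i => (α i).1) x j)).1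
  have h4 : (0 : ℝ) ≤ (1 / 2) ^ n := by positivity
  rw [le_div_iff₀ (by positivity)]
  have h5 := mul_le_mul_of_nonneg_left h3 hσb.le
  linarith

theorem PlayerSWins.anti {Ω : Type w} {B : Type u} {E : Set (ℕ → Ω × Set B)} {T : Set (List Ω)}
    {D 𝔤 𝔤' : Set (Set B)} (h : PlayerSWins E T D 𝔤) (h' : 𝔤' ⊆ 𝔤) : PlayerSWins E T D 𝔤' := by
  obtain ⟨χ, hχ, hE⟩ := h
  exact ⟨χ, fun a ha => hχ a (ha.imp_right fun ha => ⟨ha.1, fun e he => h' (ha.2 e he)⟩),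
    fun α hα => hE α ⟨hα.1, fun i => h' (hα.2 i)⟩⟩

end Strategy

/-! ### Plays of points against a fixed strategy, prolonged one block at a time. -/

section Runs

variable {𝕜 : Type*} [RCLike 𝕜] {X : Type u} [NormedAddCommGroup X] [NormedSpace 𝕜 X]
  {ξ : Ordinal.{v}} {χ : List (Ordinal.{v} × Set X) → Ordinal.{v} × Set X}

/-! ### Plays against points -/

/-- Finite plays in which Player S follows `χ` and Player V chooses points. -/
inductive Follows (χ : List (Ordinal.{v} × Set X) → Ordinal.{v} × Set X) :
    List (Ordinal.{v} × Set X) → Prop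
  | nil : Follows χ []
  | snoc (a x) : Follows χ a → x ∈ (χ a).2 → Follows χ (a ++ [((χ a).1, {x})])

/-- Infinite plays in which Player S follows `χ` and Player V chooses the points `x i`. -/
def IsRun (ξ : Ordinal.{v}) (χ : List (Ordinal.{v} × Set X) → Ordinal.{v} × Set X)
    (α : ℕ → Ordinal.{v} × Set X) (x : ℕ → X) : Prop :=
  α ∈ bodyDot (GammaInf ξ).nodes (singletonMoves X) ∧ IsAdmissible χ α ∧ ∀ i, (α i).2 = {x i}

theorem subset_closedBall_of_mem_CD {U : Set X} (hU : U ∈ CD 𝕜 X) :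
    U ⊆ Metric.closedBall 0 1 := by
  obtain ⟨Z, -, -, rfl⟩ := hU
  exact Set.inter_subset_right

theorem zero_mem_of_mem_CD {U : Set X} (hU : U ∈ CD 𝕜 X) : (0 : X) ∈ U := by
  obtain ⟨Z, -, -, rfl⟩ := hU
  exact ⟨Z.zero_mem, by simp⟩

theorem follows_snoc_iff {X : Type u} {χ : List (Ordinal.{v} × Set X) → Ordinal.{v} × Set X}
    {a : List (Ordinal.{v} × Set X)} {e : Ordinal.{v} × Set X} :
    Follows χ (a ++ [e]) ↔ Follows χ a ∧ ∃ x ∈ (χ a).2, e = ((χ a).1, {x}) := by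
  constructor
  · intro h
    generalize hb : a ++ [e] = b at h
    cases h with
    | nil => simp at hb
    | snoc a' x ha hx =>
      obtain ⟨rfl, h2⟩ := List.append_inj' hb rfl
      exact ⟨ha, x, hx, by simpa using h2⟩
  · rintro ⟨ha, x, hx, rfl⟩
    exact Follows.snoc a x ha hx

theorem Follows.of_append {X : Type u} {χ : List (Ordinal.{v} × Set X) → Ordinal.{v} × Set X}
    {a b : List (Ordinal.{v} × Set X)} (h : Follows χ (a ++ b)) :
    Follows χ a := by
  induction b using List.reverseRecOn with
  | nil => simpa using h
  | append_singleton b e ih =>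
    rw [← List.append_assoc] at h
    exact ih (follows_snoc_iff.1 h).1

theorem Follows.mem_dot
    (hχ : IsStrategyS (GammaInf ξ).nodes (CD 𝕜 X) (singletonMoves X) χ)
    {a : List (Ordinal.{v} × Set X)} (h : Follows χ a) :
    a = [] ∨ a ∈ dot (GammaInf ξ).nodes (singletonMoves X) := by
  induction h with
  | nil => exact Or.inl rfl
  | snoc a x _ hx ih =>
    obtain ⟨h1, h2⟩ := hχ a ih
    refine Or.inr ⟨by simpa using h1, fun e he => ?_⟩
    rcases List.mem_append.1 he with he | he
    · rcases ih with rfl | ih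
      · simp at he
      · exact ih.2 e he
    · rw [List.mem_singleton.1 he]
      exact ⟨x, subset_closedBall_of_mem_CD h2 hx, rfl⟩

theorem exists_isRun_of_forall_follows
    (hχ : IsStrategyS (GammaInf ξ).nodes (CD 𝕜 X) (singletonMoves X) χ)
    {α : ℕ → Ordinal.{v} × Set X}
    (h : ∀ m, Follows χ (initSeg α m)) : ∃ x, IsRun ξ χ α x := by
  have h1 : ∀ m, ∃ x ∈ (χ (initSeg α m)).2, α m = ((χ (initSeg α m)).1, {x}) := fun m =>
    (follows_snoc_iff.1 (initSeg_succ α m ▸ h (m + 1))).2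
  choose x hx hα using h1
  refine ⟨x, ⟨fun n => ?_, fun i => ?_⟩, fun n => ?_, fun i => by rw [hα i]⟩
  · have := ((h (n + 1)).mem_dot hχ).resolve_left (by simp [initSeg_succ])
    rw [← map_initSeg]
    exact this.1
  · rw [hα i]
    exact ⟨x i, subset_closedBall_of_mem_CD (hχ _ ((h i).mem_dot hχ)).2 (hx i), rfl⟩
  · refine ⟨by rw [hα n], ?_⟩
    rw [show (α n).2 = {x n} by rw [hα n]]
    exact Set.singleton_subset_iff.2 (hx n)

theorem IsRun.follows {α : ℕ → Ordinal.{v} × Set X} {x : ℕ → X} (h : IsRun ξ χ α x) (m : ℕ) :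
    Follows χ (initSeg α m) := by
  induction m with
  | zero => exact Follows.nil
  | succ m ih =>
    rw [initSeg_succ]
    refine follows_snoc_iff.2 ⟨ih, x m, ?_, Prod.ext (h.2.1 m).1 (h.2.2 m)⟩
    have := (h.2.1 m).2
    rw [h.2.2 m] at this
    exact Set.singleton_subset_iff.1 this

/-- Continuations of a finite play by zeros. -/
def zeroPlay (χ : List (Ordinal.{v} × Set X) → Ordinal.{v} × Set X)
    (a : List (Ordinal.{v} × Set X)) : ℕ → List (Ordinal.{v} × Set X)
  | 0 => a
  | k + 1 => zeroPlay χ a k ++ [((χ (zeroPlay χ a k)).1, {0})]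

/-- Since `0` belongs to every set Player S may choose, Player V can always continue with zeros.
Finite plays must be prolonged because the winning condition concerns infinite ones. -/
theorem Follows.exists_isRun
    (hχ : IsStrategyS (GammaInf ξ).nodes (CD 𝕜 X) (singletonMoves X) χ)
    {a : List (Ordinal.{v} × Set X)} (ha : Follows χ a) :
    ∃ α x, IsRun ξ χ α x ∧ initSeg α a.length = a := by
  let α : ℕ → Ordinal.{v} × Set X := fun i =>
    if h : i < a.length then a[i] else ((χ (zeroPlay χ a (i - a.length))).1, {0})
  have h0 : initSeg α a.length = a := by
    refine List.ext_getElem (by simp) fun i h1 h2 => ?_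
    simp [initSeg, α, h2]
  have hk : ∀ k, initSeg α (a.length + k) = zeroPlay χ a k := by
    intro k
    induction k with
    | zero => exact h0
    | succ k ih =>
      rw [← add_assoc, initSeg_succ, ih, zeroPlay]
      simp [α]
  have hF : ∀ k, Follows χ (zeroPlay χ a k) := by
    intro k
    induction k with
    | zero => exact ha
    | succ k ih => exact Follows.snoc _ _ ih (zero_mem_of_mem_CD (hχ _ (ih.mem_dot hχ)).2)
  have hall : ∀ m, Follows χ (initSeg α m) := by
    intro m
    obtain ⟨q, hq⟩ := initSeg_prefix α (Nat.le_add_left m a.length)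
    have := hF m
    rw [← hk, ← hq] at this
    exact this.of_append
  obtain ⟨x, hx⟩ := exists_isRun_of_forall_follows hχ hall
  exact ⟨α, x, hx, h0⟩

/-! ### Playing a block against a strategy -/

/-- The entries chosen by `χ` act as the clock. A legal entry `η` is below `α`, so Player V has a
reply after which the constraints survive `η`, and later entries of the block are below `η`. When
the branch is complete, the remaining set is still non-empty. -/
theorem exists_follows_of_survives
    (hχ : IsStrategyS (GammaInf ξ).nodes (CD 𝕜 X) (singletonMoves X) χ)
    {I : Type*} {P : X → Set I} {S : Set I} {n : ℕ}
    {s : List (Ordinal.{v} × Set X)} (hs : s.map Prod.fst ∈ levelEnds ξ n) (α : Ordinal.{v}) :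
    ∀ (t : List Ordinal.{v}) (y : List X) (b : List (Ordinal.{v} × Set X)),
      Follows χ (s ++ b) → b.map Prod.fst = raise ξ n t → b.map Prod.snd = y.map ({·}) →
      (t = [] ∨ t ∈ (Gamma ξ).nodes) → (∀ ζ, t ++ [ζ] ∈ (Gamma ξ).nodes → ζ < α) →
      Survives (pointFilter 𝕜 X) P α {i | i ∈ S ∧ ∀ v ∈ y, i ∈ P v} →
      ∃ t ∈ maxNodes (Gamma ξ).nodes, ∃ (y : List X) (b : List (Ordinal.{v} × Set X)),
        Follows χ (s ++ b) ∧ b.map Prod.fst = raise ξ n t ∧ b.map Prod.snd = y.map ({·}) ∧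
        ∃ i ∈ S, ∀ v ∈ y, i ∈ P v := by
  induction α using WellFoundedLT.induction with
  | ind α ih =>
    intro t y b hF hbt hby ht hα hS
    by_cases hend : t ∈ maxNodes (Gamma ξ).nodes
    · obtain ⟨i, hi⟩ := hS.nonempty
      exact ⟨t, hend, y, b, hF, hbt, hby, i, hi.1, hi.2⟩
    · obtain ⟨hζ, hu⟩ := hχ _ (hF.mem_dot hχ)
      rw [List.map_append, hbt] at hζ
      obtain ⟨η, hη, hηt⟩ := exists_of_snoc_mem_GammaInf hs ht hend hζ
      obtain ⟨x, hx, hxS⟩ := frequently_pointFilter.1 (hS.frequently (hα η hηt)) _ hu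
      refine ih η (hα η hηt) (t ++ [η]) (y ++ [x]) (b ++ [((χ (s ++ b)).1, {x})]) ?_ ?_ ?_
        (Or.inr hηt) (fun ζ hζ => lt_of_snoc_snoc_mem hζ) (hxS.mono ?_)
      · rw [← List.append_assoc]
        exact Follows.snoc _ _ hF hx
      · rw [List.map_append, hbt, raise_append, raise_singleton, ← hη]
        rfl
      · rw [List.map_append, hby, List.map_append]
        rfl
      · rintro i ⟨⟨hi, hiy⟩, hix⟩
        refine ⟨hi, fun v hv => ?_⟩
        rcases List.mem_append.1 hv with hv | hv
        · exact hiy v hv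
        · rw [List.mem_singleton.1 hv]
          exact hix

/-- The first `n` blocks of the run are kept and the next one is replayed so that a single index of
`S` satisfies all its constraints; a clock `ω ^ ξ` suffices because the entries of `Γ_{ξ,1}` lie
below it. -/
theorem IsRun.exists_next
    (hχ : IsStrategyS (GammaInf ξ).nodes (CD 𝕜 X) (singletonMoves X) χ)
    {α : ℕ → Ordinal.{v} × Set X} {x : ℕ → X} (h : IsRun ξ χ α x)
    {I : Type*} {P : X → Set I} {S : Set I} (n : ℕ)
    (hS : Survives (pointFilter 𝕜 X) P (ω ^ ξ) S) :
    ∃ α' x', IsRun ξ χ α' x' ∧ initSeg α' (cut ξ (fun i => (α i).1) n) =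
        initSeg α (cut ξ (fun i => (α i).1) n) ∧
      ∃ t ∈ maxNodes (Gamma ξ).nodes,
        initSeg (fun i => (α' i).1) (cut ξ (fun i => (α i).1) n + t.length) =
          initSeg (fun i => (α i).1) (cut ξ (fun i => (α i).1) n) ++ raise ξ n t ∧
        ∃ i ∈ S, ∀ j < t.length, i ∈ P (x' (cut ξ (fun i => (α i).1) n + j)) := by
  set k := cut ξ (fun i => (α i).1) n with hk
  have hcut : (initSeg α k).map Prod.fst ∈ levelEnds ξ n := by
    rw [map_initSeg]
    exact initSeg_cut_mem h.1.1 n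
  obtain ⟨t, ht, y, b, hF, hbt, hby, i, hi, hiy⟩ := exists_follows_of_survives hχ (S := S)
    hcut (ω ^ ξ) [] [] [] (by simpa using h.follows k) rfl rfl (Or.inl rfl)
    (fun ζ hζ => (Gamma_regular ξ).lt _ hζ ζ (by simp)) (hS.mono fun i hi => ⟨hi, by simp⟩)
  obtain ⟨α', x', hrun, hα'⟩ := hF.exists_isRun hχ
  have hbl : b.length = t.length := by simpa using congrArg List.length hbt
  have hyl : b.length = y.length := by simpa using congrArg List.length hby
  rw [List.length_append, length_initSeg, hbl] at hα'
  refine ⟨α', x', hrun, ?_, t, ht, ?_, i, hi, fun j hj => hiy _ ?_⟩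
  · rw [← take_initSeg α' (Nat.le_add_right k t.length), hα', List.take_append_of_le_length
      (by simp), List.take_of_length_le (by simp)]
  · rw [← map_initSeg, hα', List.map_append, hbt, map_initSeg]
  · have h1 : α' (k + j) = b[j] := by
      have h2 : (initSeg α' (k + t.length))[k + j]'(by simpa using hj) = α' (k + j) := by
        simp [initSeg]
      rw [← h2]
      simp only [hα']
      rw [List.getElem_append_right (by simp)]
      simp
    have h3 : (b.map Prod.snd)[j]'(by simpa [hbl] using hj) = {y[j]} := by
      simp only [hby, List.getElem_map]
    rw [List.getElem_map, ← h1, hrun.2.2] at h3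
    rw [Set.singleton_injective h3]
    exact List.getElem_mem _

/-! ### Agreement of blocks -/

theorem cut_le_cut {τ : ℕ → Ordinal.{v}} (hτ : τ ∈ body (GammaInf ξ).nodes) {j n : ℕ}
    (h : j ≤ n) : cut ξ τ j ≤ cut ξ τ n := by
  obtain ⟨e, he, hp⟩ := exists_levelEnds_prefix h (initSeg_cut_mem hτ n)
  have hl : e.length ≤ cut ξ τ n := by simpa using hp.length_le
  have h1 : e = initSeg τ e.length := by
    rw [← take_initSeg τ hl]
    exact List.prefix_iff_eq_take.1 hp
  rw [h1] at he
  rwa [cut_eq he]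

theorem block_congr (𝕜 : Type*) [RCLike 𝕜] {X : Type u} [NormedAddCommGroup X] [NormedSpace 𝕜 X]
    {ξ : Ordinal.{v}} {τ τ' : ℕ → Ordinal.{v}} (hτ : τ ∈ body (GammaInf ξ).nodes) {n : ℕ}
    {x x' : ℕ → X} (h : initSeg τ' (cut ξ τ n) = initSeg τ (cut ξ τ n))
    (hx : ∀ i < cut ξ τ n, x' i = x i) {j : ℕ} (hj : j < n) :
    block 𝕜 ξ τ' x' j = block 𝕜 ξ τ x j := by
  have hseg : ∀ k ≤ cut ξ τ n, initSeg τ' k = initSeg τ k := fun k hk => by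
    rw [← take_initSeg τ' hk, h, take_initSeg τ hk]
  have hcut : ∀ i ≤ n, cut ξ τ' i = cut ξ τ i := fun i hi =>
    cut_eq (by rw [hseg _ (cut_le_cut hτ hi)]; exact initSeg_cut_mem hτ i)
  rw [block, block, hcut j hj.le, hcut (j + 1) hj]
  refine Finset.sum_congr rfl fun k hk => ?_
  have hk' := (Finset.mem_Ico.1 hk).2.trans_le (cut_le_cut hτ hj)
  rw [hseg (k + 1) hk', hx k hk']

/-- A functional which is at least `d` on all points of a block is at least `d` on the block. -/
theorem le_re_block {τ : ℕ → Ordinal.{v}} {n k : ℕ} {t : List Ordinal.{v}}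
    (hk : initSeg τ k ∈ levelEnds ξ n) (ht : t ∈ maxNodes (Gamma ξ).nodes)
    (h : initSeg τ (k + t.length) = initSeg τ k ++ raise ξ n t) {x : ℕ → X} {φ : X →L[𝕜] 𝕜}
    {d : ℝ} (hd : ∀ j < t.length, d ≤ RCLike.re (φ (x (k + j)))) :
    d ≤ RCLike.re (φ (block 𝕜 ξ τ x n)) := by
  have hsum : ∑ j ∈ Finset.range t.length, (Gamma ξ).wt (t.take (j + 1)) = 1 := by
    have := (Gamma_regular ξ).sum t (isEnd_Gamma_iff.2 ht)
    exact this
  rw [block_eq 𝕜 hk ht h, map_sum, map_sum]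
  calc d = ∑ j ∈ Finset.range t.length, (Gamma ξ).wt (t.take (j + 1)) * d := by
        rw [← Finset.sum_mul, hsum, one_mul]
    _ ≤ _ := Finset.sum_le_sum fun j hj => by
      rw [re_map_ofReal_smul]
      exact mul_le_mul_of_nonneg_left (hd j (Finset.mem_range.1 hj))
        ((Gamma_regular ξ).nonneg _ ((Gamma_regular ξ).tree.take_mem ht.1 j))

end Runs

/-! ### Equivalent norms defined by dual bodies, with a minimax argument. -/

section Polar

variable {𝕜 : Type*} [RCLike 𝕜] {X : Type u} [NormedAddCommGroup X] [NormedSpace 𝕜 X]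

/-! ### Norms given by bounded sets of functionals -/

/-- A convex circled set of functionals which lies between two balls of the dual. -/
structure IsDualBody (K : Set (X →L[𝕜] 𝕜)) (c : ℝ) : Prop where
  pos : 0 < c
  norm_le : ∀ φ ∈ K, ‖φ‖ ≤ 1
  mem_of_norm_le : ∀ φ : X →L[𝕜] 𝕜, ‖φ‖ ≤ c → φ ∈ K
  smul_mem : ∀ φ ∈ K, ∀ a : 𝕜, ‖a‖ = 1 → a • φ ∈ K
  combo_mem : ∀ φ ∈ K, ∀ ψ ∈ K, ∀ a b : ℝ, 0 ≤ a → 0 ≤ b → a + b = 1 →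
    (a : 𝕜) • φ + (b : 𝕜) • ψ ∈ K

/-- The seminorm `y ↦ sup {‖φ y‖ : φ ∈ K}`. -/
noncomputable def polarSeminorm (K : Set (X →L[𝕜] 𝕜)) : Seminorm 𝕜 X :=
  ⨆ φ : K, (φ.1 : X →ₗ[𝕜] 𝕜).toSeminorm

variable {K : Set (X →L[𝕜] 𝕜)} {c : ℝ}

namespace IsDualBody

theorem polarSeminorm_apply (hK : IsDualBody K c) (y : X) :
    polarSeminorm K y = ⨆ φ : K, ‖φ.1 y‖ := by
  rw [polarSeminorm, Seminorm.iSup_apply]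
  · rfl
  · refine Seminorm.bddAbove_range_iff.2 fun y => ⟨‖y‖, ?_⟩
    rintro _ ⟨φ, rfl⟩
    simpa using φ.1.le_of_opNorm_le (hK.norm_le _ φ.2) y

theorem norm_apply_le (hK : IsDualBody K c) {φ : X →L[𝕜] 𝕜} (hφ : φ ∈ K) (y : X) :
    ‖φ y‖ ≤ polarSeminorm K y := by
  rw [hK.polarSeminorm_apply]
  refine le_ciSup (f := fun φ : K => ‖φ.1 y‖) ⟨‖y‖, ?_⟩ ⟨φ, hφ⟩
  rintro _ ⟨φ, rfl⟩
  simpa using φ.1.le_of_opNorm_le (hK.norm_le _ φ.2) y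

theorem zero_mem (hK : IsDualBody K c) : (0 : X →L[𝕜] 𝕜) ∈ K :=
  hK.mem_of_norm_le 0 (by simpa using hK.pos.le)

/-- As `K` is circled, absolute values can be rotated into real parts. -/
theorem polarSeminorm_le (hK : IsDualBody K c) {y : X} {a : ℝ} (h : ∀ φ ∈ K, RCLike.re (φ y) ≤ a) :
    polarSeminorm K y ≤ a := by
  rw [hK.polarSeminorm_apply]
  have : Nonempty K := ⟨⟨0, hK.zero_mem⟩⟩
  refine ciSup_le fun φ => ?_
  obtain ⟨b, hb, hbφ⟩ := exists_unimodular_mul (φ.1 y)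
  have := h _ (hK.smul_mem _ φ.2 b hb)
  rwa [_root_.smul_apply, _root_.smul_eq_mul, hbφ, RCLike.ofReal_re] at this

theorem le_norm (hK : IsDualBody K c) (y : X) : polarSeminorm K y ≤ ‖y‖ := by
  refine hK.polarSeminorm_le fun φ hφ => (RCLike.re_le_norm _).trans ?_
  simpa using φ.le_of_opNorm_le (hK.norm_le _ hφ) y

theorem mul_norm_le (hK : IsDualBody K c) (y : X) : c * ‖y‖ ≤ polarSeminorm K y := by
  obtain ⟨φ, hφ, hφy⟩ := exists_dual_vector'' 𝕜 y
  have h1 : (c : 𝕜) • φ ∈ K := hK.mem_of_norm_le _ (by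
    rw [norm_smul, RCLike.norm_ofReal, abs_of_pos hK.pos]
    exact mul_le_of_le_one_right hK.pos.le hφ)
  have h2 := hK.norm_apply_le h1 y
  rwa [_root_.smul_apply, hφy, _root_.smul_eq_mul, norm_mul, RCLike.norm_ofReal,
    RCLike.norm_ofReal, abs_of_pos hK.pos, abs_norm] at h2

/-- If the norm exceeds `b` on the convex hull of finitely many points, a single functional in the
body does so at these points. -/
theorem exists_forall_lt_re (hK : IsDualBody K c) {k : ℕ} (g : ℕ → X) {b : ℝ}
    (h : ∀ w : ℕ → ℝ, (∀ i, 0 ≤ w i) → ∑ i ∈ Finset.range k, w i = 1 →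
      b < polarSeminorm K (∑ i ∈ Finset.range k, (w i : 𝕜) • g i)) :
    ∃ φ ∈ K, ∀ i < k, b < RCLike.re (φ (g i)) := by
  by_contra! hcon
  -- Failure means that the open orthant `A` misses the convex set `B` of value vectors. The
  -- normalised coefficients of a separating functional will be convex weights violating `h`.
  let A : Set (Fin k → ℝ) := Set.univ.pi fun _ => Set.Ioi b
  let B : Set (Fin k → ℝ) := (fun φ : X →L[𝕜] 𝕜 => fun i : Fin k => RCLike.re (φ (g i))) '' K
  have hA : Convex ℝ A := convex_pi fun i _ => convex_Ioi b
  have hAo : IsOpen A := isOpen_set_pi Set.finite_univ fun i _ => isOpen_Ioi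
  have hB : Convex ℝ B := by
    rintro _ ⟨φ, hφ, rfl⟩ _ ⟨ψ, hψ, rfl⟩ a b ha hb hab
    refine ⟨_, hK.combo_mem φ hφ ψ hψ a b ha hb hab, ?_⟩
    ext i
    simp
  have hAB : Disjoint A B := by
    refine Set.disjoint_left.2 ?_
    rintro _ hA ⟨φ, hφ, rfl⟩
    obtain ⟨i, hi, hle⟩ := hcon φ hφ
    exact absurd (hA ⟨i, hi⟩ trivial) (not_lt.2 hle)
  obtain ⟨f, r, hfA, hfB⟩ := geometric_hahn_banach_open hA hAo hB hAB
  have hf : ∀ v, f v = ∑ i, v i * f (Pi.single i 1) := fun v => by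
    conv_lhs => rw [← Finset.univ_sum_single v]
    rw [map_sum]
    refine Finset.sum_congr rfl fun i _ => ?_
    rw [← _root_.smul_eq_mul, ← map_smul, ← Pi.single_smul, _root_.smul_eq_mul, mul_one]
  -- The orthant is on the lower side of `f` and unbounded upwards in each coordinate, so the
  -- coefficients of `f` are non-positive.
  let d : Fin k → ℝ := fun i => -f (Pi.single i 1)
  have hconst : ∀ ε > 0, -((b + ε) * ∑ i, d i) < r := fun ε hε => by
    have := hfA (fun _ => b + ε) fun i _ => by simpa using hε
    rw [hf, ← Finset.mul_sum] at this
    simpa [d] using this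
  have hd : ∀ i, 0 ≤ d i := by
    intro i
    by_contra! hi
    have hi' : 0 < f (Pi.single i 1) := by simpa [d] using hi
    obtain ⟨N, hN⟩ := exists_nat_gt ((r + (b + 1) * ∑ i, d i) / f (Pi.single i 1))
    rw [div_lt_iff₀ hi'] at hN
    have := hfA ((fun _ => b + 1) + (N : ℝ) • Pi.single i 1) fun j _ => by
      have : (0 : ℝ) ≤ N * (Pi.single i 1 : Fin k → ℝ) j :=
        mul_nonneg (Nat.cast_nonneg _) ((Pi.single_nonneg.2 zero_le_one : (0 : Fin k → ℝ) ≤ Pi.single i 1) j)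
      simp only [Pi.add_apply, Pi.smul_apply, _root_.smul_eq_mul, Set.mem_Ioi]
      linarith
    rw [map_add, map_smul, _root_.smul_eq_mul, hf, ← Finset.mul_sum] at this
    simp only [d, Finset.sum_neg_distrib] at hN
    linarith
  -- The zero functional lies in `K`; this prevents all coefficients from vanishing.
  have hr : r ≤ 0 := by
    have := hfB 0 ⟨0, hK.zero_mem, by ext; simp⟩
    simpa using this
  have hs : 0 < ∑ i, d i := by
    refine lt_of_le_of_ne (Finset.sum_nonneg fun i _ => hd i) fun h0 => ?_
    have := hconst 1 one_pos
    rw [← h0] at this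
    linarith
  have hrb : -r ≤ b * ∑ i, d i := by
    refine le_of_forall_pos_le_add fun ε hε => ?_
    have := hconst (ε / ∑ i, d i) (div_pos hε hs)
    rw [add_mul, div_mul_cancel₀ _ hs.ne'] at this
    linarith
  let w : ℕ → ℝ := fun i => if hi : i < k then d ⟨i, hi⟩ / ∑ i, d i else 0
  have hw : ∀ i : Fin k, w i = d i / ∑ i, d i := fun i => by simp [w]
  have hlt := h w (fun i => by
      by_cases hi : i < k
      · simpa [w, hi] using div_nonneg (hd _) hs.le
      · simp [w, hi])
    (by rw [Finset.sum_range]; simp only [hw]; rw [← Finset.sum_div, div_self hs.ne'])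
  refine absurd hlt (not_lt.2 (hK.polarSeminorm_le fun φ hφ => ?_))
  have h1 := hfB _ ⟨φ, hφ, rfl⟩
  rw [hf] at h1
  rw [map_sum, map_sum, Finset.sum_range]
  simp only [re_map_ofReal_smul, hw]
  have h2 : ∑ i : Fin k, d i / (∑ i, d i) * RCLike.re (φ (g i)) =
      (∑ i : Fin k, d i * RCLike.re (φ (g i))) / ∑ i, d i := by
    rw [Finset.sum_div]
    exact Finset.sum_congr rfl fun i _ => by ring
  rw [h2, div_le_iff₀ hs]
  have h3 : ∑ i : Fin k, d i * RCLike.re (φ (g i)) =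
      -∑ i : Fin k, RCLike.re (φ (g i)) * f (Pi.single i 1) := by
    rw [← Finset.sum_neg_distrib]
    exact Finset.sum_congr rfl fun i _ => by simp only [d]; ring
  rw [h3]
  linarith

end IsDualBody

end Polar

/-! ### Derivatives of trees with a root -/

section Root

variable {Ω : Type w} {T : Set (List Ω)}

theorem treeDeriv_anti (T : Set (List Ω)) {η ζ : Ordinal.{v}} (h : η ≤ ζ) :
    treeDeriv T ζ ⊆ treeDeriv T η := by
  induction ζ using induction_add_one_limit with
  | zero => rw [nonpos_iff_eq_zero.1 h]
  | add_one ζ ih =>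
    rcases h.eq_or_lt with rfl | h
    · exact subset_rfl
    · rw [treeDeriv_add_one]
      exact Set.sdiff_subset.trans (ih (Order.lt_add_one_iff.1 h))
  | limit ζ hζ ih =>
    rcases h.eq_or_lt with rfl | h
    · exact subset_rfl
    · rw [treeDeriv_limit T hζ]
      exact Set.iInter₂_subset η h

/-- As long as the derivative of `T` is non-empty the root is not maximal, so up to the rank it
merely accompanies the derivatives. -/
theorem treeDeriv_insert_nil (hT : IsTree T) {o : Ordinal.{v}} (h : ∀ β < o, treeDeriv T β ≠ ∅)
    {ζ : Ordinal.{v}} (hζo : ζ ≤ o) : treeDeriv (insert [] T) ζ = insert [] (treeDeriv T ζ) := by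
  induction ζ using induction_add_one_limit with
  | zero => simp
  | add_one ζ ih =>
    have hlt : ζ < o := Order.add_one_le_iff.1 hζo
    rw [treeDeriv_add_one, treeDeriv_add_one, ih hlt.le]
    have hne : ∀ t ∈ treeDeriv T ζ, t ≠ [] := fun t ht =>
      hT.ne_nil (by simpa using treeDeriv_anti T zero_le ht)
    obtain ⟨s, hs⟩ := Set.nonempty_iff_ne_empty.2 (h ζ hlt)
    ext t
    simp only [Set.mem_sdiff, Set.mem_insert_iff, maxNodes, Set.mem_ofPred_eq]
    constructor
    · rintro ⟨rfl | ht, hm⟩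
      · exact Or.inl rfl
      · refine Or.inr ⟨ht, fun hm' => hm ⟨Or.inr ht, ?_⟩⟩
        rintro s (rfl | hs) hts
        · exact absurd (List.prefix_nil.1 hts) (hne t ht)
        · exact hm'.2 s hs hts
    · rintro (rfl | ⟨ht, hm⟩)
      · exact ⟨Or.inl rfl, fun hm => hne s hs (hm.2 s (Or.inr hs) List.nil_prefix)⟩
      · exact ⟨Or.inr ht, fun hm' => hm ⟨ht, fun s hs => hm'.2 s (Or.inr hs)⟩⟩
  | limit ζ hζ ih =>
    rw [treeDeriv_limit _ hζ, treeDeriv_limit _ hζ]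
    ext t
    simp only [Set.mem_iInter, Set.mem_insert_iff]
    constructor
    · intro ht
      refine or_iff_not_imp_left.2 fun hne η hη => ?_
      have := ht η hη
      rw [ih η hη (hη.le.trans hζo)] at this
      exact this.resolve_left hne
    · intro ht η hη
      rw [ih η hη (hη.le.trans hζo)]
      exact ht.imp_right fun h => h η hη

end Root

/-! ### Surviving sets of functionals inside a dual body. -/

section Cluster

variable {𝕜 : Type*} [RCLike 𝕜] {X : Type u} [NormedAddCommGroup X] [NormedSpace 𝕜 X]
  {K : Set (X →L[𝕜] 𝕜)} {c : ℝ}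

/-! ### From weakly null trees to surviving sets of functionals -/

/-- Induction on the derivatives of the rooted tree: at a node of the derivative of order `ζ`, the
functionals exceeding `1 + r / 2` along the whole branch survive `ζ`. They exist by
`exists_forall_lt_re`, and weak nullity supplies a child nearly lying in any given subspace. -/
theorem IsDualBody.survives_of_weaklyNull (hK : IsDualBody K c) {Ω : Type w} {T : Set (List Ω)}
    {o : Ordinal.{v}} (hT : IsTree T) (ho : HasRank T o) {x : List Ω → X}
    (hw : WeaklyNull.{u, v} 𝕜 T x) {R σ r : ℝ} (hR : 0 ≤ R) (hσ : 0 ≤ σ) (hσR : σ * (R + 1) ≤ 1)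
    (hx : ∀ t ∈ T, ‖x t‖ ≤ R) {y : X} (hr : 0 < r)
    (hval : ∀ t ∈ T, ∀ z ∈ branchHull 𝕜 x t, 1 + r ≤ polarSeminorm K (y + (σ : 𝕜) • z)) :
    Survives (pointFilter 𝕜 X)
      (fun v => {φ : X →L[𝕜] 𝕜 | 1 + r / 4 < RCLike.re (φ y) + RCLike.re (φ v)}) o K := by
  have key : ∀ ζ : Ordinal.{v}, ζ ≤ o → ∀ t ∈ treeDeriv (insert [] T) ζ,
      Survives (pointFilter 𝕜 X)
        (fun v => {φ : X →L[𝕜] 𝕜 | 1 + r / 4 < RCLike.re (φ y) + RCLike.re (φ v)}) ζ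
        {φ | φ ∈ K ∧ ∀ k < t.length,
          1 + r / 2 < RCLike.re (φ (y + (σ : 𝕜) • x (t.take (k + 1))))} := by
    intro ζ
    induction ζ using WellFoundedLT.induction with
    | ind ζ ih =>
      intro hζ t ht
      refine survives_iff.2 ⟨?_, fun β hβ => ?_⟩
      · have ht0 : t ∈ insert [] T := by simpa using treeDeriv_anti _ zero_le ht
        rcases ht0 with rfl | htT
        · exact ⟨0, hK.zero_mem, by simp⟩
        · refine (hK.exists_forall_lt_re
            (fun i => y + (σ : 𝕜) • x (t.take (i + 1))) fun d hd hd1 => ?_).imp fun φ hφ => hφ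
          have h1 := hval t htT _ ⟨d, hd, hd1, rfl⟩
          have h2 : ∑ i ∈ Finset.range t.length, (d i : 𝕜) • (y + (σ : 𝕜) • x (t.take (i + 1))) =
              y + (σ : 𝕜) • ∑ i ∈ Finset.range t.length, (d i : 𝕜) • x (t.take (i + 1)) := by
            simp only [smul_add, Finset.sum_add_distrib]
            rw [← Finset.sum_smul, ← RCLike.ofReal_sum, hd1, Finset.smul_sum]
            rw [RCLike.ofReal_one, one_smul]
            exact congrArg _ (Finset.sum_congr rfl fun i _ => smul_comm _ _ _)
          rw [h2]
          linarith
      · refine frequently_pointFilter.2 fun U hU => ?_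
        obtain ⟨Z, hZ, hZf, rfl⟩ := hU
        have ht' := treeDeriv_anti _ (Order.add_one_le_iff.2 hβ) ht
        have hcl := hw β t ht'
        rw [← Set.image_image (toWeakSpace 𝕜 X) x] at hcl
        obtain ⟨_, ⟨s, ⟨hs, rfl⟩, rfl⟩, z, hz, hxz⟩ := exists_norm_sub_lt_of_zero_mem_closure hZ hZf
          hcl (lt_min one_pos (by linarith : 0 < r / 4))
        have hsT : s ∈ T := by simpa using treeDeriv_anti T zero_le hs
        have hs' : s ∈ treeDeriv (insert [] T) β := by
          rw [treeDeriv_insert_nil hT ho.2 (hβ.le.trans hζ)]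
          exact Or.inr hs
        have hsl : 0 < s.length := List.length_pos_of_ne_nil (hT.ne_nil hsT)
        -- The point played is `σ z`, with `z` in the subspace close to `x s`. The error `r / 4`
        -- lowers the threshold from `1 + r / 2` to `1 + r / 4`, and `hσR` keeps the point in the
        -- unit ball.
        refine ⟨(σ : 𝕜) • z, ⟨Z.smul_mem _ hz, ?_⟩, (ih β hβ (hβ.le.trans hζ) s hs').mono ?_⟩
        · have h1 : ‖z‖ ≤ R + 1 := by
            have h2 := norm_sub_norm_le z (x s)
            rw [norm_sub_rev] at h2
            linarith [hx s hsT, hxz.trans_le (min_le_left _ _)]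
          rw [mem_closedBall_zero_iff, norm_smul, RCLike.norm_ofReal, abs_of_nonneg hσ]
          exact (mul_le_mul_of_nonneg_left h1 hσ).trans hσR
        · rintro φ ⟨hφ, hφs⟩
          refine ⟨⟨hφ, fun k hk => ?_⟩, ?_⟩
          · rw [List.length_dropLast] at hk
            have := hφs k (by omega)
            rwa [List.dropLast_eq_take, List.take_take, min_eq_left (by omega)]
          · have h1 := hφs (s.length - 1) (by omega)
            rw [Nat.sub_add_cancel hsl, List.take_length] at h1
            have h2 : ‖φ ((σ : 𝕜) • (x s - z))‖ ≤ r / 4 := by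
              refine (φ.le_of_opNorm_le (hK.norm_le φ hφ) _).trans ?_
              rw [one_mul, norm_smul, RCLike.norm_ofReal, abs_of_nonneg hσ]
              have h3 := hxz.le.trans (min_le_right _ _)
              have h4 : σ ≤ 1 := by nlinarith
              exact (mul_le_of_le_one_left (norm_nonneg _) h4).trans h3
            have h3 := (RCLike.re_le_norm _).trans h2
            have h4 : φ (y + (σ : 𝕜) • x s) =
                φ y + φ ((σ : 𝕜) • z) + φ ((σ : 𝕜) • (x s - z)) := by
              rw [← map_add, ← map_add, smul_sub]
              congr 1
              abel
            rw [h4, map_add, map_add] at h1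
            show 1 + r / 4 < _
            linarith
  refine (key o le_rfl [] ?_).mono fun φ hφ => hφ.1
  rw [treeDeriv_insert_nil hT ho.2 le_rfl]
  exact Or.inl rfl

theorem exists_survives_of_biUnion {B I J : Type*} {F : Filter B} {P : B → Set I} {o : Ordinal.{v}}
    (t : Finset J) {S : J → Set I} (h : Survives F P o (⋃ j ∈ t, S j)) :
    ∃ j ∈ t, Survives F P o (S j) := by
  classical
  induction t using Finset.induction_on with
  | empty => simpa using h.nonempty
  | insert j t _ ih =>
    rw [Finset.set_biUnion_insert] at h
    rcases h.union with h | h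
    · exact ⟨j, Finset.mem_insert_self _ _, h⟩
    · obtain ⟨i, hi, h⟩ := ih h
      exact ⟨i, Finset.mem_insert_of_mem hi, h⟩

/-- A surviving set of functionals in the dual ball accumulates, in the weak-star topology, at a
functional all of whose neighbourhoods survive. -/
theorem exists_cluster_functional {B : Type*} {F : Filter B} {P : B → Set (X →L[𝕜] 𝕜)}
    {o : Ordinal.{v}} (hK : ∀ φ ∈ K, ‖φ‖ ≤ 1) (h : Survives F P o K) :
    ∃ φ₀ : WeakDual 𝕜 X, ∀ U ∈ 𝓝 φ₀,
      Survives F P o {φ | φ ∈ K ∧ StrongDual.toWeakDual φ ∈ U} := by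
  by_contra! hcon
  choose U hU hUS using hcon
  -- Finitely many neighbourhoods with non-surviving traces would cover the dual ball, hence `K`,
  -- against the partition property.
  obtain ⟨t, -, ht⟩ := (WeakDual.isCompact_closedBall (𝕜 := 𝕜) (E := X) 0 1).elim_nhds_subcover U
    fun φ _ => hU φ
  have hKt : K ⊆ ⋃ φ₀ ∈ t, {φ | φ ∈ K ∧ StrongDual.toWeakDual φ ∈ U φ₀} := fun φ hφ => by
    have := ht (show StrongDual.toWeakDual φ ∈ _ from by simpa using hK φ hφ)
    obtain ⟨ψ, hψ, hφψ⟩ := Set.mem_iUnion₂.1 this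
    exact Set.mem_iUnion₂.2 ⟨ψ, hψ, hφ, hφψ⟩
  obtain ⟨φ, -, hφ⟩ := exists_survives_of_biUnion t (h.mono hKt)
  exact hUS φ hφ

end Cluster

/-! ### The norm built from a winning strategy, and its flatness. -/

section Renorming

variable {𝕜 : Type*} [RCLike 𝕜] {X : Type u} [NormedAddCommGroup X] [NormedSpace 𝕜 X]
  {ξ : Ordinal.{v}} {χ : List (Ordinal.{v} × Set X) → Ordinal.{v} × Set X} {C : ℝ}

/-! ### The norm given by a winning strategy -/

theorem sum_norm_block_le (hC : 0 ≤ C) {α : ℕ → Ordinal.{v} × Set X}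
    (hα : α ∈ targetSet 𝕜 X ξ C) {x : ℕ → X} (hx : ∀ i, x i ∈ (α i).2) (φ : X →L[𝕜] 𝕜) (n : ℕ) :
    ∑ j ∈ Finset.range n, ‖φ (block 𝕜 ξ (fun i => (α i).1) x j)‖ ≤ C * ‖φ‖ := by
  rcases eq_or_ne φ 0 with rfl | hφ
  · simp
  have hφ0 : 0 < ‖φ‖ := norm_pos_iff.2 hφ
  let ψ : X →L[𝕜] 𝕜 := ((‖φ‖⁻¹ : ℝ) : 𝕜) • φ
  have hψ : ‖ψ‖ ≤ 1 := by
    rw [norm_smul, RCLike.norm_ofReal, abs_of_pos (inv_pos.2 hφ0), inv_mul_cancel₀ hφ0.ne']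
  have h1 : weakOneNorm 𝕜 (block 𝕜 ξ (fun i => (α i).1) x) ≤ ENNReal.ofReal C :=
    (le_iSup₂ (f := fun (x : ℕ → X) (_ : ∀ i, x i ∈ (α i).2) =>
      weakOneNorm 𝕜 (block 𝕜 ξ (fun i => (α i).1) x)) x hx).trans hα.2
  have h2 : ∑ j ∈ Finset.range n, ‖ψ (block 𝕜 ξ (fun i => (α i).1) x j)‖ₑ ≤ ENNReal.ofReal C :=
    ((ENNReal.sum_le_tsum _).trans (le_iSup₂ (f := fun (f : X →L[𝕜] 𝕜) (_ : ‖f‖ ≤ 1) =>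
      ∑' n, ‖f (block 𝕜 ξ (fun i => (α i).1) x n)‖ₑ) ψ hψ)).trans h1
  rw [ENNReal.le_ofReal_iff_toReal_le (by simp) hC, ENNReal.toReal_sum (by simp)] at h2
  have h3 : ∀ z, ‖ψ z‖ = ‖φ‖⁻¹ * ‖φ z‖ := fun z => by
    rw [_root_.smul_apply, norm_smul, RCLike.norm_ofReal, abs_of_pos (inv_pos.2 hφ0)]
  simp only [toReal_enorm, h3] at h2
  rwa [← Finset.mul_sum, inv_mul_le_iff₀ hφ0, mul_comm] at h2

variable (𝕜 ξ χ) in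
/-- The functionals `φ` with `‖φ‖ + ∑ |φ (block)| ≤ 1` along all plays against `χ`. -/
def strategyBody : Set (X →L[𝕜] 𝕜) :=
  {φ | ∀ α x, IsRun ξ χ α x → ∀ n,
    ‖φ‖ + ∑ j ∈ Finset.range n, ‖φ (block 𝕜 ξ (fun i => (α i).1) x j)‖ ≤ 1}

/-- Along each run the blocks cost at most `C * ‖φ‖` by the winning condition, and the norm itself
costs `‖φ‖`; hence the radius `(1 + C)⁻¹`. -/
theorem isDualBody_strategyBody (hC : 0 ≤ C)
    (hχ : IsStrategyS (GammaInf ξ).nodes (CD 𝕜 X) (singletonMoves X) χ)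
    (hwin : ∀ α ∈ bodyDot (GammaInf ξ).nodes (singletonMoves X), IsAdmissible χ α →
      α ∈ targetSet 𝕜 X ξ C) :
    IsDualBody (strategyBody 𝕜 ξ χ) (1 + C)⁻¹ where
  pos := by positivity
  norm_le φ hφ := by
    obtain ⟨α, x, hrun, -⟩ := Follows.nil.exists_isRun hχ
    simpa using hφ α x hrun 0
  mem_of_norm_le φ hφ α x hrun n := by
    have h1 := sum_norm_block_le hC (hwin α hrun.1 hrun.2.1)
      (x := x) (fun i => by rw [hrun.2.2 i]; rfl) φ n
    rw [← one_div, le_div_iff₀ (by positivity)] at hφ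
    linarith
  smul_mem φ hφ a ha α x hrun n := by
    simpa [norm_smul, ha] using hφ α x hrun n
  combo_mem φ hφ ψ hψ a b ha hb hab α x hrun n := by
    have h1 := hφ α x hrun n
    have h2 := hψ α x hrun n
    have hn : ∀ (E : Type _) [NormedAddCommGroup E] [NormedSpace 𝕜 E] (e f : E),
        ‖(a : 𝕜) • e + (b : 𝕜) • f‖ ≤ a * ‖e‖ + b * ‖f‖ := fun E _ _ e f => by
      refine (norm_add_le _ _).trans_eq ?_
      rw [norm_smul, norm_smul, RCLike.norm_ofReal, RCLike.norm_ofReal, abs_of_nonneg ha,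
        abs_of_nonneg hb]
    have hn' : ∀ e f : 𝕜, ‖(a : 𝕜) * e + (b : 𝕜) * f‖ ≤ a * ‖e‖ + b * ‖f‖ := fun e f => by
      refine (norm_add_le _ _).trans_eq ?_
      rw [norm_mul, norm_mul, RCLike.norm_ofReal, RCLike.norm_ofReal, abs_of_nonneg ha,
        abs_of_nonneg hb]
    have h3 := Finset.sum_le_sum fun j (_ : j ∈ Finset.range n) =>
      hn' (φ (block 𝕜 ξ (fun i => (α i).1) x j)) (ψ (block 𝕜 ξ (fun i => (α i).1) x j))
    rw [Finset.sum_add_distrib, ← Finset.mul_sum, ← Finset.mul_sum] at h3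
    have h4 := hn _ φ ψ
    have h5 := mul_le_mul_of_nonneg_left h1 ha
    have h6 := mul_le_mul_of_nonneg_left h2 hb
    refine (add_le_add h4 h3).trans ?_
    linarith

/-- No functional of the body can be kept alive by Player V during a block on which the functionals
gain a fixed amount. -/
theorem not_survives_strategyBody (hC : 0 ≤ C)
    (hχ : IsStrategyS (GammaInf ξ).nodes (CD 𝕜 X) (singletonMoves X) χ)
    (hwin : ∀ α ∈ bodyDot (GammaInf ξ).nodes (singletonMoves X), IsAdmissible χ α →
      α ∈ targetSet 𝕜 X ξ C) {y : X} (hy : polarSeminorm (strategyBody 𝕜 ξ χ) y ≤ 1) {r : ℝ}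
    (hr : 0 < r) :
    ¬ Survives (pointFilter 𝕜 X)
      (fun v => {φ : X →L[𝕜] 𝕜 | 1 + r / 4 < RCLike.re (φ y) + RCLike.re (φ v)}) (ω ^ ξ)
      (strategyBody 𝕜 ξ χ) := by
  intro hsurv
  have hK := isDualBody_strategyBody hC hχ hwin
  obtain ⟨φ₁, hφ₁⟩ := exists_cluster_functional hK.norm_le hsurv
  let φ₀ : X →L[𝕜] 𝕜 := WeakDual.toStrongDual φ₁
  -- The dual norm is not weak-star continuous, so it is tested at a vector `y₀`. A functional of
  -- the body close to `φ₀` at `y`, at `y₀` and on the first `n` blocks gains `1 + r / 4 - Re φ y`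
  -- on a new block, within the total budget `1`. Two errors `r / 24` against the gain `r / 4` leave
  -- more than `r / 8`.
  have step : ∀ α x, IsRun ξ χ α x → ∀ n, ∀ y₀ : X, ‖y₀‖ ≤ 1 →
      ‖φ₀ y₀‖ + ∑ j ∈ Finset.range n, ‖φ₀ (block 𝕜 ξ (fun i => (α i).1) x j)‖ ≤
        RCLike.re (φ₀ y) - r / 8 := by
    intro α x hrun n y₀ hy₀
    have hc1 : Continuous fun ψ : WeakDual 𝕜 X => RCLike.re (ψ y) :=
      RCLike.continuous_re.comp (WeakDual.eval_continuous y)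
    have hc2 : Continuous fun ψ : WeakDual 𝕜 X =>
        ‖ψ y₀‖ + ∑ j ∈ Finset.range n, ‖ψ (block 𝕜 ξ (fun i => (α i).1) x j)‖ :=
      (WeakDual.eval_continuous y₀).norm.add
        (continuous_finsetSum _ fun j _ => (WeakDual.eval_continuous _).norm)
    have hU1 := hc1.continuousAt.eventually
      (gt_mem_nhds (show RCLike.re (φ₁ y) < RCLike.re (φ₁ y) + r / 24 by linarith))
    have hU2 := (hc2.continuousAt (x := φ₁)).eventually
      (lt_mem_nhds (sub_lt_self _ (show 0 < r / 24 by positivity)))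
    obtain ⟨α', x', hrun', hseg, t, ht, hseg', φ, ⟨hφK, hφ1, hφ2⟩, hP⟩ :=
      hrun.exists_next hχ n (hφ₁ _ (hU1.and hU2))
    have hα' : ∀ i < cut ξ (fun i => (α i).1) n, α' i = α i := fun i hi => by
      have h1 := congrArg (fun l => l[i]?) hseg
      simpa [initSeg, hi] using h1
    have hblock : ∀ j < n, block 𝕜 ξ (fun i => (α' i).1) x' j =
        block 𝕜 ξ (fun i => (α i).1) x j := fun j hj => by
      refine block_congr 𝕜 hrun.1.1 ?_ (fun i hi => ?_) hj
      · rw [← map_initSeg, hseg, map_initSeg]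
      · have := hrun'.2.2 i
        rw [hα' i hi, hrun.2.2 i] at this
        exact (Set.singleton_injective this).symm
    have hcut := initSeg_cut_mem hrun.1.1 n
    have hsegn : initSeg (fun i => (α' i).1) (cut ξ (fun i => (α i).1) n) =
        initSeg (fun i => (α i).1) (cut ξ (fun i => (α i).1) n) := by
      rw [← map_initSeg, hseg, map_initSeg]
    have hlast := le_re_block (𝕜 := 𝕜) (τ := fun i => (α' i).1) (x := x') (φ := φ)
      (by rw [hsegn]; exact hcut) ht (by rw [hsegn]; exact hseg')
      (d := 1 + r / 4 - RCLike.re (φ y)) (fun j hj => by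
        have := hP j hj
        simp only [Set.mem_ofPred_eq] at this
        linarith)
    have h1 := hφK α' x' hrun' (n + 1)
    rw [Finset.sum_range_succ, Finset.sum_congr rfl fun j hj => by
      rw [hblock j (Finset.mem_range.1 hj)]] at h1
    have h2 := hlast.trans (RCLike.re_le_norm _)
    have h3 : ‖φ y₀‖ ≤ ‖φ‖ := by simpa using φ.le_opNorm_of_le hy₀
    have hφ1' : RCLike.re (φ y) < RCLike.re (φ₀ y) + r / 24 := hφ1
    have hφ2' : ‖φ₀ y₀‖ + ∑ j ∈ Finset.range n, ‖φ₀ (block 𝕜 ξ (fun i => (α i).1) x j)‖ - r / 24 <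
      ‖φ y₀‖ + ∑ j ∈ Finset.range n, ‖φ (block 𝕜 ξ (fun i => (α i).1) x j)‖ := hφ2
    linarith
  have step' : ∀ α x, IsRun ξ χ α x → ∀ n,
      ‖φ₀‖ + ∑ j ∈ Finset.range n, ‖φ₀ (block 𝕜 ξ (fun i => (α i).1) x j)‖ ≤
        RCLike.re (φ₀ y) - r / 8 := by
    intro α x hrun n
    by_contra! hlt
    obtain ⟨y₀, hy₀, h⟩ := φ₀.exists_lt_apply_of_lt_opNorm (sub_lt_iff_lt_add.2 hlt)
    have := step α x hrun n y₀ hy₀.le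
    linarith
  obtain ⟨α, x, hrun, -⟩ := Follows.nil.exists_isRun hχ
  have hm0 : 0 ≤ RCLike.re (φ₀ y) - r / 8 := by
    have := step' α x hrun 0
    rw [Finset.sum_range_zero, add_zero] at this
    exact (norm_nonneg _).trans this
  -- This value lies strictly between the bound `Re φ₀ y - r / 8` for the totals of `φ₀` and `Re φ₀
  -- y`: dividing by it gives a member of the body whose real part at `y` exceeds `1`.
  set m := RCLike.re (φ₀ y) - r / 16 with hm
  have hmpos : 0 < m := by linarith
  have hmem : ((m⁻¹ : ℝ) : 𝕜) • φ₀ ∈ strategyBody 𝕜 ξ χ := by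
    intro α x hrun n
    have h1 := step' α x hrun n
    have hn : ∀ z, ‖(((m⁻¹ : ℝ) : 𝕜) • φ₀) z‖ = m⁻¹ * ‖φ₀ z‖ := fun z => by
      rw [_root_.smul_apply, norm_smul, RCLike.norm_ofReal, abs_of_pos (inv_pos.2 hmpos)]
    simp only [hn]
    rw [norm_smul, RCLike.norm_ofReal, abs_of_pos (inv_pos.2 hmpos), ← Finset.mul_sum, ← mul_add,
      inv_mul_le_iff₀ hmpos]
    linarith
  have h1 := (RCLike.re_le_norm _).trans ((hK.norm_apply_le hmem y).trans hy)
  rw [_root_.smul_apply, _root_.smul_eq_mul, RCLike.re_ofReal_mul, inv_mul_le_iff₀ hmpos] at h1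
  linarith

/-- The zero collection on a tree of rank `ω ^ ξ` has infimum `0` when `p y = 1`. Such a tree arises
from the vacuous constraint, which survives every clock. -/
theorem modulusAt_nonneg {p : Seminorm 𝕜 X} {σ : ℝ} (hσ : 0 ≤ σ) {y : X} (hy : p y = 1) :
    0 ≤ modulusAt p ξ σ y := by
  have hs : ∀ o : Ordinal.{v}, Survives (pointFilter 𝕜 X) (fun _ => (Set.univ : Set Unit)) o
      Set.univ := fun o => by
    induction o using WellFoundedLT.induction with
    | ind o ih =>
      refine survives_iff.2 ⟨Set.univ_nonempty, fun β hβ => frequently_pointFilter.2 fun U hU =>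
        ⟨0, zero_mem_of_mem_CD hU, ?_⟩⟩
      simpa using ih β hβ
  obtain ⟨Ω, T, x, hT, hr, -, hw, -⟩ := exists_tree_of_survives 𝕜 Set.univ (by simp) (hs (ω ^ ξ))
  have hne := hr.nonempty (opow_pos _ omega0_pos)
  refine le_csSup ⟨p y + σ - 1, ?_⟩ ⟨Ω, T, fun _ => 0, hT, hr, by simp, ?_, ?_⟩
  · rintro _ ⟨Ω, T, x, hT, hr, hx, -, rfl⟩
    exact sInf_treeValues_le hσ hT (hr.nonempty (opow_pos _ omega0_pos)) hx
  · simpa using hw.smul 0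
  · have : treeValues p σ y T (fun _ => (0 : X)) = {0} := by
      obtain ⟨t, ht⟩ := hne
      refine Set.eq_singleton_iff_unique_mem.2 ⟨⟨t, ht, _, mem_branchHull_of_lt _
        (List.length_pos_of_ne_nil (hT.ne_nil ht)), by simp [hy]⟩, ?_⟩
      rintro _ ⟨t, -, z, ⟨d, -, -, rfl⟩, rfl⟩
      simp [hy]
    show (0 : ℝ) = sInf (treeValues p σ y T (fun _ => (0 : X)))
    rw [this, csInf_singleton]

/-- A winning strategy of Player S against points yields an asymptotically uniformly flat norm. -/
theorem exists_isAUF_of_playerSWins [Nontrivial X] (hC : 0 < C)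
    (h : PlayerSWins (targetSet 𝕜 X ξ C) (GammaInf ξ).nodes (CD 𝕜 X) (singletonMoves X)) :
    ∃ p : Seminorm 𝕜 X, IsEquivNorm p ∧ IsAUF p ξ := by
  obtain ⟨χ, hχ, hwin⟩ := h
  have hK := isDualBody_strategyBody hC.le hχ hwin
  set p := polarSeminorm (strategyBody 𝕜 ξ χ)
  -- Since `p x ≤ 1` gives `‖x‖ ≤ 1 + C`, the value `σ = (2 + C)⁻¹` satisfies `σ * (R + 1) = 1` for
  -- `R = 1 + C`.
  refine ⟨p, ⟨(1 + C)⁻¹, 1, hK.pos, one_pos, fun x =>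
    ⟨hK.mul_norm_le x, by simpa using hK.le_norm x⟩⟩, (2 + C)⁻¹, by positivity, ?_⟩
  have hσ : (0 : ℝ) < (2 + C)⁻¹ := by positivity
  have hle : ∀ y : X, p y ≤ 1 → ∀ a ∈ {r : ℝ | ∃ (Ω : Type (max u v)) (T : Set (List Ω))
      (x : List Ω → X), IsTree T ∧ HasRank T (ω ^ ξ) ∧ (∀ t ∈ T, p (x t) ≤ 1) ∧
      WeaklyNull.{u, v} 𝕜 T x ∧ r = sInf (treeValues p (2 + C)⁻¹ y T x)}, a ≤ 0 := by
    rintro y hy _ ⟨Ω, T, x, hT, hr, hx, hw, rfl⟩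
    by_contra! hpos
    refine not_survives_strategyBody hC.le hχ hwin hy hpos
      (hK.survives_of_weaklyNull hT hr hw (R := 1 + C) (σ := (2 + C)⁻¹) (by positivity) hσ.le ?_
        (fun t ht => ?_) hpos fun t ht z hz => ?_)
    · rw [show 1 + C + 1 = 2 + C by ring, inv_mul_cancel₀ (by positivity)]
    · have h1 := (hK.mul_norm_le (x t)).trans (hx t ht)
      rwa [inv_mul_le_iff₀ (by positivity), mul_one] at h1
    · have h1 := csInf_le bddBelow_treeValues (show _ ∈ treeValues p (2 + C)⁻¹ y T x from
        ⟨t, ht, z, hz, rfl⟩)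
      linarith
  have hAt : ∀ y : X, p y ≤ 1 → modulusAt p ξ (2 + C)⁻¹ y ≤ 0 := fun y hy =>
    Real.sSup_nonpos (hle y hy)
  refine le_antisymm (Real.sSup_nonpos ?_) ?_
  · rintro _ ⟨y, hy, rfl⟩
    exact hAt y hy
  · obtain ⟨y, hy⟩ := exists_ne (0 : X)
    have hpy : 0 < p y := (mul_pos hK.pos (norm_pos_iff.2 hy)).trans_le (hK.mul_norm_le y)
    have hp1 : p ((((p y)⁻¹ : ℝ) : 𝕜) • y) = 1 := by
      rw [map_smul_eq_mul, RCLike.norm_ofReal, abs_of_pos (inv_pos.2 hpy),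
        inv_mul_cancel₀ hpy.ne']
    refine (modulusAt_nonneg hσ.le hp1).trans (le_csSup ⟨0, ?_⟩ ⟨_, hp1.le, rfl⟩)
    rintro _ ⟨y, hy, rfl⟩
    exact hAt y hy

end Renorming

end AUFGame

/-! ### The cycle of implications. -/

theorem mainTheorem9 {𝕜 : Type*} [RCLike 𝕜] {X : Type u} [NormedAddCommGroup X] [NormedSpace 𝕜 X]
    [CompleteSpace X] (hX : ¬ FiniteDimensional 𝕜 X) (ξ : Ordinal.{v}) :
    List.TFAE
      [∃ p : Seminorm 𝕜 X, AUFGame.IsEquivNorm p ∧ AUFGame.IsAUF p ξ,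
       ∃ C : ℝ, 0 < C ∧ AUFGame.PlayerSWins (AUFGame.targetSet 𝕜 X ξ C)
         (AUFGame.GammaInf ξ).nodes (AUFGame.CD 𝕜 X) (AUFGame.compactMoves X),
       ∃ C : ℝ, 0 < C ∧ AUFGame.PlayerSWins (AUFGame.targetSet 𝕜 X ξ C)
         (AUFGame.GammaInf ξ).nodes (AUFGame.CD 𝕜 X) (AUFGame.finiteMoves X),
       ∃ C : ℝ, 0 < C ∧ AUFGame.PlayerSWins (AUFGame.targetSet 𝕜 X ξ C)
         (AUFGame.GammaInf ξ).nodes (AUFGame.CD 𝕜 X) (AUFGame.singletonMoves X)] := by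
  have hX' : Nontrivial X := by
    by_contra h
    have := not_nontrivial_iff_subsingleton.1 h
    exact hX inferInstance
  tfae_have 1 → 2 := fun ⟨p, hp, h⟩ => AUFGame.playerSWins_of_isAUF hp h
  tfae_have 2 → 3 := fun ⟨C, hC, h⟩ =>
    ⟨C, hC, h.anti fun _ hG => ⟨hG.1.isCompact, hG.2⟩⟩
  tfae_have 3 → 4 := fun ⟨C, hC, h⟩ => ⟨C, hC, h.anti fun _ ⟨x, hx, hG⟩ =>
    hG ▸ ⟨Set.finite_singleton x, Set.singleton_nonempty x, Set.singleton_subset_iff.2 hx⟩⟩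
  tfae_have 4 → 1 := fun ⟨_, hC, h⟩ => AUFGame.exists_isAUF_of_playerSWins hC h
  tfae_finish
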